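/- **Theorem 1 (Sparse Hamiltonian simulation).** A Hermitian matrix $H\in\mathbb C^{2^n\times 2^n}$ (a Hamiltonian on $n\ge 1$ qubits) is *$d$-sparse* if it has at most $d$ nonzero entries in every row and in every column; $\|H\|_{\max}$ denotes its largest entry in absolute value. A black box for $H$ is the unitary that maps $$|u\rangle|j\rangle|x\rangle|y\rangle\ \mapsto\ |u\rangle|j\rangle|x\oplus v\rangle|y\oplus h\rangle ,$$ where $v$ is the column of the $j$th nonzero entry of row $u$ (in increasing order of columns) and $h$ is the binary representation of its value $H_{uv}$; it acts as the identity if row $u$ has fewer than $j$ nonzero entries. Here $j$ is held in $\lceil\log_2 d\rceil$ qubits, and $h$ consists of a sign and $w$ magnitude bits for each of $\operatorname{Re}H_{uv}$ and $\operatorname{Im}H_{uv}$, the magnitudes being truncated to $p$ fractional bits. A circuit consists of queries to the black box and of arbitrary 2-qubit gates, acting on the $n$ system qubits and on any number of ancilla qubits. It *simulates $H$ for time $t$ within error $\epsilon$* if $$\big\|\,\mathcal C(|\psi\rangle|0\cdots0\rangle)-(e^{-iHt}|\psi\rangle)|0\cdots0\rangle\,\big\|\le\epsilon\,\||\psi\rangle\|\quad\text{for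 all } |\psi\rangle\in\mathbb C^{2^n}.$$ There is an absolute constant $C$ with the following property. Let $n\ge1$, $d,p,w\ge 0$ be integers and let $\Lambda$, $t>0$, $\epsilon>0$ be real numbers such that $$\tau:=d^2\Lambda t\ge 1,\qquad \tau/\epsilon>e,\qquad 2^p\Lambda<2^w .$$ Then there is a circuit, depending only on these parameters, that makes at most $$C\,\tau\,\frac{\log(\tau/\epsilon)}{\log\log(\tau/\epsilon)}\ \text{ queries and uses at most }\ C\,\tau\,\frac{\log^2(\tau/\epsilon)}{\log\log(\tau/\epsilon)}\,n\ \text{ additional 2-qubit gates,}$$ and that, when given the black box for $H$, simulates $H$ for time $t$ within error $\epsilon$, for every $d$-sparse Hamiltonian $H$ on $n$ qubits with $\|H\|_{\max}\le\Lambda$ (in particular with $\Lambda=\|H\|_{\max}$) whose entries are represented accurately enough, namely $d\,t\,|H_{uv}-\tilde H_{uv}|\le\epsilon/2$ for all $u,v$, where $\tilde H_{uv}$ is $H_{uv}$ with the magnitudes of its real and imaginary parts truncated to $p$ fractional bits. (This holds for every $H$ once $p$ is large, and for every $p$ if the real and imaginary parts of the entries of $H$ are multiples of $2^{-p}$.)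 -/

import Mathlib

noncomputable section

namespace HamSim

/-- At most `d` nonzero entries in every row and in every column. -/
def IsSparse {N : ℕ} (d : ℕ) (H : Matrix (Fin N) (Fin N) ℂ) : Prop :=
  (∀ u, {v | H u v ≠ 0}.ncard ≤ d) ∧ (∀ v, {u | H u v ≠ 0}.ncard ≤ d)

/-- The largest entry in absolute value. -/
def maxNorm {N : ℕ} (H : Matrix (Fin N) (Fin N) ℂ) : ℝ :=
  ⨆ q : Fin N × Fin N, ‖H q.1 q.2‖

/-! ### Fixed-point numbers -/

/-- The integer `⌊2 ^ p * |x|⌋`: the magnitude of `x`, truncated to `p` fractional bits. -/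
def magnitude (p : ℕ) (x : ℝ) : ℕ := ⌊2 ^ p * |x|⌋₊

/-- The number represented by the sign and the truncated magnitude of `x`. -/
def truncReal (p : ℕ) (x : ℝ) : ℝ :=
  (if x < 0 then -1 else 1) * ((magnitude p x : ℝ) / 2 ^ p)

/-- Truncation of the real and of the imaginary part to `p` fractional bits. -/
def trunc (p : ℕ) (z : ℂ) : ℂ := ⟨truncReal p z.re, truncReal p z.im⟩

/-! ### The black box -/

/-- The qubits on which the black box acts: an `n`-qubit row index, a `c`-qubit counter,
an `n`-qubit register for the position of the answer, and a register for its value, namely a sign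
and `w` magnitude bits both for the real and for the imaginary part.
Bit `k` has weight `2 ^ k` in each register. -/
inductive Port (n c w : ℕ) : Type
  | row (k : Fin n)
  | idx (k : Fin c)
  | pos (k : Fin n)
  | reSign
  | reMag (k : Fin w)
  | imSign
  | imMag (k : Fin w)

open Classical in
/-- The column of the nonzero entry number `j` (counted from `0`, by increasing column) in
row `u`, if there is one. -/
def nthNonzero {N : ℕ} (H : Matrix (Fin N) (Fin N) ℂ) (u : Fin N) (j : ℕ) : Option (Fin N) :=
  ((Finset.univ.filter fun v => H u v ≠ 0).sort (· ≤ ·))[j]?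

/-- The bits of the answer: position `v` and value `H u v`, truncated to `p` fractional bits, of
the nonzero entry number `j` of row `u`. All bits are `0` if there is no such entry, and no bit is
ever added to the two input registers. -/
def answer {n c w : ℕ} (p : ℕ) (H : Matrix (Fin (2 ^ n)) (Fin (2 ^ n)) ℂ)
    (u : Fin (2 ^ n)) (j : ℕ) (s : Port n c w) : Bool :=
  match nthNonzero H u j with
  | none => false
  | some v =>
    match s with
    | .row _ => false
    | .idx _ => false
    | .pos k => v.val.testBit k
    | .reSign => decide ((H u v).re < 0)
    | .reMag k => (magnitude p (H u v).re).testBit k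
    | .imSign => decide ((H u v).im < 0)
    | .imMag k => (magnitude p (H u v).im).testBit k

/-! ### Circuits -/

section Circuits

variable {n c w : ℕ} {ι : Type}

/-- One operation of a circuit whose qubits are labelled by `ι`: an arbitrary 2-qubit gate on the
qubits `a ≠ b`, or a query whose registers are the distinct qubits given by `e`. -/
inductive Op (n c w : ℕ) (ι : Type) : Type
  | gate (a b : ι) (hab : a ≠ b) (U : Matrix.unitaryGroup (Bool × Bool) ℂ)
  | query (e : Port n c w ↪ ι)

/-- The operations of a circuit, in the order in which they are applied. -/
abbrev Circuit (n c w : ℕ) (ι : Type) : Type := List (Op n c w ι)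

open Classical in
/-- The unitary `U` on the qubits `a`, `b`, and the identity on all others. -/
def gateMatrix (a b : ι) (U : Matrix (Bool × Bool) (Bool × Bool) ℂ) :
    Matrix (ι → Bool) (ι → Bool) ℂ :=
  fun x y => if ∀ q, q ≠ a → q ≠ b → x q = y q then U (x a, x b) (y a, y b) else 0

open Classical in
/-- The action of a query on basis states: the answer for the contents of the input registers is
added modulo 2 to the output registers. -/
def queryMap (p : ℕ) (H : Matrix (Fin (2 ^ n)) (Fin (2 ^ n)) ℂ) (e : Port n c w ↪ ι)
    (x : ι → Bool) : ι → Bool :=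
  fun q => xor (x q) (decide (∃ s, e s = q ∧
    answer p H (Fin.ofBits fun k => x (e (.row k))) (Nat.ofBits fun k => x (e (.idx k))) s = true))

open Classical in
def queryMatrix (p : ℕ) (H : Matrix (Fin (2 ^ n)) (Fin (2 ^ n)) ℂ) (e : Port n c w ↪ ι) :
    Matrix (ι → Bool) (ι → Bool) ℂ :=
  fun y x => if y = queryMap p H e x then 1 else 0

def Op.matrix (p : ℕ) (H : Matrix (Fin (2 ^ n)) (Fin (2 ^ n)) ℂ) :
    Op n c w ι → Matrix (ι → Bool) (ι → Bool) ℂ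
  | .gate a b _ U => gateMatrix a b U.val
  | .query e => queryMatrix p H e

/-- The operator performed by a circuit when its queries are answered for `H`, with values
truncated to `p` fractional bits. -/
def Circuit.matrix [Fintype ι] [DecidableEq ι] (p : ℕ)
    (H : Matrix (Fin (2 ^ n)) (Fin (2 ^ n)) ℂ) :
    Circuit n c w ι → Matrix (ι → Bool) (ι → Bool) ℂ
  | [] => 1
  | g :: gs => Circuit.matrix p H gs * g.matrix p H

/-- The number of queries. -/
def Circuit.queries : Circuit n c w ι → ℕ
  | [] => 0
  | .gate _ _ _ _ :: gs => Circuit.queries gs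
  | .query _ :: gs => Circuit.queries gs + 1

/-- The number of 2-qubit gates. -/
def Circuit.gates : Circuit n c w ι → ℕ
  | [] => 0
  | .gate _ _ _ _ :: gs => Circuit.gates gs + 1
  | .query _ :: gs => Circuit.gates gs

end Circuits

/-! ### Simulation -/

/-- The state `ψ ⊗ |0 ⋯ 0⟩` of `n` system qubits and `a` ancilla qubits. -/
def withAncillas {n : ℕ} (a : ℕ) (ψ : Fin (2 ^ n) → ℂ) : (Fin n ⊕ Fin a → Bool) → ℂ :=
  fun x => if ∀ k : Fin a, x (.inr k) = false then ψ (Fin.ofBits fun k => x (.inl k)) else 0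

/-- The evolution operator `exp (-i H t)`. -/
def evolution {N : ℕ} (H : Matrix (Fin N) (Fin N) ℂ) (t : ℝ) : Matrix (Fin N) (Fin N) ℂ :=
  NormedSpace.exp ((-(Complex.I * (t : ℂ))) • H)

/-- The circuit, with ancillas that start in `|0 ⋯ 0⟩` and return there, performs
`exp (-i H t)` with error at most `ε` (in the `ℓ²` norm, for every input state). -/
def Simulates {n c w a : ℕ} (p : ℕ) (K : Circuit n c w (Fin n ⊕ Fin a))
    (H : Matrix (Fin (2 ^ n)) (Fin (2 ^ n)) ℂ) (t ε : ℝ) : Prop :=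
  ∀ ψ : Fin (2 ^ n) → ℂ,
    ‖WithLp.toLp 2 ((K.matrix p H).mulVec (withAncillas a ψ)
        - withAncillas a ((evolution H t).mulVec ψ))‖ ≤ ε * ‖WithLp.toLp 2 ψ‖

end HamSim

end

/-! ### Operators on basis states: gates, queries, circuits and their costs. -/

noncomputable section

namespace HamSim

open Matrix

set_option linter.unusedSectionVars false

variable {n c w : ℕ} {ι : Type} [Fintype ι] [DecidableEq ι]

/-! ### Basis states and monomial operators -/

/-! The circuit evaluates a truncated Taylor series of the evolution operator, segment by segment,
as a linear combination of powers of one matrix that the black box provides.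

Multiplication by the Hamiltonian. Only `b` leading bits of the entries are used, with `b` at most
of order `log (τ/ε)`; this replaces `H` by a Hermitian matrix `G`. A block prepares two uniform
counters `s₁`, `s₂` of `m` bits each and a slot `l`, reads entry `s₁` of row `u` to get a column
`v`, swaps `u` with `v` and `s₁` with `s₂`, reads entry `s₂` of row `v`, and undoes the preparation.
Only branches in which the second reading leads from `v` back to `u` contribute to the part with
clean ancillas, and a nonzero entry is found by one pair of counters out of `4 ^ m`; this is the
source of the factor `d ^ 2`. A slot selects one magnitude bit with its place value as weight,
together with auxiliary signs that average to zero unless the bit is set. So the clean part of a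
block is exactly `-iG/α`, where `α ≤ 16 d² Λ` (`blockCircuit_apply`, `sum_phases`, `blockAmp_eq`,
`blockScale_le`). No arithmetic on the values is needed. A block that is switched off acts as the
identity on clean ancillas although its queries are not controlled, because its two readings cancel
(`walk_off`).

One segment. Let `h = t/r` with `αh ≤ 1/2`. A thermometer register switches on the first `k` of `K`
blocks, which yields the powers of `-iG/α` (`blocksCircuit_apply`). The Taylor coefficients sum to
less than `2`; two padding terms that cancel each other make the sum of absolute values exactly `2`.
Hence the clean part is `U/2`, where `U` is the Taylor polynomial (`lcuCircuit_apply`,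
`sum_lcuWeight_taylor`). If `E` adjoins clean ancillas and `A` is this circuit, one round of
oblivious amplitude amplification maps `E` to `EU + AE(1 - U*U)` up to a sign
(`amplification_identity`). The second term is small since `U` is close to a unitary, so the error
of a segment is `O(1/K!)` (`segment_error`).

Totals. There are `r = O(τ)` segments with `O(K)` queries each, and `K = O(log(τ/ε)/log log(τ/ε))`
makes `r/K!` small compared with `ε` (`exists_order`). Errors of segments add up (`iterate_error`),
and the errors of truncation and rounding enter through `norm_exp_sub_exp_le` and the Schur test
`l2_opNorm_le_of_sparse`. A segment uses `O(K(n + b))` gates, which gives the second logarithm in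
the gate count. -/

/-- The basis state `|x⟩`. -/
def ket (x : ι → Bool) : (ι → Bool) → ℂ := Pi.single x 1

theorem mulVec_ket_apply (M : Matrix (ι → Bool) (ι → Bool) ℂ) (x y : ι → Bool) :
    (M *ᵥ ket x) y = M y x := by
  simp [ket]

theorem ket_eq (x y : ι → Bool) : ket x y = if y = x then 1 else 0 := by
  simp [ket, Pi.single_apply]

theorem matrix_ext_ket {M N : Matrix (ι → Bool) (ι → Bool) ℂ}
    (h : ∀ x, M *ᵥ ket x = N *ᵥ ket x) : M = N := by
  ext y x
  simpa only [mulVec_ket_apply] using congrFun (h x) y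

/-- `M` maps the basis state `|x⟩` to `φ x • |g x⟩`. -/
def Mono (M : Matrix (ι → Bool) (ι → Bool) ℂ) (φ : (ι → Bool) → ℂ)
    (g : (ι → Bool) → (ι → Bool)) : Prop :=
  ∀ x, M *ᵥ ket x = φ x • ket (g x)

theorem Mono.one : Mono (1 : Matrix (ι → Bool) (ι → Bool) ℂ) (fun _ => 1) id := by
  intro x; simp

theorem Mono.mul {M N : Matrix (ι → Bool) (ι → Bool) ℂ} {φ ψ g h} (hN : Mono N ψ h)
    (hM : Mono M φ g) : Mono (N * M) (fun x => φ x * ψ (g x)) (fun x => h (g x)) := by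
  intro x
  rw [← Matrix.mulVec_mulVec, hM, Matrix.mulVec_smul, hN, smul_smul]

theorem Mono.congr {M : Matrix (ι → Bool) (ι → Bool) ℂ} {φ ψ g h} (hM : Mono M φ g)
    (h₁ : ∀ x, φ x = ψ x) (h₂ : ∀ x, g x = h x) : Mono M ψ h := by
  intro x
  rw [hM, h₁, h₂]

theorem Mono.apply {M : Matrix (ι → Bool) (ι → Bool) ℂ} {φ g} (hM : Mono M φ g)
    (x y : ι → Bool) : M y x = if y = g x then φ x else 0 := by
  have := congrFun (hM x) y
  rw [mulVec_ket_apply] at this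
  simpa [ket_eq] using this

/-- `M` does not change the qubits in `S`. -/
def Pres (S : Set ι) (M : Matrix (ι → Bool) (ι → Bool) ℂ) : Prop :=
  ∀ x y, M y x ≠ 0 → ∀ q ∈ S, y q = x q

theorem Pres.mono {S T : Set ι} {M : Matrix (ι → Bool) (ι → Bool) ℂ} (h : Pres T M)
    (hST : S ⊆ T) : Pres S M := fun x y hxy q hq => h x y hxy q (hST hq)

theorem Pres.one (S : Set ι) : Pres S (1 : Matrix (ι → Bool) (ι → Bool) ℂ) := by
  intro x y h q _
  rw [Matrix.one_apply] at h
  split_ifs at h with h'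
  · rw [h']
  · exact absurd rfl h

theorem Pres.mul {S : Set ι} {M N : Matrix (ι → Bool) (ι → Bool) ℂ} (hM : Pres S M)
    (hN : Pres S N) : Pres S (M * N) := by
  intro x y h q hq
  rw [Matrix.mul_apply] at h
  obtain ⟨z, -, hz⟩ := Finset.exists_ne_zero_of_sum_ne_zero h
  rw [hM z y (left_ne_zero_of_mul hz) q hq, hN x z (right_ne_zero_of_mul hz) q hq]

theorem Pres.conjTranspose {S : Set ι} {M : Matrix (ι → Bool) (ι → Bool) ℂ} (hM : Pres S M) :
    Pres S Mᴴ := by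
  intro x y h q hq
  refine (hM y x (fun h0 => h ?_) q hq).symm
  simp [Matrix.conjTranspose_apply, h0]

theorem Mono.pres {S : Set ι} {M : Matrix (ι → Bool) (ι → Bool) ℂ} {φ g} (hM : Mono M φ g)
    (h : ∀ x, ∀ q ∈ S, g x q = x q) : Pres S M := by
  intro x y hxy q hq
  rw [hM.apply] at hxy
  split_ifs at hxy with h'
  · rw [h', h x q hq]
  · exact absurd rfl hxy

/-! ### Gates -/

/-- Overwrites the bits `a` and `b`. -/
def setBits (a b : ι) (p : Bool × Bool) (x : ι → Bool) : ι → Bool :=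
  Function.update (Function.update x a p.1) b p.2

theorem setBits_left {a b : ι} (hab : a ≠ b) (p : Bool × Bool) (x : ι → Bool) :
    setBits a b p x a = p.1 := by simp [setBits, hab]

theorem setBits_right (a b : ι) (p : Bool × Bool) (x : ι → Bool) :
    setBits a b p x b = p.2 := by simp [setBits]

theorem setBits_of_ne {a b q : ι} (ha : q ≠ a) (hb : q ≠ b) (p : Bool × Bool) (x : ι → Bool) :
    setBits a b p x q = x q := by simp [setBits, ha, hb]

/-- Brings equality of basis states into the form of the condition in `gateMatrix`, so that the sum
over the new values of the two bits collapses to a single term. -/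
theorem eq_setBits_iff {a b : ι} (hab : a ≠ b) (p : Bool × Bool) (x y : ι → Bool) :
    y = setBits a b p x ↔ (∀ q, q ≠ a → q ≠ b → y q = x q) ∧ p = (y a, y b) := by
  constructor
  · rintro rfl
    exact ⟨fun q ha hb => setBits_of_ne ha hb p x,
      by rw [setBits_left hab, setBits_right]⟩
  · rintro ⟨h, rfl⟩
    ext q
    by_cases hb : q = b
    · subst hb; rw [setBits_right]
    by_cases ha : q = a
    · subst ha; rw [setBits_left hab]
    rw [h q ha hb, setBits_of_ne ha hb]

theorem setBits_setBits {a b : ι} (hab : a ≠ b) (p r : Bool × Bool) (x : ι → Bool) :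
    setBits a b p (setBits a b r x) = setBits a b p x := by
  rw [eq_setBits_iff hab]
  refine ⟨fun q ha hb => ?_, ?_⟩
  · rw [setBits_of_ne ha hb, setBits_of_ne ha hb]
  · rw [setBits_left hab, setBits_right]

theorem setBits_self {a b : ι} (hab : a ≠ b) (x : ι → Bool) : setBits a b (x a, x b) x = x :=
  ((eq_setBits_iff hab _ x x).2 ⟨fun _ _ _ => rfl, rfl⟩).symm

/-- Later computations with particular gates start from this expansion of a column, rather than from
matrix entries. -/
theorem gate_mulVec_ket {a b : ι} (hab : a ≠ b) (U : Matrix (Bool × Bool) (Bool × Bool) ℂ)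
    (x : ι → Bool) :
    gateMatrix a b U *ᵥ ket x = ∑ p, U p (x a, x b) • ket (setBits a b p x) := by
  funext y
  rw [mulVec_ket_apply, Finset.sum_apply]
  simp only [Pi.smul_apply, ket_eq, eq_setBits_iff hab, smul_eq_mul, mul_ite, mul_one, mul_zero,
    gateMatrix]
  by_cases h : ∀ q, q ≠ a → q ≠ b → y q = x q
  · rw [if_pos h, Finset.sum_eq_single (y a, y b), if_pos ⟨h, rfl⟩]
    · intro p _ hp
      rw [if_neg fun h' => hp h'.2]
    · simp
  · rw [if_neg h, Finset.sum_eq_zero]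
    intro p _
    rw [if_neg fun h' => h h'.1]

theorem gateMatrix_mul {a b : ι} (hab : a ≠ b) (U V : Matrix (Bool × Bool) (Bool × Bool) ℂ) :
    gateMatrix a b U * gateMatrix a b V = gateMatrix a b (U * V) := by
  apply matrix_ext_ket
  intro x
  rw [← Matrix.mulVec_mulVec, gate_mulVec_ket hab, gate_mulVec_ket hab, Matrix.mulVec_sum]
  simp only [Matrix.mulVec_smul, gate_mulVec_ket hab, setBits_left hab, setBits_right,
    setBits_setBits hab, Matrix.mul_apply, Finset.sum_smul, Finset.smul_sum, smul_smul]
  rw [Finset.sum_comm]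
  simp only [mul_comm]

theorem gateMatrix_one {a b : ι} (hab : a ≠ b) :
    gateMatrix a b (1 : Matrix (Bool × Bool) (Bool × Bool) ℂ) = 1 := by
  apply matrix_ext_ket
  intro x
  rw [gate_mulVec_ket hab, Matrix.one_mulVec, Finset.sum_eq_single (x a, x b)]
  · simp [setBits_self hab]
  · intro p _ hp; simp [hp]
  · simp

theorem gateMatrix_conjTranspose (a b : ι) (U : Matrix (Bool × Bool) (Bool × Bool) ℂ) :
    (gateMatrix a b U)ᴴ = gateMatrix a b Uᴴ := by
  ext x y
  simp only [Matrix.conjTranspose_apply, gateMatrix]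
  have : (∀ q, q ≠ a → q ≠ b → y q = x q) ↔ ∀ q, q ≠ a → q ≠ b → x q = y q :=
    ⟨fun h q ha hb => (h q ha hb).symm, fun h q ha hb => (h q ha hb).symm⟩
  by_cases h : ∀ q, q ≠ a → q ≠ b → x q = y q
  · rw [if_pos h, if_pos (this.2 h)]
  · rw [if_neg h, if_neg fun h' => h (this.1 h'), star_zero]

theorem gateMatrix_pres {a b : ι} {S : Set ι} (ha : a ∉ S) (hb : b ∉ S)
    (U : Matrix (Bool × Bool) (Bool × Bool) ℂ) : Pres S (gateMatrix a b U) := by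
  intro x y h q hq
  simp only [gateMatrix] at h
  split_ifs at h with h'
  · exact h' q (fun e => ha (e ▸ hq)) (fun e => hb (e ▸ hq))
  · exact absurd rfl h

/-! ### Queries -/

variable (p : ℕ) (H : Matrix (Fin (2 ^ n)) (Fin (2 ^ n)) ℂ)

/-- The answer of the black box, as a function of the contents of its input registers. -/
def reply (e : Port n c w ↪ ι) (x : ι → Bool) (s : Port n c w) : Bool :=
  answer p H (Fin.ofBits fun k => x (e (.row k))) (Nat.ofBits fun k => x (e (.idx k))) s

theorem answer_row (u : Fin (2 ^ n)) (j : ℕ) (k : Fin n) :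
    answer p H u j (.row k : Port n c w) = false := by
  unfold answer; split <;> rfl

theorem answer_idx (u : Fin (2 ^ n)) (j : ℕ) (k : Fin c) :
    answer p H u j (.idx k : Port n c w) = false := by
  unfold answer; split <;> rfl

theorem queryMap_port (e : Port n c w ↪ ι) (x : ι → Bool) (s : Port n c w) :
    queryMap p H e x (e s) = xor (x (e s)) (reply p H e x s) := by
  have : (∃ s', e s' = e s ∧ answer p H (Fin.ofBits fun k => x (e (.row k)))
      (Nat.ofBits fun k => x (e (.idx k))) s' = true) ↔ reply p H e x s = true :=
    ⟨fun ⟨s', h, h'⟩ => by rw [e.injective h] at h'; exact h', fun h => ⟨s, rfl, h⟩⟩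
  simp only [queryMap, this]
  simp

theorem queryMap_of_notMem (e : Port n c w ↪ ι) (x : ι → Bool) {q : ι} (hq : ∀ s, e s ≠ q) :
    queryMap p H e x q = x q := by
  have : ¬ ∃ s, e s = q ∧ answer p H (Fin.ofBits fun k => x (e (.row k)))
      (Nat.ofBits fun k => x (e (.idx k))) s = true := fun ⟨s, h, _⟩ => hq s h
  simp only [queryMap, this]
  simp

theorem reply_congr (e : Port n c w ↪ ι) {x y : ι → Bool}
    (hr : ∀ k, x (e (.row k)) = y (e (.row k))) (hi : ∀ k, x (e (.idx k)) = y (e (.idx k))) :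
    reply p H e x = reply p H e y := by
  funext s
  simp only [reply, hr, hi]

/-- A query never changes its own input registers, so a second query gives the same answer. This
makes a query an involution. -/
theorem reply_queryMap (e : Port n c w ↪ ι) (x : ι → Bool) :
    reply p H e (queryMap p H e x) = reply p H e x := by
  apply reply_congr <;> intro k <;> rw [queryMap_port]
  · simp [reply, answer_row]
  · simp [reply, answer_idx]

theorem queryMap_queryMap (e : Port n c w ↪ ι) (x : ι → Bool) :
    queryMap p H e (queryMap p H e x) = x := by
  funext q
  by_cases hq : ∃ s, e s = q
  · obtain ⟨s, rfl⟩ := hq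
    rw [queryMap_port, reply_queryMap, queryMap_port]
    simp
  · push Not at hq
    rw [queryMap_of_notMem _ _ _ _ hq, queryMap_of_notMem _ _ _ _ hq]

theorem query_mono (e : Port n c w ↪ ι) :
    Mono (queryMatrix p H e) (fun _ => 1) (queryMap p H e) := by
  intro x
  funext y
  rw [mulVec_ket_apply]
  simp [queryMatrix, ket_eq]

theorem queryMatrix_conjTranspose (e : Port n c w ↪ ι) :
    (queryMatrix p H e)ᴴ = queryMatrix p H e := by
  ext x y
  simp only [Matrix.conjTranspose_apply, queryMatrix]
  have : y = queryMap p H e x ↔ x = queryMap p H e y :=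
    ⟨fun h => by rw [h, queryMap_queryMap], fun h => by rw [h, queryMap_queryMap]⟩
  by_cases h : x = queryMap p H e y
  · rw [if_pos h, if_pos (this.2 h)]; simp
  · rw [if_neg h, if_neg fun h' => h (this.1 h')]; simp

/-! ### Circuits -/

/-- The inverse operation. -/
def Op.inv : Op n c w ι → Op n c w ι
  | .gate a b hab U => .gate a b hab U⁻¹
  | .query e => .query e

theorem Op.matrix_inv (g : Op n c w ι) : g.inv.matrix p H = (g.matrix p H)ᴴ := by
  cases g with
  | gate a b hab U =>
    simp only [Op.inv, Op.matrix, gateMatrix_conjTranspose]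
    rfl
  | query e => simp only [Op.inv, Op.matrix, queryMatrix_conjTranspose]

theorem Op.conjTranspose_mul_matrix (g : Op n c w ι) :
    (g.matrix p H)ᴴ * g.matrix p H = 1 := by
  cases g with
  | gate a b hab U =>
    simp only [Op.matrix, gateMatrix_conjTranspose]
    rw [gateMatrix_mul hab, ← gateMatrix_one hab]
    congr 1
    exact Matrix.mem_unitaryGroup_iff'.1 U.2
  | query e =>
    simp only [Op.matrix, queryMatrix_conjTranspose]
    apply matrix_ext_ket
    intro x
    rw [((query_mono p H e).mul (query_mono p H e)) x]
    simp [queryMap_queryMap]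

/-- The inverse circuit. -/
def Circuit.inv (K : Circuit n c w ι) : Circuit n c w ι := (K.map Op.inv).reverse

@[simp] theorem Circuit.matrix_nil : Circuit.matrix p H ([] : Circuit n c w ι) = 1 := rfl

@[simp] theorem Circuit.matrix_cons (g : Op n c w ι) (K : Circuit n c w ι) :
    Circuit.matrix p H (g :: K) = Circuit.matrix p H K * g.matrix p H := rfl

theorem Circuit.matrix_append (K L : Circuit n c w ι) :
    Circuit.matrix p H (K ++ L) = Circuit.matrix p H L * Circuit.matrix p H K := by
  induction K with
  | nil => simp
  | cons g K ih => simp [ih, Matrix.mul_assoc]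

theorem Circuit.matrix_inv (K : Circuit n c w ι) :
    Circuit.matrix p H K.inv = (Circuit.matrix p H K)ᴴ := by
  induction K with
  | nil => simp [Circuit.inv]
  | cons g K ih =>
    have : Circuit.inv (g :: K) = Circuit.inv K ++ [g.inv] := by simp [Circuit.inv]
    rw [this, Circuit.matrix_append, ih]
    simp [Op.matrix_inv, Matrix.conjTranspose_mul]

theorem Circuit.conjTranspose_mul_matrix (K : Circuit n c w ι) :
    (Circuit.matrix p H K)ᴴ * Circuit.matrix p H K = 1 := by
  induction K with
  | nil => simp
  | cons g K ih =>
    rw [Circuit.matrix_cons, Matrix.conjTranspose_mul, Matrix.mul_assoc,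
      ← Matrix.mul_assoc _ (Circuit.matrix p H K), ih, Matrix.one_mul,
      Op.conjTranspose_mul_matrix]

section Counts

@[simp] theorem Circuit.queries_nil : Circuit.queries ([] : Circuit n c w ι) = 0 := rfl

@[simp] theorem Circuit.gates_nil : Circuit.gates ([] : Circuit n c w ι) = 0 := rfl

@[simp] theorem Circuit.queries_gate (a b : ι) (hab U) (K : Circuit n c w ι) :
    Circuit.queries (Op.gate a b hab U :: K) = K.queries := rfl

@[simp] theorem Circuit.gates_gate (a b : ι) (hab U) (K : Circuit n c w ι) :
    Circuit.gates (Op.gate a b hab U :: K) = K.gates + 1 := rfl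

@[simp] theorem Circuit.queries_query (e) (K : Circuit n c w ι) :
    Circuit.queries (Op.query e :: K) = K.queries + 1 := rfl

@[simp] theorem Circuit.gates_query (e) (K : Circuit n c w ι) :
    Circuit.gates (Op.query e :: K) = K.gates := rfl

@[simp] theorem Circuit.queries_append (K L : Circuit n c w ι) :
    Circuit.queries (K ++ L) = K.queries + Circuit.queries L := by
  induction K with
  | nil => simp
  | cons g K ih => cases g <;> simp [ih]; omega

@[simp] theorem Circuit.gates_append (K L : Circuit n c w ι) :
    Circuit.gates (K ++ L) = K.gates + Circuit.gates L := by
  induction K with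
  | nil => simp
  | cons g K ih => cases g <;> simp [ih]; omega

@[simp] theorem Circuit.queries_inv (K : Circuit n c w ι) : K.inv.queries = K.queries := by
  induction K with
  | nil => simp [Circuit.inv]
  | cons g K ih =>
    have : Circuit.inv (g :: K) = Circuit.inv K ++ [g.inv] := by simp [Circuit.inv]
    rw [this, Circuit.queries_append, ih]
    cases g <;> simp [Op.inv]

@[simp] theorem Circuit.gates_inv (K : Circuit n c w ι) : K.inv.gates = K.gates := by
  induction K with
  | nil => simp [Circuit.inv]
  | cons g K ih =>
    have : Circuit.inv (g :: K) = Circuit.inv K ++ [g.inv] := by simp [Circuit.inv]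
    rw [this, Circuit.gates_append, ih]
    cases g <;> simp [Op.inv]

theorem Circuit.queries_flatMap {α : Type*} (l : List α) (f : α → Circuit n c w ι) {m : ℕ}
    (h : ∀ a ∈ l, (f a).queries = m) : Circuit.queries (l.flatMap f) = l.length * m := by
  induction l with
  | nil => simp
  | cons a l ih =>
    simp only [List.flatMap_cons, Circuit.queries_append, List.length_cons]
    rw [h a (by simp), ih fun b hb => h b (by simp [hb])]
    ring

theorem Circuit.gates_flatMap {α : Type*} (l : List α) (f : α → Circuit n c w ι) {m : ℕ}
    (h : ∀ a ∈ l, (f a).gates = m) : Circuit.gates (l.flatMap f) = l.length * m := by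
  induction l with
  | nil => simp
  | cons a l ih =>
    simp only [List.flatMap_cons, Circuit.gates_append, List.length_cons]
    rw [h a (by simp), ih fun b hb => h b (by simp [hb])]
    ring

end Counts

end HamSim

end

/-! ### Elementary gates, commuting families of gates, and uniform superpositions. -/

noncomputable section

namespace HamSim

open Matrix

set_option linter.unusedSectionVars false

variable {n c w : ℕ} {ι : Type} [Fintype ι] [DecidableEq ι]
variable (p : ℕ) (H : Matrix (Fin (2 ^ n)) (Fin (2 ^ n)) ℂ)

/-! ### Elementary gates -/

/-- A diagonal 2-qubit unitary. -/
def diagUnitary (φ : Bool → Bool → ℂ) (hφ : ∀ r s, ‖φ r s‖ = 1) :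
    Matrix.unitaryGroup (Bool × Bool) ℂ :=
  ⟨Matrix.diagonal fun q => φ q.1 q.2, by
    rw [Matrix.mem_unitaryGroup_iff', Matrix.star_eq_conjTranspose, Matrix.diagonal_conjTranspose,
      Matrix.diagonal_mul_diagonal, ← Matrix.diagonal_one]
    congr 1
    funext q
    have := Complex.conj_mul' (φ q.1 q.2)
    simpa [hφ] using this⟩

/-- The gate that multiplies by a phase which depends on two qubits. -/
def diagOp (a b : ι) (hab : a ≠ b) (φ : Bool → Bool → ℂ) (hφ : ∀ r s, ‖φ r s‖ = 1) :
    Op n c w ι := .gate a b hab (diagUnitary φ hφ)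

theorem diagOp_mono (a b : ι) (hab : a ≠ b) (φ : Bool → Bool → ℂ) (hφ : ∀ r s, ‖φ r s‖ = 1) :
    Mono ((diagOp (n := n) (c := c) (w := w) a b hab φ hφ).matrix p H)
      (fun x => φ (x a) (x b)) id := by
  intro x
  simp only [diagOp, Op.matrix, diagUnitary]
  rw [gate_mulVec_ket hab, Finset.sum_eq_single (x a, x b)]
  · simp [setBits_self hab]
  · intro q _ hq
    rw [Matrix.diagonal_apply_ne _ hq, zero_smul]
  · simp

/-- The controlled NOT, with the control first. -/
def cnotUnitary : Matrix.unitaryGroup (Bool × Bool) ℂ :=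
  ⟨Matrix.of fun r q => if r = (q.1, xor q.2 q.1) then 1 else 0, by
    rw [Matrix.mem_unitaryGroup_iff']
    ext ⟨a, b⟩ ⟨a', b'⟩
    cases a <;> cases b <;> cases a' <;> cases b' <;>
      simp [Matrix.mul_apply, Matrix.star_apply, Matrix.of_apply]⟩

/-- The controlled NOT with control `a` and target `b`. -/
def cnotOp (a b : ι) (hab : a ≠ b) : Op n c w ι := .gate a b hab cnotUnitary

theorem cnotOp_mono (a b : ι) (hab : a ≠ b) :
    Mono ((cnotOp (n := n) (c := c) (w := w) a b hab).matrix p H) (fun _ => 1)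
      (fun x => Function.update x b (xor (x b) (x a))) := by
  intro x
  simp only [cnotOp, Op.matrix, cnotUnitary]
  rw [gate_mulVec_ket hab, Finset.sum_eq_single (x a, xor (x b) (x a))]
  · simp [setBits]
  · intro q _ hq
    simp [hq]
  · simp

/-- The NOT gate on the qubit `a`. -/
def notUnitary : Matrix.unitaryGroup (Bool × Bool) ℂ :=
  ⟨Matrix.of fun r q => if r = (!q.1, q.2) then 1 else 0, by
    rw [Matrix.mem_unitaryGroup_iff']
    ext ⟨a, b⟩ ⟨a', b'⟩
    cases a <;> cases b <;> cases a' <;> cases b' <;>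
      simp [Matrix.mul_apply, Matrix.star_apply, Matrix.of_apply]⟩

/-- The NOT gate on the qubit `a`. -/
def notOp (a b : ι) (hab : a ≠ b) : Op n c w ι := .gate a b hab notUnitary

theorem notOp_mono (a b : ι) (hab : a ≠ b) :
    Mono ((notOp (n := n) (c := c) (w := w) a b hab).matrix p H) (fun _ => 1)
      (fun x => Function.update x a (!x a)) := by
  intro x
  simp only [notOp, Op.matrix, notUnitary]
  rw [gate_mulVec_ket hab, Finset.sum_eq_single (!x a, x b)]
  · congr 2
    · simp
    symm
    rw [eq_setBits_iff hab]
    simp +contextual [hab.symm]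
  · intro q _ hq
    simp [hq]
  · simp

/-- `1` or `-1`. -/
def sgn (b : Bool) : ℂ := if b then -1 else 1

theorem norm_sgn (b : Bool) : ‖sgn b‖ = 1 := by cases b <;> simp [sgn]

/-- The Hadamard gate on the first of two qubits. -/
def hadUnitary : Matrix.unitaryGroup (Bool × Bool) ℂ :=
  ⟨Matrix.of fun r q => if r.2 = q.2 then ((Real.sqrt 2)⁻¹ : ℝ) * sgn (r.1 && q.1) else 0, by
    have h : ((Real.sqrt 2 : ℝ) : ℂ)⁻¹ * ((Real.sqrt 2 : ℝ) : ℂ)⁻¹ = 2⁻¹ := by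
      rw [← mul_inv, ← Complex.ofReal_mul, Real.mul_self_sqrt (by norm_num)]; norm_num
    rw [Matrix.mem_unitaryGroup_iff']
    ext ⟨a, b⟩ ⟨a', b'⟩
    cases a <;> cases b <;> cases a' <;> cases b' <;>
      simp [Matrix.mul_apply, Fintype.sum_prod_type, Matrix.star_apply, sgn, h] <;> norm_num⟩

/-- The Hadamard gate on the qubit `a`. -/
def hadOp (a b : ι) (hab : a ≠ b) : Op n c w ι := .gate a b hab hadUnitary

theorem hadOp_mulVec (a b : ι) (hab : a ≠ b) (x : ι → Bool) :
    (hadOp (n := n) (c := c) (w := w) a b hab).matrix p H *ᵥ ket x =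
      (((Real.sqrt 2)⁻¹ : ℝ) : ℂ) • (ket (Function.update x a false) +
        sgn (x a) • ket (Function.update x a true)) := by
  have h : ∀ r : Bool, setBits a b (r, x b) x = Function.update x a r := by
    intro r
    symm
    rw [eq_setBits_iff hab]
    simp +contextual [hab.symm]
  simp only [hadOp, Op.matrix, hadUnitary]
  rw [gate_mulVec_ket hab, Fintype.sum_prod_type]
  cases hb : x b <;> simp [hb, ← h, sgn, add_comm]

/-- A bit flip, controlled by a function of the other qubits. -/
theorem hadOp_conj_mono {M : Matrix (ι → Bool) (ι → Bool) ℂ} {f : (ι → Bool) → Bool} {t d : ι}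
    (htd : t ≠ d) (hM : Mono M (fun x => sgn (x t && f x)) id)
    (hf : ∀ x r, f (Function.update x t r) = f x) :
    Mono ((hadOp (n := n) (c := c) (w := w) t d htd).matrix p H * (M *
        (hadOp (n := n) (c := c) (w := w) t d htd).matrix p H)) (fun _ => 1)
      (fun x => Function.update x t (xor (x t) (f x))) := by
  intro x
  have h : ((Real.sqrt 2 : ℝ) : ℂ)⁻¹ * ((Real.sqrt 2 : ℝ) : ℂ)⁻¹ = 2⁻¹ := by
    rw [← mul_inv, ← Complex.ofReal_mul, Real.mul_self_sqrt (by norm_num)]; norm_num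
  rw [← Matrix.mulVec_mulVec, ← Matrix.mulVec_mulVec, hadOp_mulVec]
  simp only [Matrix.mulVec_smul, Matrix.mulVec_add, hM _, id, hadOp_mulVec, hf,
    Function.update_self, Function.update_idem, smul_add, smul_smul, one_smul]
  cases x t <;> cases f x <;> simp [sgn, h] <;> module

/-- The phase `z` if both bits are set. -/
def phaseAnd (z : ℂ) (r s : Bool) : ℂ := if r && s then z else 1

theorem norm_phaseAnd {z : ℂ} (hz : ‖z‖ = 1) (r s : Bool) : ‖phaseAnd z r s‖ = 1 := by
  unfold phaseAnd; split_ifs <;> simp [hz]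

/-- Adds the conjunction (`o = false`) or the disjunction (`o = true`) of the qubits `a`, `b` to the
qubit `t`. -/
def logicCircuit (o : Bool) (a b t : ι) (hab : a ≠ b) (hat : a ≠ t) (hbt : b ≠ t) :
    Circuit n c w ι :=
  [hadOp t a hat.symm,
    diagOp a t hat (phaseAnd Complex.I) (norm_phaseAnd Complex.norm_I),
    diagOp b t hbt (phaseAnd Complex.I) (norm_phaseAnd Complex.norm_I),
    cnotOp a b hab,
    diagOp b t hbt (phaseAnd (if o then Complex.I else -Complex.I))
      (norm_phaseAnd (by split_ifs <;> simp)),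
    cnotOp a b hab,
    hadOp t a hat.symm]

/-- As integers, `a + b - (a ⊕ b) = 2(a ∧ b)` and `a + b + (a ⊕ b) = 2(a ∨ b)`. Three controlled
powers of `i` therefore produce the sign of the conjunction or disjunction, and conjugation by
Hadamard gates on the target turns this sign into a bit flip. -/
theorem logicCircuit_mono (o : Bool) (a b t : ι) (hab : a ≠ b) (hat : a ≠ t) (hbt : b ≠ t) :
    Mono (Circuit.matrix p H (logicCircuit (n := n) (c := c) (w := w) o a b t hab hat hbt))
      (fun _ => 1)
      (fun x => Function.update x t (xor (x t) (if o then x a || x b else x a && x b))) := by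
  simp only [logicCircuit, Circuit.matrix_cons, Circuit.matrix_nil, one_mul]
  rw [Matrix.mul_assoc]
  have hX := cnotOp_mono (c := c) (w := w) p H a b hab
  have hD₁ := diagOp_mono (c := c) (w := w) p H a t hat (phaseAnd Complex.I)
    (norm_phaseAnd Complex.norm_I)
  have hD₂ := diagOp_mono (c := c) (w := w) p H b t hbt (phaseAnd Complex.I)
    (norm_phaseAnd Complex.norm_I)
  have hD₃ := diagOp_mono (c := c) (w := w) p H b t hbt
    (phaseAnd (if o then Complex.I else -Complex.I)) (norm_phaseAnd (by split_ifs <;> simp))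
  have key := (((hX.mul hD₃).mul hX).mul hD₂).mul hD₁
  have := hadOp_conj_mono (c := c) (w := w) p H
    (f := fun x => if o then x a || x b else x a && x b) hat.symm
    (key.congr (ψ := fun x => sgn (x t && (if o then x a || x b else x a && x b))) ?_ ?_) ?_
  · simpa only [Matrix.mul_assoc] using this
  · intro x
    simp only [id, phaseAnd, Function.update_self, Function.update_of_ne hbt.symm, sgn]
    have : ∀ α β γ : Bool, (if α && γ then Complex.I else 1) *
        ((if β && γ then Complex.I else 1) * (1 * ((if (xor β α) && γ then
          if o then Complex.I else -Complex.I else 1) * 1))) =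
        if γ && (if o then α || β else α && β) then -1 else (1 : ℂ) := by
      intro α β γ
      cases α <;> cases β <;> cases γ <;> cases o <;> simp
    exact this _ _ _
  · intro x
    funext q
    by_cases hq : q = b
    · subst hq; simp [Function.update_of_ne hab]
    · simp [hq]
  · intro x r
    simp [Function.update_of_ne hat, Function.update_of_ne hbt]

@[simp] theorem logicCircuit_queries (o : Bool) (a b t : ι) (hab hat hbt) :
    Circuit.queries (logicCircuit (n := n) (c := c) (w := w) o a b t hab hat hbt) = 0 := rfl

@[simp] theorem logicCircuit_gates (o : Bool) (a b t : ι) (hab hat hbt) :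
    Circuit.gates (logicCircuit (n := n) (c := c) (w := w) o a b t hab hat hbt) = 7 := rfl

/-! ### Families of commuting gates -/

open Classical in
/-- The value of `f k` is added to the qubit `t k`, for all `k` in a list. -/
def xorFamily {α : Type} (l : List α) (t : α → ι) (f : α → (ι → Bool) → Bool) (x : ι → Bool) :
    ι → Bool :=
  fun q => xor (x q) (decide (∃ k ∈ l, t k = q ∧ f k x = true))

theorem xorFamily_target {α : Type} {l : List α} {t : α → ι} (ht : Function.Injective t)
    (f : α → (ι → Bool) → Bool) (x : ι → Bool) {k : α} (hk : k ∈ l) :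
    xorFamily l t f x (t k) = xor (x (t k)) (f k x) := by
  have : (∃ k' ∈ l, t k' = t k ∧ f k' x = true) ↔ f k x = true :=
    ⟨fun ⟨k', _, h, h'⟩ => by rwa [ht h] at h', fun h => ⟨k, hk, rfl, h⟩⟩
  simp only [xorFamily, this]
  simp

theorem xorFamily_of_ne {α : Type} {l : List α} {t : α → ι} (f : α → (ι → Bool) → Bool)
    (x : ι → Bool) {q : ι} (hq : ∀ k ∈ l, t k ≠ q) : xorFamily l t f x q = x q := by
  have : ¬ ∃ k' ∈ l, t k' = q ∧ f k' x = true := fun ⟨k', hk', h, _⟩ => hq k' hk' h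
  simp only [xorFamily, this]
  simp

/-- The targets are distinct and no `f k` depends on any target, so every gate still sees the
original values and the order of the list is irrelevant. -/
theorem xorFamily_mono {α : Type} {l : List α} (hl : l.Nodup) {t : α → ι}
    (ht : Function.Injective t) {f : α → (ι → Bool) → Bool} {F : α → Circuit n c w ι}
    (hF : ∀ k ∈ l, Mono (Circuit.matrix p H (F k)) (fun _ => 1)
      (fun x => Function.update x (t k) (xor (x (t k)) (f k x))))
    (hf : ∀ k k' x r, f k (Function.update x (t k') r) = f k x) :
    Mono (Circuit.matrix p H (l.flatMap F)) (fun _ => 1) (xorFamily l t f) := by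
  induction l with
  | nil =>
    refine Mono.one.congr (fun _ => rfl) fun x => ?_
    funext q
    rw [xorFamily_of_ne] <;> simp
  | cons a l ih =>
    rw [List.flatMap_cons, Circuit.matrix_append]
    have hl' := List.nodup_cons.1 hl
    refine ((ih hl'.2 fun k hk => hF k (by simp [hk])).mul (hF a (by simp))).congr
      (fun _ => by simp) fun x => ?_
    funext q
    by_cases hq : ∃ k ∈ l, t k = q
    · obtain ⟨k, hk, rfl⟩ := hq
      have hka : k ≠ a := fun e => hl'.1 (e ▸ hk)
      rw [xorFamily_target ht _ _ hk, xorFamily_target ht _ _ (List.mem_cons_of_mem _ hk), hf,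
        Function.update_of_ne (ht.ne hka)]
    · push Not at hq
      rw [xorFamily_of_ne _ _ hq]
      by_cases hqa : t a = q
      · subst hqa
        rw [xorFamily_target ht _ _ (by simp)]
        simp
      · rw [Function.update_of_ne (Ne.symm hqa), xorFamily_of_ne]
        intro k hk
        rcases List.mem_cons.1 hk with rfl | hk
        · exact hqa
        · exact hq k hk

theorem diagFamily_mono {α : Type} (l : List α) {φ : α → (ι → Bool) → ℂ}
    {F : α → Circuit n c w ι} (hF : ∀ k, Mono (Circuit.matrix p H (F k)) (φ k) id) :
    Mono (Circuit.matrix p H (l.flatMap F)) (fun x => (l.map fun k => φ k x).prod) id := by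
  induction l with
  | nil => exact Mono.one.congr (fun _ => by simp) fun _ => rfl
  | cons a l ih =>
    rw [List.flatMap_cons, Circuit.matrix_append]
    exact (ih.mul (hF a)).congr (fun x => by simp) fun _ => rfl

/-! ### Uniform superpositions -/

/-- Hadamard gates on the qubits of a list. -/
def hadCircuit (d : ι) (l : List ι) : Circuit n c w ι :=
  l.flatMap fun a => if h : a = d then [] else [hadOp a d h]

/-- The first Hadamard gate creates two branches; the later ones do not touch its qubit, so the bit
`y a` decides which branch can reach `y`. The qubit `d` only completes each gate to a 2-qubit gate.
-/
theorem hadCircuit_apply (d : ι) (l : List ι) (hl : l.Nodup) (hd : d ∉ l) (x y : ι → Bool)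
    (hx : ∀ q ∈ l, x q = false) :
    (Circuit.matrix p H (hadCircuit (n := n) (c := c) (w := w) d l) *ᵥ ket x) y =
      if ∀ q, q ∉ l → y q = x q then (((Real.sqrt 2)⁻¹ : ℝ) : ℂ) ^ l.length else 0 := by
  induction l generalizing x with
  | nil =>
    simp only [hadCircuit, List.flatMap_nil, Circuit.matrix_nil, Matrix.one_mulVec, ket_eq]
    simp [funext_iff]
  | cons a l ih =>
    have hl' := List.nodup_cons.1 hl
    have had : a ≠ d := fun e => hd (e ▸ by simp)
    have hc : hadCircuit (n := n) (c := c) (w := w) d (a :: l) =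
        hadOp a d had :: hadCircuit d l := by
      simp [hadCircuit, had]
    have hxa : x a = false := hx a (by simp)
    have hupd : Function.update x a false = x := by rw [← hxa, Function.update_eq_self]
    rw [hc, Circuit.matrix_cons, ← Matrix.mulVec_mulVec, hadOp_mulVec, hxa,
      hupd]
    simp only [sgn, Bool.false_eq_true, if_false, one_smul, Matrix.mulVec_smul, Matrix.mulVec_add,
      Pi.smul_apply, Pi.add_apply]
    have hd' : d ∉ l := fun h => hd (by simp [h])
    rw [ih hl'.2 hd' x fun q hq => hx q (by simp [hq]),
      ih hl'.2 hd' (Function.update x a true) fun q hq => by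
        rw [Function.update_of_ne (fun e => hl'.1 (by rwa [e] at hq))]; exact hx q (by simp [hq])]
    by_cases h : ∀ q, q ∉ a :: l → y q = x q
    · rw [if_pos h]
      cases hya : y a
      · rw [if_pos, if_neg]
        · simp [pow_succ']
        · intro h'
          have := h' a hl'.1
          simp [hya] at this
        · intro q hq
          by_cases hqa : q = a
          · rw [hqa, hya, hxa]
          · exact h q (by simp [hq, hqa])
      · rw [if_neg, if_pos]
        · simp [pow_succ']
        · intro q hq
          by_cases hqa : q = a
          · rw [hqa, hya]; simp
          · rw [Function.update_of_ne hqa]; exact h q (by simp [hq, hqa])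
        · intro h'
          have := h' a hl'.1
          simp [hya, hxa] at this
    · rw [if_neg h, if_neg, if_neg]
      · simp
      · intro h'
        refine h fun q hq => ?_
        have := h' q fun hq' => hq (by simp [hq'])
        rwa [Function.update_of_ne (fun e => hq (by simp [e]))] at this
      · intro h'
        exact h fun q hq => h' q fun hq' => hq (by simp [hq'])

/-- Reduces a sum over all basis states to the qubits in the range of `e` when the summand forces
the others to agree with `x`. It contracts products of blocks to products of matrices on the system
register. -/
theorem sum_extend {α : Type} [Fintype α] [DecidableEq α] {R : Type*} [AddCommMonoid R]
    {e : α → ι} (he : Function.Injective e) (x : ι → Bool) (F : (ι → Bool) → R)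
    (hF : ∀ z, F z ≠ 0 → ∀ q, (∀ k, e k ≠ q) → z q = x q) :
    ∑ z, F z = ∑ s : α → Bool, F (Function.extend e s x) := by
  symm
  apply Finset.sum_of_injOn (fun s => Function.extend e s x)
  · intro s _ s' _ h
    funext k
    have := congrFun h (e k)
    simpa [he.extend_apply] using this
  · simp
  · intro z _ hz
    by_contra h0
    apply hz
    refine ⟨fun k => z (e k), by simp, ?_⟩
    funext q
    by_cases hq : ∃ k, e k = q
    · obtain ⟨k, rfl⟩ := hq
      simp [he.extend_apply]
    · simp only [Function.extend_apply' _ _ _ hq]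
      push Not at hq
      exact (hF z h0 q hq).symm
  · intro s _; rfl

theorem hadCircuit_mulVec {α : Type} [Fintype α] [DecidableEq α] {e : α → ι}
    (he : Function.Injective e) (d : ι) (l : List ι) (hl : l.Nodup) (hd : d ∉ l)
    (hle : ∀ q, q ∈ l ↔ ∃ k, e k = q) (x : ι → Bool) (hx : ∀ k, x (e k) = false) :
    Circuit.matrix p H (hadCircuit (n := n) (c := c) (w := w) d l) *ᵥ ket x =
      (((Real.sqrt 2)⁻¹ : ℝ) : ℂ) ^ l.length • ∑ s : α → Bool, ket (Function.extend e s x) := by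
  funext y
  have hx' : ∀ q ∈ l, x q = false := by
    intro q hq
    obtain ⟨k, rfl⟩ := (hle q).1 hq
    exact hx k
  rw [hadCircuit_apply p H d l hl hd x y hx', Pi.smul_apply,
    Finset.sum_apply]
  simp only [ket_eq, smul_eq_mul]
  by_cases h : ∀ q, q ∉ l → y q = x q
  · have hy : y = Function.extend e (fun k => y (e k)) x := by
      funext q
      by_cases hq : ∃ k, e k = q
      · obtain ⟨k, rfl⟩ := hq
        simp [he.extend_apply]
      · rw [Function.extend_apply' _ _ _ hq]
        exact h q fun hq' => hq ((hle q).1 hq')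
    rw [if_pos h, Finset.sum_eq_single (fun k => y (e k))]
    · rw [if_pos hy, mul_one]
    · intro s _ hs
      refine if_neg fun e' => hs ?_
      funext k
      rw [e', he.extend_apply]
    · simp
  · rw [if_neg h, Finset.sum_eq_zero, mul_zero]
    intro s _
    refine if_neg fun e' => h fun q hq => ?_
    rw [e', Function.extend_apply' _ _ _ fun hq' => hq ((hle q).2 hq')]

end HamSim

end

/-! ### Preparation of unary registers, and reflections. -/

noncomputable section

namespace HamSim

open Matrix

set_option linter.unusedSectionVars false

variable {n c w : ℕ} {ι : Type} [Fintype ι] [DecidableEq ι]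
variable (p : ℕ) (H : Matrix (Fin (2 ^ n)) (Fin (2 ^ n)) ℂ)

/-! ### State preparation in unary -/

/-- The rotation by the angle `θ` in the plane of `|10⟩` and `|σ1⟩`. -/
def rotUnitary (σ : Bool) (θ : ℝ) : Matrix.unitaryGroup (Bool × Bool) ℂ :=
  ⟨Matrix.of fun r q =>
    if q = (true, false) then
      if r = (true, false) then (Real.cos θ : ℂ) else if r = (σ, true) then (Real.sin θ : ℂ) else 0
    else if q = (σ, true) then
      if r = (true, false) then -(Real.sin θ : ℂ) else if r = (σ, true) then (Real.cos θ : ℂ) else 0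
    else if r = q then 1 else 0, by
    have h : Complex.cos θ * Complex.cos θ + Complex.sin θ * Complex.sin θ = 1 := by
      rw [← sq, ← sq, Complex.cos_sq_add_sin_sq]
    have h' : Complex.sin θ * Complex.sin θ + Complex.cos θ * Complex.cos θ = 1 := by
      rw [add_comm, h]
    rw [Matrix.mem_unitaryGroup_iff']
    ext ⟨a, b⟩ ⟨a', b'⟩
    have hc : (starRingEnd ℂ) (Complex.cos θ) = Complex.cos θ := by
      rw [← Complex.ofReal_cos, Complex.conj_ofReal]
    have hs : (starRingEnd ℂ) (Complex.sin θ) = Complex.sin θ := by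
      rw [← Complex.ofReal_sin, Complex.conj_ofReal]
    cases σ <;> cases a <;> cases b <;> cases a' <;> cases b' <;>
      simp [Matrix.mul_apply, Fintype.sum_prod_type, Matrix.star_apply, hc, hs, h, h'] <;> ring⟩

/-- The rotation on the qubits `a`, `b`. -/
def rotCircuit (a b : ι) (σ : Bool) (θ : ℝ) : Circuit n c w ι :=
  if h : a = b then [] else [.gate a b h (rotUnitary σ θ)]

theorem rotCircuit_mulVec_of_true {a b : ι} (hab : a ≠ b) (σ : Bool) (θ : ℝ) {x : ι → Bool}
    (ha : x a = true) (hb : x b = false) :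
    Circuit.matrix p H (rotCircuit (n := n) (c := c) (w := w) a b σ θ) *ᵥ ket x =
      (Real.cos θ : ℂ) • ket x + (Real.sin θ : ℂ) • ket (setBits a b (σ, true) x) := by
  simp only [rotCircuit, hab, dite_false, Circuit.matrix_cons, Circuit.matrix_nil, one_mul,
    Op.matrix]
  rw [gate_mulVec_ket hab, ha, hb]
  have : setBits a b (true, false) x = x := by rw [← ha, ← hb, setBits_self hab]
  rw [Fintype.sum_prod_type]
  cases σ <;> simp [rotUnitary, this]
  abel

/-- The rotation plane is orthogonal to `|00⟩`. A branch in which the cascade has already stopped is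
thus unaffected by later rotations. -/
theorem rotCircuit_mulVec_of_false {a b : ι} (σ : Bool) (θ : ℝ) {x : ι → Bool}
    (ha : x a = false) (hb : x b = false) :
    Circuit.matrix p H (rotCircuit (n := n) (c := c) (w := w) a b σ θ) *ᵥ ket x = ket x := by
  by_cases hab : a = b
  · simp [rotCircuit, hab]
  simp only [rotCircuit, hab, dite_false, Circuit.matrix_cons, Circuit.matrix_nil, one_mul,
    Op.matrix]
  rw [gate_mulVec_ket hab, ha, hb]
  have : setBits a b (false, false) x = x := by
    conv_rhs => rw [← setBits_self hab x, ha, hb]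
  rw [Fintype.sum_prod_type]
  cases σ <;> simp [rotUnitary, this]

/-- The norm of the weights number `i`, …, `i + m`. -/
def tailNorm (a : ℕ → ℝ) (i m : ℕ) : ℝ := Real.sqrt (∑ l ∈ Finset.range (m + 1), a (i + l) ^ 2)

theorem tailNorm_pos {a : ℕ → ℝ} (ha : ∀ l, 0 < a l) (i m : ℕ) : 0 < tailNorm a i m :=
  Real.sqrt_pos.2 (Finset.sum_pos (fun l _ => pow_pos (ha _) 2) (by simp))

theorem tailNorm_sq {a : ℕ → ℝ} (i m : ℕ) :
    tailNorm a i m ^ 2 = ∑ l ∈ Finset.range (m + 1), a (i + l) ^ 2 :=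
  Real.sq_sqrt (Finset.sum_nonneg fun _ _ => sq_nonneg _)

theorem tailNorm_succ_sq {a : ℕ → ℝ} (i m : ℕ) :
    tailNorm a i (m + 1) ^ 2 = a i ^ 2 + tailNorm a (i + 1) m ^ 2 := by
  rw [tailNorm_sq, tailNorm_sq, Finset.sum_range_succ']
  simp only [add_zero]
  rw [add_comm]
  congr 1
  exact Finset.sum_congr rfl fun l _ => by rw [show i + (l + 1) = i + 1 + l by ring]

/-- The angle that splits off the weight number `i` from the weights number `i`, …, `i + m`. -/
def tailAngle (a : ℕ → ℝ) (i m : ℕ) : ℝ := Real.arccos (a i / tailNorm a i m)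

theorem tailNorm_mul_cos {a : ℕ → ℝ} (ha : ∀ l, 0 < a l) (i m : ℕ) :
    tailNorm a i (m + 1) * Real.cos (tailAngle a i (m + 1)) = a i := by
  have hN := tailNorm_pos ha i (m + 1)
  have h0 : 0 ≤ a i / tailNorm a i (m + 1) := div_nonneg (ha i).le hN.le
  have h1 : a i / tailNorm a i (m + 1) ≤ 1 := by
    rw [div_le_one hN]
    refine le_of_sq_le_sq ?_ hN.le
    rw [tailNorm_succ_sq]
    nlinarith [sq_nonneg (tailNorm a (i + 1) m)]
  rw [tailAngle, Real.cos_arccos (by linarith) h1]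
  field_simp

theorem tailNorm_mul_sin {a : ℕ → ℝ} (ha : ∀ l, 0 < a l) (i m : ℕ) :
    tailNorm a i (m + 1) * Real.sin (tailAngle a i (m + 1)) = tailNorm a (i + 1) m := by
  have hN := tailNorm_pos ha i (m + 1)
  have hN' := tailNorm_pos ha (i + 1) m
  have hs : 0 ≤ Real.sin (tailAngle a i (m + 1)) :=
    Real.sin_nonneg_of_nonneg_of_le_pi (Real.arccos_nonneg _) (Real.arccos_le_pi _)
  have hc := tailNorm_mul_cos ha i m
  have := Real.sin_sq_add_cos_sq (tailAngle a i (m + 1))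
  have h2 := tailNorm_succ_sq (a := a) i m
  have h3 : (tailNorm a i (m + 1) * Real.sin (tailAngle a i (m + 1))) ^ 2 =
      tailNorm a (i + 1) m ^ 2 := by
    have e : tailNorm a i (m + 1) ^ 2 * (Real.sin (tailAngle a i (m + 1)) ^ 2 +
        Real.cos (tailAngle a i (m + 1)) ^ 2) = tailNorm a i (m + 1) ^ 2 := by rw [this, mul_one]
    rw [← hc] at h2
    linarith [mul_pow (tailNorm a i (m + 1)) (Real.sin (tailAngle a i (m + 1))) 2,
      mul_pow (tailNorm a i (m + 1)) (Real.cos (tailAngle a i (m + 1))) 2]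
  exact (sq_eq_sq₀ (mul_nonneg hN.le hs) hN'.le).1 h3

/-- Distributes the amplitude of `|q i⟩` over the unary states number `i`, …, `i + m`. -/
def cascade (q : ℕ → ι) (a : ℕ → ℝ) (σ : Bool) : ℕ → ℕ → Circuit n c w ι
  | _, 0 => []
  | i, m + 1 => rotCircuit (q i) (q (i + 1)) σ (tailAngle a i (m + 1)) ++ cascade q a σ (i + 1) m

/-- The unary state number `l` after the one in which the qubit `q i` is the last one that is set:
one-hot if `σ = false`, thermometer code if `σ = true`. -/
def unary (q : ℕ → ι) (σ : Bool) : ℕ → ℕ → (ι → Bool) → (ι → Bool)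
  | _, 0, x => x
  | i, l + 1, x => unary q σ (i + 1) l (setBits (q i) (q (i + 1)) (σ, true) x)

theorem cascade_mulVec_of_false (q : ℕ → ι) (a : ℕ → ℝ) (σ : Bool) (i m : ℕ) {x : ι → Bool}
    (hx : ∀ l, i ≤ l → l ≤ i + m → x (q l) = false) :
    Circuit.matrix p H (cascade (n := n) (c := c) (w := w) q a σ i m) *ᵥ ket x = ket x := by
  induction m generalizing i with
  | zero => simp [cascade]
  | succ m ih =>
    rw [cascade, Circuit.matrix_append, ← Matrix.mulVec_mulVec, rotCircuit_mulVec_of_false,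
      ih (i + 1) fun l h₁ h₂ => hx l (by omega) (by omega)]
    · exact hx i le_rfl (by omega)
    · exact hx (i + 1) (by omega) (by omega)

/-- Each rotation leaves the share `a i` on the current state, which the rest of the cascade fixes,
and passes the share `tailNorm a (i + 1) m` on to the next one. The factor `tailNorm` on the left
avoids normalizing in the induction. -/
theorem cascade_mulVec (q : ℕ → ι) {a : ℕ → ℝ} (ha : ∀ l, 0 < a l) (σ : Bool) (i m : ℕ)
    (hq : ∀ l l', i ≤ l → l < l' → l' ≤ i + m → q l ≠ q l') {x : ι → Bool}
    (hxi : x (q i) = true) (hx : ∀ l, i < l → l ≤ i + m → x (q l) = false) :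
    (tailNorm a i m : ℂ) •
        (Circuit.matrix p H (cascade (n := n) (c := c) (w := w) q a σ i m) *ᵥ ket x) =
      ∑ l ∈ Finset.range (m + 1), (a (i + l) : ℂ) • ket (unary q σ i l x) := by
  induction m generalizing i x with
  | zero => simp [cascade, unary, tailNorm, Real.sqrt_sq (ha i).le]
  | succ m ih =>
    have hne : q i ≠ q (i + 1) := hq i (i + 1) le_rfl (by omega) (by omega)
    rw [cascade, Circuit.matrix_append, ← Matrix.mulVec_mulVec,
      rotCircuit_mulVec_of_true p H hne σ _ hxi (hx (i + 1) (by omega) (by omega)),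
      Matrix.mulVec_add, Matrix.mulVec_smul, Matrix.mulVec_smul,
      cascade_mulVec_of_false p H q a σ (i + 1) m fun l h₁ h₂ => hx l (by omega) (by omega),
      smul_add, smul_smul, smul_smul, ← Complex.ofReal_mul, ← Complex.ofReal_mul,
      tailNorm_mul_cos ha, tailNorm_mul_sin ha, ih (i + 1) (fun l l' h₁ h₂ h₃ =>
        hq l l' (by omega) h₂ (by omega)) (by rw [setBits_right]) (fun l h₁ h₂ => ?_),
      Finset.sum_range_succ' _ (m + 1)]
    · simp only [unary, add_zero]
      rw [add_comm]
      congr 1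
      exact Finset.sum_congr rfl fun l _ => by rw [show i + (l + 1) = i + 1 + l by ring]
    · rw [setBits_of_ne (hq i l le_rfl (by omega) (by omega)).symm
        (hq (i + 1) l (by omega) h₁ (by omega)).symm]
      exact hx l (by omega) (by omega)

theorem unary_of_ne (q : ℕ → ι) (σ : Bool) (i l : ℕ) (x : ι → Bool) {r : ι}
    (hr : ∀ j, i ≤ j → j ≤ i + l → r ≠ q j) : unary q σ i l x r = x r := by
  induction l generalizing i x with
  | zero => rfl
  | succ l ih =>
    rw [unary, ih (i + 1) _ fun j h₁ h₂ => hr j (by omega) (by omega),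
      setBits_of_ne (hr i le_rfl (by omega)) (hr (i + 1) (by omega) (by omega))]

theorem unary_last (q : ℕ → ι) (σ : Bool) (i l : ℕ) {x : ι → Bool} (hx : x (q i) = true) :
    unary q σ i l x (q (i + l)) = true := by
  induction l generalizing i x with
  | zero => exact hx
  | succ l ih =>
    rw [unary, show i + (l + 1) = i + 1 + l by ring]
    exact ih (i + 1) (by rw [setBits_right])

/-- A qubit that has been passed keeps the value `σ`; this is the difference between the one-hot and
the thermometer code. -/
theorem unary_lt (q : ℕ → ι) (σ : Bool) (i l : ℕ) (x : ι → Bool)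
    (hq : ∀ j j', i ≤ j → j < j' → j' ≤ i + l → q j ≠ q j') {j : ℕ} (hij : i ≤ j)
    (hj : j < i + l) : unary q σ i l x (q j) = σ := by
  induction l generalizing i x with
  | zero => omega
  | succ l ih =>
    rw [unary]
    rcases Nat.eq_or_lt_of_le hij with rfl | hij
    · rw [unary_of_ne _ _ _ _ _ fun j' h₁ h₂ => hq i j' le_rfl (by omega) (by omega),
        setBits_left (hq i (i + 1) le_rfl (by omega) (by omega))]
    · exact ih (i + 1) _ (fun j j' h₁ h₂ h₃ => hq j j' (by omega) h₂ (by omega)) hij (by omega)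

theorem rotCircuit_gates (a b : ι) (σ : Bool) (θ : ℝ) :
    Circuit.gates (rotCircuit (n := n) (c := c) (w := w) a b σ θ) ≤ 1 := by
  unfold rotCircuit; split_ifs <;> simp

theorem rotCircuit_queries (a b : ι) (σ : Bool) (θ : ℝ) :
    Circuit.queries (rotCircuit (n := n) (c := c) (w := w) a b σ θ) = 0 := by
  unfold rotCircuit; split_ifs <;> simp

theorem cascade_gates (q : ℕ → ι) (a : ℕ → ℝ) (σ : Bool) (i m : ℕ) :
    Circuit.gates (cascade (n := n) (c := c) (w := w) q a σ i m) ≤ m := by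
  induction m generalizing i with
  | zero => simp [cascade]
  | succ m ih =>
    rw [cascade, Circuit.gates_append, add_comm]
    exact add_le_add (ih _) (rotCircuit_gates ..)

theorem cascade_queries (q : ℕ → ι) (a : ℕ → ℝ) (σ : Bool) (i m : ℕ) :
    Circuit.queries (cascade (n := n) (c := c) (w := w) q a σ i m) = 0 := by
  induction m generalizing i with
  | zero => simp [cascade]
  | succ m ih => rw [cascade, Circuit.queries_append, ih, rotCircuit_queries]

theorem cascade_pres {S : Set ι} (q : ℕ → ι) (a : ℕ → ℝ) (σ : Bool) (i m : ℕ)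
    (hq : ∀ j, q j ∉ S) :
    Pres S (Circuit.matrix p H (cascade (n := n) (c := c) (w := w) q a σ i m)) := by
  induction m generalizing i with
  | zero => simpa [cascade] using Pres.one S
  | succ m ih =>
    rw [cascade, Circuit.matrix_append]
    refine (ih _).mul ?_
    unfold rotCircuit
    split_ifs
    · simpa using Pres.one S
    · simpa [Op.matrix] using gateMatrix_pres (hq i) (hq (i + 1)) _

theorem hadCircuit_pres {S : Set ι} (d : ι) (l : List ι) (hd : d ∉ S) (hl : ∀ q ∈ l, q ∉ S) :
    Pres S (Circuit.matrix p H (hadCircuit (n := n) (c := c) (w := w) d l)) := by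
  induction l with
  | nil => simpa [hadCircuit] using Pres.one S
  | cons a l ih =>
    have : hadCircuit (n := n) (c := c) (w := w) d (a :: l) =
        (if h : a = d then [] else [hadOp a d h]) ++ hadCircuit d l := by
      simp [hadCircuit]
    rw [this, Circuit.matrix_append]
    refine (ih fun q hq => hl q (by simp [hq])).mul ?_
    split_ifs
    · simpa using Pres.one S
    · simpa [Op.matrix, hadOp] using gateMatrix_pres (hl a (by simp)) hd _

theorem hadCircuit_queries (d : ι) (l : List ι) :
    Circuit.queries (hadCircuit (n := n) (c := c) (w := w) d l) = 0 := by
  unfold hadCircuit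
  rw [Circuit.queries_flatMap (m := 0), mul_zero]
  intro a _
  split_ifs <;> rfl

theorem hadCircuit_gates (d : ι) (l : List ι) :
    Circuit.gates (hadCircuit (n := n) (c := c) (w := w) d l) ≤ l.length := by
  induction l with
  | nil => simp [hadCircuit]
  | cons a l ih =>
    have : hadCircuit (n := n) (c := c) (w := w) d (a :: l) =
        (if h : a = d then [] else [hadOp a d h]) ++ hadCircuit d l := by
      simp [hadCircuit]
    rw [this, Circuit.gates_append, List.length_cons, add_comm]
    refine add_le_add ih ?_
    split_ifs <;> simp [hadOp]

/-! ### Reflections -/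

/-- Successive disjunctions: every pair of the list consists of a source and a target, and the
disjunction of the source and the previous target is added to the target. -/
def orChain : ι → List (ι × ι) → Circuit n c w ι
  | _, [] => []
  | v, (z, t) :: l =>
    (if h : v ≠ z ∧ v ≠ t ∧ z ≠ t then logicCircuit true v z t h.1 h.2.1 h.2.2 else []) ++
      orChain t l

/-- The last target. -/
def chainEnd : ι → List (ι × ι) → ι
  | v, [] => v
  | _, (_, t) :: l => chainEnd t l

/-- The sources lie outside the work bits, so they keep their values along the chain. The formula
for the end of the chain needs targets that start at `0`, but the circuit permutes basis states in
any case. -/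
theorem orChain_mono (v : ι) (l : List (ι × ι)) (hl : (v :: l.map Prod.snd).Nodup)
    (hd : ∀ r ∈ l, r.1 ∉ v :: l.map Prod.snd) :
    ∃ g, Mono (Circuit.matrix p H (orChain (n := n) (c := c) (w := w) v l)) (fun _ => 1) g ∧
      ∀ x, (∀ r ∈ l, x r.2 = false) →
        g x (chainEnd v l) = (x v || l.any fun r => x r.1) := by
  induction l generalizing v with
  | nil => exact ⟨id, by simpa [orChain] using Mono.one, by simp [chainEnd]⟩
  | cons r l ih =>
    obtain ⟨z, t⟩ := r
    simp only [List.map_cons, List.nodup_cons, List.mem_cons, not_or] at hl hd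
    obtain ⟨g, hg, hgx⟩ := ih t (by simpa using hl.2) fun r hr => by
      have := hd r (Or.inr hr)
      simpa using this.2
    have hz := hd (z, t) (Or.inl rfl)
    have h : v ≠ z ∧ v ≠ t ∧ z ≠ t := ⟨fun e => hz.1 e.symm, hl.1.1, hz.2.1⟩
    rw [orChain, dif_pos h, Circuit.matrix_append]
    refine ⟨_, (hg.mul (logicCircuit_mono p H true v z t h.1 h.2.1 h.2.2)).congr
      (fun _ => by simp) fun _ => rfl, fun x hx => ?_⟩
    have hxt : x t = false := hx (z, t) (by simp)
    have hnt : ∀ r ∈ l, r.2 ≠ t := fun r hr e =>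
      hl.2.1 (List.mem_map.2 ⟨r, hr, e⟩)
    rw [chainEnd, hgx]
    · simp only [if_true, hxt, Bool.false_xor, Function.update_self, List.any_cons, Bool.or_assoc]
      congr 2
      rw [Bool.eq_iff_iff]
      simp only [List.any_eq_true]
      refine exists_congr fun r => and_congr_right fun hr => ?_
      rw [Function.update_of_ne (hd r (Or.inr hr)).2.1]
    · intro r hr
      rw [Function.update_of_ne (hnt r hr)]
      exact hx r (by simp [hr])

theorem orChain_gates (v : ι) (l : List (ι × ι)) :
    Circuit.gates (orChain (n := n) (c := c) (w := w) v l) ≤ 7 * l.length := by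
  induction l generalizing v with
  | nil => simp [orChain]
  | cons r l ih =>
    rw [orChain, Circuit.gates_append, List.length_cons]
    have := ih r.2
    split_ifs
    · simp; omega
    · simp; omega

theorem orChain_queries (v : ι) (l : List (ι × ι)) :
    Circuit.queries (orChain (n := n) (c := c) (w := w) v l) = 0 := by
  induction l generalizing v with
  | nil => simp [orChain]
  | cons r l ih =>
    rw [orChain, Circuit.queries_append, ih]
    split_ifs <;> simp

/-- The phase of a reflection. -/
def reflPhase (r _s : Bool) : ℂ := if r then 1 else -1

theorem norm_reflPhase (r s : Bool) : ‖reflPhase r s‖ = 1 := by cases r <;> simp [reflPhase]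

/-- The reflection about the subspace in which all sources are `0`. -/
def reflCircuit (v : ι) (l : List (ι × ι)) (d : ι) : Circuit n c w ι :=
  orChain v l ++ ((if h : chainEnd v l = d then [] else
    [diagOp (chainEnd v l) d h reflPhase norm_reflPhase]) ++ (orChain v l).inv)

/-- Compute, apply a phase, uncompute: the result is diagonal for all contents of the work bits, and
the phase is the intended one if these are `0`. -/
theorem reflCircuit_mono (v : ι) (l : List (ι × ι)) (d : ι) (hl : (v :: l.map Prod.snd).Nodup)
    (hd : ∀ r ∈ l, r.1 ∉ v :: l.map Prod.snd) (hd' : chainEnd v l ≠ d) :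
    ∃ φ, Mono (Circuit.matrix p H (reflCircuit (n := n) (c := c) (w := w) v l d)) φ id ∧
      ∀ x, x v = false → (∀ r ∈ l, x r.2 = false) →
        φ x = if ∀ r ∈ l, x r.1 = false then -1 else 1 := by
  obtain ⟨g, hg, hgx⟩ := orChain_mono (c := c) (w := w) p H v l hl hd
  refine ⟨fun x => reflPhase (g x (chainEnd v l)) (g x d), fun x => ?_, fun x hxv hx => ?_⟩
  · simp only [reflCircuit, hd', dite_false, Circuit.matrix_append, Circuit.matrix_cons,
      Circuit.matrix_nil, one_mul, Circuit.matrix_inv]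
    rw [← Matrix.mulVec_mulVec, hg x, one_smul, ← Matrix.mulVec_mulVec, diagOp_mono,
      Matrix.mulVec_smul]
    congr 1
    have := hg x
    rw [one_smul] at this
    rw [id, ← this, Matrix.mulVec_mulVec, Circuit.conjTranspose_mul_matrix, Matrix.one_mulVec, id]
  · beta_reduce
    rw [hgx x hx, hxv, Bool.false_or]
    by_cases h : ∀ r ∈ l, x r.1 = false
    · rw [if_pos h, reflPhase, if_neg]
      simpa using h
    · rw [if_neg h, reflPhase, if_pos]
      simpa using h

theorem reflCircuit_gates (v : ι) (l : List (ι × ι)) (d : ι) :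
    Circuit.gates (reflCircuit (n := n) (c := c) (w := w) v l d) ≤ 14 * l.length + 1 := by
  have := orChain_gates (n := n) (c := c) (w := w) v l
  simp only [reflCircuit, Circuit.gates_append, Circuit.gates_inv]
  split_ifs
  · simp; omega
  · simp [diagOp]; omega

theorem reflCircuit_queries (v : ι) (l : List (ι × ι)) (d : ι) :
    Circuit.queries (reflCircuit (n := n) (c := c) (w := w) v l d) = 0 := by
  simp only [reflCircuit, Circuit.queries_append, Circuit.queries_inv, orChain_queries]
  split_ifs <;> simp [diagOp]

end HamSim

end

/-! ### The layout of the qubits, reading a row, and the controlled swap. -/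

noncomputable section

namespace HamSim

open Matrix

set_option linter.unusedSectionVars false

/-! ### The qubits of the simulation circuit -/

instance (n c w : ℕ) : DecidableEq (Port n c w) := Classical.decEq _

instance (n c w : ℕ) : Finite (Port n c w) := by
  let f : Port n c w → Fin n ⊕ Fin c ⊕ Fin n ⊕ Unit ⊕ Fin w ⊕ Unit ⊕ Fin w := fun s =>
    match s with
    | .row k => .inl k
    | .idx k => .inr (.inl k)
    | .pos k => .inr (.inr (.inl k))
    | .reSign => .inr (.inr (.inr (.inl ())))
    | .reMag k => .inr (.inr (.inr (.inr (.inl k))))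
    | .imSign => .inr (.inr (.inr (.inr (.inr (.inl ())))))
    | .imMag k => .inr (.inr (.inr (.inr (.inr (.inr k)))))
  refine Finite.of_injective f fun s t h => ?_
  cases s <;> cases t <;> simp [f] at h <;> simp [h]

/-- The ancillas of a block, which performs one multiplication by the Hamiltonian. -/
inductive Blk (n m M : ℕ) : Type
  | tgt (k : Fin n)
  | fst (k : Fin m)
  | snd (k : Fin m)
  | hot (k : Fin M)

instance (n m M : ℕ) : Finite (Blk n m M) := by
  let f : Blk n m M → Fin n ⊕ Fin m ⊕ Fin m ⊕ Fin M := fun s =>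
    match s with
    | .tgt k => .inl k
    | .fst k => .inr (.inl k)
    | .snd k => .inr (.inr (.inl k))
    | .hot k => .inr (.inr (.inr k))
  refine Finite.of_injective f fun s t h => ?_
  cases s <;> cases t <;> simp [f] at h <;> simp [h]

/-- The ancillas: a thermometer that counts multiplications, ports of the black box, work bits for
reflections, and the blocks. -/
inductive Anc (n c w m M K L : ℕ) : Type
  | therm (k : Fin (K + 2))
  | port (s : Port n c w)
  | work (k : Fin L)
  | blk (i : Fin K) (s : Blk n m M)

instance (n c w m M K L : ℕ) : Finite (Anc n c w m M K L) := by
  let f : Anc n c w m M K L → Fin (K + 2) ⊕ Port n c w ⊕ Fin L ⊕ (Fin K × Blk n m M) := fun s =>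
    match s with
    | .therm k => .inl k
    | .port s => .inr (.inl s)
    | .work k => .inr (.inr (.inl k))
    | .blk i s => .inr (.inr (.inr (i, s)))
  refine Finite.of_injective f fun s t h => ?_
  cases s <;> cases t <;> simp [f] at h <;> simp [h]

instance (n c w m M K L : ℕ) : Fintype (Anc n c w m M K L) := Fintype.ofFinite _

instance (n c w m M K L : ℕ) : DecidableEq (Anc n c w m M K L) := Classical.decEq _

/-- All qubits: the system and the ancillas. -/
abbrev Lab (n c w m M K L : ℕ) : Type := Fin n ⊕ Anc n c w m M K L

variable {n c w m M K L : ℕ}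

/-- A qubit of a block. -/
abbrev blkLab (i : Fin K) (s : Blk n m M) : Lab n c w m M K L := .inr (.blk i s)

/-- A port of the black box. -/
abbrev portLab (s : Port n c w) : Lab n c w m M K L := .inr (.port s)

/-- The qubit that switches on the block `i`. -/
abbrev ctlLab (i : Fin K) : Lab n c w m M K L := .inr (.therm i.castSucc.succ)

/-- The qubits on which the block `i` queries the black box. -/
def portFun (i : Fin K) : Port n c w → Lab n c w m M K L
  | .row k => .inl k
  | .idx k => if h : k.1 < m then blkLab i (.fst ⟨k, h⟩) else portLab (.idx k)
  | .pos k => portLab (.pos k)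
  | .reSign => portLab .reSign
  | .reMag k => portLab (.reMag k)
  | .imSign => portLab .imSign
  | .imMag k => portLab (.imMag k)

theorem portFun_injective (i : Fin K) :
    Function.Injective (portFun (n := n) (c := c) (w := w) (m := m) (M := M) (L := L) i) := by
  intro s t h
  cases s <;> cases t <;> simp only [portFun] at h <;> (try split_ifs at h) <;>
    simp_all [Fin.ext_iff]

/-- The qubits on which the block `i` queries the black box. -/
def portEmb (i : Fin K) : Port n c w ↪ Lab n c w m M K L := ⟨portFun i, portFun_injective i⟩

/-- The output ports. -/
def Port.IsOut : Port n c w → Prop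
  | .row _ => False
  | .idx _ => False
  | _ => True

theorem portEmb_of_isOut (i : Fin K) {s : Port n c w} (hs : s.IsOut) :
    portEmb (m := m) (M := M) (L := L) i s = portLab s := by
  cases s <;> first | rfl | exact hs.elim

variable (p : ℕ) (H : Matrix (Fin (2 ^ n)) (Fin (2 ^ n)) ℂ)

/-- The contents of an output port after a query by the block `i`. -/
def queried (i : Fin K) (x : Lab n c w m M K L → Bool) (s : Port n c w) : Bool :=
  xor (x (portLab s)) (reply p H (portEmb i) x s)

theorem queryMap_out (i : Fin K) (x : Lab n c w m M K L → Bool) {s : Port n c w} (hs : s.IsOut) :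
    queryMap p H (portEmb i) x (portLab s) = queried p H i x s := by
  rw [← portEmb_of_isOut i hs, queryMap_port, portEmb_of_isOut i hs, queried]

theorem queryMap_eq_self (i : Fin K) (x : Lab n c w m M K L → Bool) {q : Lab n c w m M K L}
    (hq : ∀ s : Port n c w, s.IsOut → q ≠ portLab s) : queryMap p H (portEmb i) x q = x q := by
  by_cases h : ∃ s, portEmb i s = q
  · obtain ⟨s, rfl⟩ := h
    rw [queryMap_port]
    cases s
    case row => simp [reply, answer_row]
    case idx => simp [reply, answer_idx]
    all_goals exact (hq _ (by trivial) rfl).elim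
  · push Not at h
    exact queryMap_of_notMem _ _ _ _ h

/-! ### Reading a row -/

/-- Phases that depend on two ports, for each position of a one-hot register. -/
structure Phases (n c w M : ℕ) where
  bitPort : Fin M → Port n c w
  signPort : Fin M → Port n c w
  bitPort_isOut : ∀ l, (bitPort l).IsOut
  signPort_isOut : ∀ l, (signPort l).IsOut
  bit : Fin M → Bool → ℂ
  sign : Fin M → Bool → ℂ
  norm_bit : ∀ l r, ‖bit l r‖ = 1
  norm_sign : ∀ l r, ‖sign l r‖ = 1

/-- A phase that is switched on by the first of two qubits. -/
def condPhase (f : Bool → ℂ) (r s : Bool) : ℂ := if r then f s else 1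

theorem norm_condPhase {f : Bool → ℂ} (hf : ∀ s, ‖f s‖ = 1) (r s : Bool) :
    ‖condPhase f r s‖ = 1 := by
  cases r <;> simp [condPhase, hf]

/-- The phase for the contents `z` of the ports and the one-hot position `l`. -/
def Phases.val (F : Phases n c w M) (z : Port n c w → Bool) (l : Fin M) : ℂ :=
  F.bit l (z (F.bitPort l)) * F.sign l (z (F.signPort l))

/-- The phase gates of a block. -/
def phaseCircuit (i : Fin K) (F : Phases n c w M) : Circuit n c w (Lab n c w m M K L) :=
  (List.finRange M).flatMap fun l =>
    [diagOp (blkLab i (.hot l)) (portLab (F.bitPort l)) (by simp) (condPhase (F.bit l))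
        (norm_condPhase (F.norm_bit l)),
      diagOp (blkLab i (.hot l)) (portLab (F.signPort l)) (by simp) (condPhase (F.sign l))
        (norm_condPhase (F.norm_sign l))]

theorem phaseCircuit_mono (i : Fin K) (F : Phases n c w M) :
    Mono (Circuit.matrix p H (phaseCircuit (m := m) (L := L) i F))
      (fun x => ∏ l, if x (blkLab i (.hot l)) then F.val (fun s => x (portLab s)) l else 1) id := by
  have := diagFamily_mono (c := c) (w := w) p H (List.finRange M) (F := fun l : Fin M =>
    [diagOp (blkLab i (.hot l)) (portLab (F.bitPort l)) (by simp) (condPhase (F.bit l))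
        (norm_condPhase (F.norm_bit l)),
      diagOp (blkLab i (.hot l)) (portLab (F.signPort l)) (by simp) (condPhase (F.sign l))
        (norm_condPhase (F.norm_sign l))])
    (φ := fun l (x : Lab n c w m M K L → Bool) =>
      if x (blkLab i (.hot l)) then F.val (fun s => x (portLab s)) l else 1) fun l => by
      simp only [Circuit.matrix_cons, Circuit.matrix_nil, one_mul]
      refine ((diagOp_mono _ _ _ _ _ _ _).mul (diagOp_mono _ _ _ _ _ _ _)).congr
        (fun x => ?_) fun _ => rfl
      simp only [condPhase, id, Phases.val]
      split_ifs <;> simp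
  refine this.congr (fun x => ?_) fun _ => rfl
  rw [Fin.prod_univ_def]

/-- Adds the position of an entry to the target register, and multiplies by a phase that depends
on its value. -/
def readCircuit (i : Fin K) (F : Phases n c w M) : Circuit n c w (Lab n c w m M K L) :=
  .query (portEmb i) :: (phaseCircuit i F ++ ((List.finRange n).flatMap (fun k =>
    [cnotOp (portLab (.pos k)) (blkLab i (.tgt k)) (by simp)]) ++ [.query (portEmb i)]))

/-- The action of `readCircuit` on basis states. -/
def readMap (i : Fin K) (x : Lab n c w m M K L → Bool) : Lab n c w m M K L → Bool
  | .inr (.blk i' (.tgt k)) =>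
    if i' = i then xor (x (blkLab i (.tgt k))) (queried p H i x (.pos k))
      else x (blkLab i' (.tgt k))
  | q => x q

/-- The answer is copied into the target register and into phases while it is present on the output
ports; the second query then erases it. The ports need not be clean for this description. -/
theorem readCircuit_mono (i : Fin K) (F : Phases n c w M) :
    Mono (Circuit.matrix p H (readCircuit (m := m) (L := L) i F))
      (fun x => ∏ l, if x (blkLab i (.hot l)) then F.val (queried p H i x) l else 1)
      (readMap p H i) := by
  have hq := query_mono p H (portEmb (n := n) (c := c) (w := w) (m := m) (M := M) (L := L) i)
  have hx := xorFamily_mono (ι := Lab n c w m M K L) (c := c) (w := w) p H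
    (List.nodup_finRange n) (t := fun k => blkLab i (.tgt k))
    (f := fun k x => x (portLab (.pos k)))
    (F := fun k => [cnotOp (portLab (.pos k)) (blkLab i (.tgt k)) (by simp)])
    (fun a b h => by simpa using h)
    (fun k _ => by
      simp only [Circuit.matrix_cons, Circuit.matrix_nil, one_mul]
      exact cnotOp_mono _ _ _ _ _)
    (fun k k' x r => by rw [Function.update_of_ne (by simp)])
  simp only [readCircuit, Circuit.matrix_cons, Circuit.matrix_append, Circuit.matrix_nil, one_mul,
    Op.matrix]
  refine (((hq.mul hx).mul (phaseCircuit_mono p H i F)).mul hq).congr (fun x => ?_) fun x => ?_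
  · simp only [mul_one, one_mul]
    refine Finset.prod_congr rfl fun l _ => ?_
    rw [queryMap_eq_self p H i x (by simp)]
    simp only [Phases.val, queryMap_out p H i x (F.bitPort_isOut l),
      queryMap_out p H i x (F.signPort_isOut l)]
  · simp only [id]
    set x₁ := queryMap p H (portEmb i) x with hx₁
    set x₂ := xorFamily (List.finRange n) (fun k => blkLab i (.tgt k))
      (fun k x => x (portLab (.pos k))) x₁ with hx₂
    have h₂ : ∀ q : Lab n c w m M K L, (∀ k, blkLab i (.tgt k) ≠ q) → x₂ q = x₁ q :=
      fun q hq => xorFamily_of_ne _ _ fun k _ => hq k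
    -- The CNOTs write only to the target register, which is not an input of the query, so the
    -- second answer equals the first and cancels it.
    have hr : reply p H (portEmb i) x₂ = reply p H (portEmb i) x := by
      rw [← reply_queryMap p H (portEmb i) x]
      apply reply_congr
      · intro k; exact h₂ _ (by simp [portEmb, portFun])
      · intro k
        apply h₂
        intro k'
        simp only [portEmb, portFun, Function.Embedding.coeFn_mk]
        split_ifs <;> simp
    have hout : ∀ s : Port n c w, s.IsOut →
        queryMap p H (portEmb i) x₂ (portLab s) = x (portLab s) := by
      intro s hs
      rw [queryMap_out p H i _ hs, queried, hr, h₂ _ (by simp), hx₁, queryMap_out p H i _ hs,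
        queried]
      simp
    have hne : ∀ q : Lab n c w m M K L, (∀ k, blkLab i (.tgt k) ≠ q) →
        queryMap p H (portEmb i) x₂ q = x q := by
      intro q hq
      by_cases h : ∃ s : Port n c w, s.IsOut ∧ q = portLab s
      · obtain ⟨s, hs, rfl⟩ := h
        exact hout s hs
      · push Not at h
        rw [queryMap_eq_self p H i _ h, h₂ q hq, hx₁, queryMap_eq_self p H i _ h]
    funext q
    rcases q with k | (k | s | k | ⟨i', (k | k | k | k)⟩)
    case inr.blk.tgt =>
      by_cases hi : i' = i
      · subst hi
        rw [queryMap_eq_self p H _ _ (by simp), hx₂, xorFamily_target (fun a b h => by simpa using h)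
          _ _ (List.mem_finRange k), hx₁, queryMap_eq_self p H _ _ (by simp),
          queryMap_out p H _ _ (s := .pos k) trivial]
        simp [readMap]
      · rw [hne _ (by simp [Ne.symm hi])]
        simp [readMap, hi]
    all_goals exact hne _ (by simp)

/-! ### The controlled swap -/

/-- The registers that are swapped. -/
def swapL (i : Fin K) : Fin n ⊕ Fin m → Lab n c w m M K L :=
  Sum.elim .inl fun k => blkLab i (.fst k)

/-- The registers that are swapped. -/
def swapR (i : Fin K) : Fin n ⊕ Fin m → Lab n c w m M K L :=
  Sum.elim (fun k => blkLab i (.tgt k)) fun k => blkLab i (.snd k)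

theorem swapL_injective (i : Fin K) : Function.Injective
    (swapL (n := n) (c := c) (w := w) (m := m) (M := M) (L := L) i) := by
  rintro (a | a) (b | b) h <;> simp [swapL] at h <;> simp [h]

theorem swapR_injective (i : Fin K) : Function.Injective
    (swapR (n := n) (c := c) (w := w) (m := m) (M := M) (L := L) i) := by
  rintro (a | a) (b | b) h <;> simp [swapR] at h <;> simp [h]

theorem swapL_ne_swapR (i : Fin K) (a b : Fin n ⊕ Fin m) :
    swapL (c := c) (w := w) (M := M) (L := L) i a ≠ swapR i b := by
  rcases a with a | a <;> rcases b with b | b <;> simp [swapL, swapR]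

theorem swapL_ne_ctl (i : Fin K) (a : Fin n ⊕ Fin m) :
    swapL (c := c) (w := w) (M := M) (L := L) i a ≠ ctlLab i := by
  rcases a with a | a <;> simp [swapL]

theorem swapR_ne_ctl (i : Fin K) (a : Fin n ⊕ Fin m) :
    swapR (c := c) (w := w) (M := M) (L := L) i a ≠ ctlLab i := by
  rcases a with a | a <;> simp [swapR]

/-- The index of the swapped qubits. -/
def swapList (n m : ℕ) : List (Fin n ⊕ Fin m) :=
  (List.finRange n).map .inl ++ (List.finRange m).map .inr

theorem mem_swapList (a : Fin n ⊕ Fin m) : a ∈ swapList n m := by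
  rcases a with a | a <;> simp [swapList]

theorem swapList_nodup (n m : ℕ) : (swapList n m).Nodup := by
  refine List.Nodup.append ((List.nodup_finRange n).map Sum.inl_injective)
    ((List.nodup_finRange m).map Sum.inr_injective) ?_
  intro a ha hb
  simp only [List.mem_map] at ha hb
  obtain ⟨_, _, rfl⟩ := ha
  obtain ⟨_, _, h⟩ := hb
  cases h

theorem swapList_length (n m : ℕ) : (swapList n m).length = n + m := by simp [swapList]

/-- Swaps the two pairs of registers if the block is switched on. -/
def swapCircuit (i : Fin K) : Circuit n c w (Lab n c w m M K L) :=
  ((swapList n m).flatMap fun k => [cnotOp (swapR i k) (swapL i k) (swapL_ne_swapR i k k).symm]) ++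
    (((swapList n m).flatMap fun k => logicCircuit false (ctlLab i) (swapL i k) (swapR i k)
      (swapL_ne_ctl i k).symm (swapR_ne_ctl i k).symm (swapL_ne_swapR i k k)) ++
    (swapList n m).flatMap fun k =>
      [cnotOp (swapR i k) (swapL i k) (swapL_ne_swapR i k k).symm])

/-- The action of `swapCircuit` on basis states. -/
def swapMap (i : Fin K) (x : Lab n c w m M K L → Bool) : Lab n c w m M K L → Bool
  | .inl k => if x (ctlLab i) then x (blkLab i (.tgt k)) else x (.inl k)
  | .inr (.blk i' (.tgt k)) =>
    if i' = i ∧ x (ctlLab i) = true then x (.inl k) else x (blkLab i' (.tgt k))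
  | .inr (.blk i' (.fst k)) =>
    if i' = i ∧ x (ctlLab i) = true then x (blkLab i (.snd k)) else x (blkLab i' (.fst k))
  | .inr (.blk i' (.snd k)) =>
    if i' = i ∧ x (ctlLab i) = true then x (blkLab i (.fst k)) else x (blkLab i' (.snd k))
  | q => x q

/-- A swap is a product of three CNOTs. It suffices to control the middle one, because the outer two
cancel when it is absent. -/
theorem swapCircuit_mono (i : Fin K) :
    Mono (Circuit.matrix p H (swapCircuit (n := n) (c := c) (w := w) (m := m) (M := M) (L := L) i))
      (fun _ => 1) (swapMap i) := by
  have h₁ := xorFamily_mono (ι := Lab n c w m M K L) (c := c) (w := w) p H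
    (swapList_nodup n m) (swapL_injective i) (f := fun k x => x (swapR i k))
    (F := fun k => [cnotOp (swapR i k) (swapL i k) (swapL_ne_swapR i k k).symm])
    (fun k _ => by
      simp only [Circuit.matrix_cons, Circuit.matrix_nil, one_mul]
      exact cnotOp_mono _ _ _ _ _)
    (fun k k' x r => by rw [Function.update_of_ne (swapL_ne_swapR i k' k).symm])
  have h₂ := xorFamily_mono (ι := Lab n c w m M K L) (c := c) (w := w) p H
    (swapList_nodup n m) (swapR_injective i) (f := fun k x => x (ctlLab i) && x (swapL i k))
    (F := fun k => logicCircuit false (ctlLab i) (swapL i k) (swapR i k)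
      (swapL_ne_ctl i k).symm (swapR_ne_ctl i k).symm (swapL_ne_swapR i k k))
    (fun k _ => logicCircuit_mono p H _ _ _ _ _ _ _)
    (fun k k' x r => by
      rw [Function.update_of_ne (swapL_ne_swapR i k k'),
        Function.update_of_ne (swapR_ne_ctl i k').symm])
  simp only [swapCircuit, Circuit.matrix_append]
  refine ((h₁.mul h₂).mul h₁).congr (fun x => by simp) fun x => ?_
  have hL : ∀ (y : Lab n c w m M K L → Bool) k, xorFamily (swapList n m) (swapL i)
      (fun k x => x (swapR i k)) y (swapL i k) = xor (y (swapL i k)) (y (swapR i k)) :=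
    fun y k => xorFamily_target (swapL_injective i) _ _ (mem_swapList k)
  have hL' : ∀ (y : Lab n c w m M K L → Bool) q, (∀ k, swapL i k ≠ q) →
      xorFamily (swapList n m) (swapL i) (fun k x => x (swapR i k)) y q = y q :=
    fun y q hq => xorFamily_of_ne _ _ fun k _ => hq k
  have hR : ∀ (y : Lab n c w m M K L → Bool) k, xorFamily (swapList n m) (swapR i)
      (fun k x => x (ctlLab i) && x (swapL i k)) y (swapR i k) =
        xor (y (swapR i k)) (y (ctlLab i) && y (swapL i k)) :=
    fun y k => xorFamily_target (swapR_injective i) _ _ (mem_swapList k)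
  have hR' : ∀ (y : Lab n c w m M K L → Bool) q, (∀ k, swapR i k ≠ q) →
      xorFamily (swapList n m) (swapR i) (fun k x => x (ctlLab i) && x (swapL i k)) y q = y q :=
    fun y q hq => xorFamily_of_ne _ _ fun k _ => hq k
  set g := xorFamily (swapList n m) (swapL i) (fun k x => x (swapR i k)) (xorFamily (swapList n m)
    (swapR i) (fun k x => x (ctlLab i) && x (swapL i k)) (xorFamily (swapList n m) (swapL i)
      (fun k x => x (swapR i k)) x)) with hg
  have key : ∀ k, g (swapL i k) = (if x (ctlLab i) then x (swapR i k) else x (swapL i k)) ∧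
      g (swapR i k) = (if x (ctlLab i) then x (swapL i k) else x (swapR i k)) := by
    intro k
    have e₁ := fun y => hL' y (swapR i k) fun k' => swapL_ne_swapR i k' k
    have e₂ := fun y => hR' y (swapL i k) fun k' => (swapL_ne_swapR i k k').symm
    have e₃ := fun y => hL' y (ctlLab i) (swapL_ne_ctl i)
    rw [hg, hL, hR, e₂, hL, e₁, e₁, e₃, hR, hL, e₁, e₃]
    cases x (ctlLab i) <;> cases x (swapL i k) <;> cases x (swapR i k) <;> simp
  have hother : ∀ q, (∀ k, swapL i k ≠ q) → (∀ k, swapR i k ≠ q) → g q = x q := by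
    intro q h h'
    rw [hg, hL' _ _ h, hR' _ _ h', hL' _ _ h]
  funext q
  rcases q with k | (k | s | k | ⟨i', (k | k | k | k)⟩)
  case inl => exact (key (.inl k)).1
  case inr.blk.tgt =>
    by_cases hi : i' = i
    · subst hi
      refine (key (.inl k)).2.trans ?_
      simp [swapMap, swapL, swapR]
    · rw [hother _ (by simp [swapL]) (by simp [swapR, Ne.symm hi])]
      simp [swapMap, hi]
  case inr.blk.fst =>
    by_cases hi : i' = i
    · subst hi
      refine (key (.inr k)).1.trans ?_
      simp [swapMap, swapL, swapR]
    · rw [hother _ (by simp [swapL, Ne.symm hi]) (by simp [swapR])]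
      simp [swapMap, hi]
  case inr.blk.snd =>
    by_cases hi : i' = i
    · subst hi
      refine (key (.inr k)).2.trans ?_
      simp [swapMap, swapL, swapR]
    · rw [hother _ (by simp [swapL]) (by simp [swapR, Ne.symm hi])]
      simp [swapMap, hi]
  all_goals exact hother _ (by simp [swapL]) (by simp [swapR])

end HamSim

end

/-! ### A block: preparation, double reading, and its matrix elements. -/

noncomputable section

namespace HamSim

open Matrix

set_option linter.unusedSectionVars false

variable {n c w m M K L : ℕ}

/-! ### Preparation of the ancillas of a block -/

/-- The counters of a block. -/
def countLab (i : Fin K) : Fin m ⊕ Fin m → Lab n c w m M K L :=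
  Sum.elim (fun k => blkLab i (.fst k)) fun k => blkLab i (.snd k)

theorem countLab_injective (i : Fin K) : Function.Injective
    (countLab (n := n) (c := c) (w := w) (m := m) (M := M) (L := L) i) := by
  rintro (a | a) (b | b) h <;> simp [countLab] at h <;> simp [h]

/-- The counters of a block. -/
def countList (i : Fin K) : List (Lab n c w m M K L) := (swapList m m).map (countLab i)

/-- The one-hot register of a block. -/
def hotSeq [NeZero M] (i : Fin K) (l : ℕ) : Lab n c w m M K L := blkLab i (.hot (Fin.ofNat M l))

theorem hotSeq_val [NeZero M] (i : Fin K) (l : Fin M) :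
    hotSeq (n := n) (c := c) (w := w) (m := m) (L := L) i l.1 = blkLab i (.hot l) := by
  simp [hotSeq]

theorem hotSeq_ne [NeZero M] (i : Fin K) {l l' : ℕ} (h : l < l') (h' : l' < M) :
    hotSeq (n := n) (c := c) (w := w) (m := m) (M := M) (L := L) i l ≠ hotSeq i l' := by
  intro e
  have e' : blkLab (n := n) (c := c) (w := w) (m := m) (L := L) i (.hot ⟨l, h.trans h'⟩) =
      blkLab i (.hot ⟨l', h'⟩) := by
    rw [← hotSeq_val, ← hotSeq_val]; exact e
  simp only [Sum.inr.injEq, Anc.blk.injEq, Blk.hot.injEq, Fin.mk.injEq] at e'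
  omega

/-- Prepares the ancillas of a block. -/
def prepCircuit [NeZero n] [NeZero M] (i : Fin K) (a : ℕ → ℝ) :
    Circuit n c w (Lab n c w m M K L) :=
  hadCircuit (blkLab i (.tgt 0)) (countList i) ++
    (cnotOp (ctlLab i) (blkLab i (.hot 0)) (by simp) :: cascade (hotSeq i) a false 0 (M - 1))

/-- The contents of the counters and of the one-hot register are overwritten. -/
def put (i : Fin K) (s₁ s₂ : Fin m → Bool) (h : Fin M → Bool) (x : Lab n c w m M K L → Bool) :
    Lab n c w m M K L → Bool
  | .inr (.blk i' (.fst k)) => if i' = i then s₁ k else x (blkLab i' (.fst k))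
  | .inr (.blk i' (.snd k)) => if i' = i then s₂ k else x (blkLab i' (.snd k))
  | .inr (.blk i' (.hot k)) => if i' = i then h k else x (blkLab i' (.hot k))
  | q => x q

/-- The one-hot code. -/
def oneHot (l : Fin M) (k : Fin M) : Bool := decide (k = l)

theorem extend_countLab (i : Fin K) (s : Fin m ⊕ Fin m → Bool) (x : Lab n c w m M K L → Bool)
    (hx : ∀ b, x (blkLab i b) = false) :
    Function.extend (countLab i) s x =
      put i (fun k => s (.inl k)) (fun k => s (.inr k)) (fun _ => false) x := by
  have hinj := countLab_injective (n := n) (c := c) (w := w) (m := m) (M := M) (L := L) i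
  have hne : ∀ q, (∀ k, countLab i k ≠ q) → Function.extend (countLab i) s x q = x q :=
    fun q hq => Function.extend_apply' _ _ _ fun ⟨k, hk⟩ => hq k hk
  funext q
  rcases q with k | (k | t | k | ⟨i', (k | k | k | k)⟩)
  case inr.blk.fst =>
    by_cases hi : i' = i
    · subst hi
      exact (hinj.extend_apply s x (.inl k)).trans (by simp [put])
    · rw [hne _ (by simp [countLab, Ne.symm hi])]
      simp [put, hi]
  case inr.blk.snd =>
    by_cases hi : i' = i
    · subst hi
      exact (hinj.extend_apply s x (.inr k)).trans (by simp [put])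
    · rw [hne _ (by simp [countLab, Ne.symm hi])]
      simp [put, hi]
  case inr.blk.hot =>
    rw [hne _ (by simp [countLab])]
    by_cases hi : i' = i
    · subst hi; simp [put, hx]
    · simp [put, hi]
  all_goals exact hne _ (by simp [countLab])

variable (p : ℕ) (H : Matrix (Fin (2 ^ n)) (Fin (2 ^ n)) ℂ)

theorem inv_sqrt_two_pow (m : ℕ) :
    (((Real.sqrt 2)⁻¹ : ℝ) : ℂ) ^ (m + m) = ((2 : ℂ) ^ m)⁻¹ := by
  rw [← two_mul, pow_mul, ← Complex.ofReal_pow, inv_pow, Real.sq_sqrt (by norm_num), ← inv_pow]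
  norm_num

theorem hadCircuit_count [NeZero n] (i : Fin K) {x : Lab n c w m M K L → Bool}
    (hx : ∀ b, x (blkLab i b) = false) :
    Circuit.matrix p H (hadCircuit (c := c) (w := w) (blkLab i (.tgt 0)) (countList i)) *ᵥ
        ket x =
      ((2 : ℂ) ^ m)⁻¹ • ∑ s : (Fin m → Bool) × (Fin m → Bool),
        ket (put i s.1 s.2 (fun _ => false) x) := by
  rw [countList, hadCircuit_mulVec p H (countLab_injective i) _ _
    ((swapList_nodup m m).map (countLab_injective i)) ?_ ?_ x ?_]
  · rw [List.length_map, swapList_length, inv_sqrt_two_pow]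
    congr 1
    rw [← (Equiv.sumArrowEquivProdArrow (Fin m) (Fin m) Bool).sum_comp]
    refine Finset.sum_congr rfl fun s _ => ?_
    rw [extend_countLab i s x hx]
    rfl
  · simp only [List.mem_map, not_exists, not_and]
    rintro (k | k) _ <;> simp [countLab]
  · intro q
    simp [mem_swapList]
  · rintro (k | k) <;> simp [countLab, hx]

theorem put_ctl (i : Fin K) (s₁ s₂ : Fin m → Bool) (h : Fin M → Bool)
    (x : Lab n c w m M K L → Bool) : put i s₁ s₂ h x (ctlLab i) = x (ctlLab i) := rfl

/-- Without the control no excitation enters the one-hot register, so the cascade has nothing to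
distribute and the phase gates of the block remain idle. The Hadamard gates act nevertheless; the
inverse preparation removes their effect. -/
theorem prepCircuit_mulVec_off [NeZero n] [NeZero M] (i : Fin K) (a : ℕ → ℝ)
    {x : Lab n c w m M K L → Bool} (hx : ∀ b, x (blkLab i b) = false)
    (hq : x (ctlLab i) = false) :
    Circuit.matrix p H (prepCircuit i a) *ᵥ ket x =
      ∑ s : (Fin m → Bool) × (Fin m → Bool), ((2 : ℂ) ^ m)⁻¹ •
        ket (put i s.1 s.2 (fun _ => false) x) := by
  rw [prepCircuit, Circuit.matrix_append, ← Matrix.mulVec_mulVec, hadCircuit_count p H i hx,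
    Matrix.mulVec_smul, Matrix.mulVec_sum, Finset.smul_sum]
  refine Finset.sum_congr rfl fun s _ => ?_
  congr 1
  rw [Circuit.matrix_cons, ← Matrix.mulVec_mulVec, cnotOp_mono, one_smul]
  beta_reduce
  rw [put_ctl, hq,
    Bool.xor_false, Function.update_eq_self, cascade_mulVec_of_false]
  intro l _ _
  simp [hotSeq, put]

theorem unary_hotSeq [NeZero M] (i : Fin K) (s₁ s₂ : Fin m → Bool)
    (x : Lab n c w m M K L → Bool) (l : Fin M) :
    unary (hotSeq i) false 0 l.1 (Function.update (put i s₁ s₂ (fun _ => false) x)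
      (blkLab i (.hot 0)) true) = put i s₁ s₂ (oneHot l) x := by
  have h0 : blkLab (n := n) (c := c) (w := w) (m := m) (L := L) i (.hot 0) = hotSeq (M := M) i 0 :=
    (hotSeq_val i 0).symm
  have hne : ∀ q : Lab n c w m M K L, (∀ k, q ≠ blkLab i (.hot k)) →
      unary (hotSeq i) false 0 l.1 (Function.update (put i s₁ s₂ (fun _ => false) x)
        (blkLab i (.hot 0)) true) q = put i s₁ s₂ (fun _ => false) x q := by
    intro q hq
    rw [unary_of_ne (hotSeq i) _ _ _ _ fun j _ _ => hq _, Function.update_of_ne (hq 0)]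
  funext q
  by_cases hq : ∃ k, q = blkLab i (.hot k)
  · obtain ⟨k, rfl⟩ := hq
    rw [show put i s₁ s₂ (oneHot l) x (blkLab i (.hot k)) = decide (k = l) by simp [put, oneHot]]
    rcases lt_trichotomy k l with h | h | h
    · rw [← hotSeq_val i k, unary_lt (hotSeq i) _ 0 l.1 _ (fun j j' _ h₁ h₂ => hotSeq_ne i h₁ (by omega))
        (by omega) (by simpa using h)]
      simp [h.ne]
    · subst h
      have := unary_last (hotSeq i) false 0 k.1
        (x := Function.update (put i s₁ s₂ (fun _ => false) x) (blkLab i (.hot 0)) true)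
        (by rw [h0]; simp)
      rw [zero_add, hotSeq_val] at this
      rw [this]; simp
    · rw [← hotSeq_val i k, unary_of_ne (hotSeq i) _ 0 l.1 _ (fun j _ hj => (hotSeq_ne i (by
        have : l.1 < k.1 := h
        omega) k.2).symm), h0, Function.update_of_ne (hotSeq_ne i (by
          have : l.1 < k.1 := h
          omega) k.2).symm, hotSeq_val]
      simp [put, h.ne']
  · push Not at hq
    rw [hne q hq]
    rcases q with k | (k | t | k | ⟨i', (k | k | k | k)⟩)
    case inr.blk.hot =>
      have hi : i' ≠ i := fun e => hq k (by rw [e])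
      simp [put, hi]
    all_goals rfl

theorem prepCircuit_mulVec_on [NeZero n] [NeZero M] (i : Fin K) {a : ℕ → ℝ} (ha : ∀ l, 0 < a l)
    (ha' : ∑ l : Fin M, a l ^ 2 = 1)
    {x : Lab n c w m M K L → Bool} (hx : ∀ b, x (blkLab i b) = false)
    (hq : x (ctlLab i) = true) :
    Circuit.matrix p H (prepCircuit i a) *ᵥ ket x =
      ∑ s : ((Fin m → Bool) × (Fin m → Bool)) × Fin M, (((2 : ℂ) ^ m)⁻¹ * (a s.2 : ℂ)) •
        ket (put i s.1.1 s.1.2 (oneHot s.2) x) := by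
  have hM : M - 1 + 1 = M := Nat.succ_pred_eq_of_ne_zero (NeZero.ne M)
  have hN : tailNorm a 0 (M - 1) = 1 := by
    rw [tailNorm, hM]
    simp only [zero_add]
    rw [Finset.sum_range (fun l => a l ^ 2), ha', Real.sqrt_one]
  have h0 : blkLab (n := n) (c := c) (w := w) (m := m) (L := L) i (.hot 0) = hotSeq (M := M) i 0 :=
    (hotSeq_val i 0).symm
  rw [prepCircuit, Circuit.matrix_append, ← Matrix.mulVec_mulVec, hadCircuit_count p H i hx,
    Matrix.mulVec_smul, Matrix.mulVec_sum, Finset.smul_sum]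
  conv_rhs => rw [Fintype.sum_prod_type]
  refine Finset.sum_congr rfl fun s _ => ?_
  have := cascade_mulVec (c := c) (w := w) p H (hotSeq i) ha false 0 (M - 1)
    (fun l l' _ h h' => hotSeq_ne i h (by omega))
    (x := Function.update (put i s.1 s.2 (fun _ => false) x) (blkLab i (.hot 0)) true)
    (by rw [h0, Function.update_self]) (fun l h h' => by
      rw [h0, Function.update_of_ne (hotSeq_ne i h (by omega)).symm]
      simp [hotSeq, put])
  rw [hN, Complex.ofReal_one, one_smul, hM,
    Finset.sum_range] at this
  rw [Circuit.matrix_cons, ← Matrix.mulVec_mulVec, cnotOp_mono, one_smul]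
  beta_reduce
  rw [put_ctl, hq, show put i s.1 s.2 (fun _ => false) x (blkLab i (.hot 0)) = false by simp [put],
    Bool.false_xor, this, Finset.smul_sum]
  refine Finset.sum_congr rfl fun l _ => ?_
  rw [unary_hotSeq, smul_smul, zero_add]

/-! ### The matrix elements of a block -/

/-- Matrix elements of "prepare, act, unprepare" between states whose preparations are known: only
the columns of `P` at `x` and `y` enter, so the inverse preparation never has to be computed. -/
theorem sandwich_apply {ι Θ Θ' : Type} [Fintype ι] [DecidableEq ι] [Fintype Θ] [Fintype Θ']
    {P Q : Matrix (ι → Bool) (ι → Bool) ℂ} {x y : ι → Bool} {A : Θ → ℂ} {B : Θ' → ℂ}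
    {X : Θ → ι → Bool} {Y : Θ' → ι → Bool}
    (hx : P *ᵥ ket x = ∑ θ, A θ • ket (X θ)) (hy : P *ᵥ ket y = ∑ θ, B θ • ket (Y θ)) :
    (Pᴴ * (Q * P)) y x = ∑ θ, ∑ θ', A θ * star (B θ') * Q (Y θ') (X θ) := by
  have hy' : ∀ z, star (P z y) = ∑ θ', star (B θ') * ket (Y θ') z := by
    intro z
    have := congrFun hy z
    rw [mulVec_ket_apply] at this
    rw [this, Finset.sum_apply, star_sum]
    refine Finset.sum_congr rfl fun θ' _ => ?_
    rw [Pi.smul_apply, smul_eq_mul, star_mul', ket_eq]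
    split_ifs <;> simp
  have hx' : ∀ z, (Q * P) z x = ∑ θ, A θ * Q z (X θ) := by
    intro z
    have : (Q * P) *ᵥ ket x = ∑ θ, A θ • (Q *ᵥ ket (X θ)) := by
      rw [← Matrix.mulVec_mulVec, hx, Matrix.mulVec_sum]
      exact Finset.sum_congr rfl fun θ _ => by rw [Matrix.mulVec_smul]
    have := congrFun this z
    rw [mulVec_ket_apply] at this
    rw [this, Finset.sum_apply]
    exact Finset.sum_congr rfl fun θ _ => by rw [Pi.smul_apply, mulVec_ket_apply, smul_eq_mul]
  rw [Matrix.mul_apply]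
  simp only [Matrix.conjTranspose_apply, hy', hx', Finset.sum_mul_sum]
  rw [Finset.sum_comm]
  conv_rhs => rw [Finset.sum_comm]
  refine Finset.sum_congr rfl fun θ' _ => ?_
  rw [Finset.sum_comm]
  refine Finset.sum_congr rfl fun θ _ => ?_
  simp only [ket_eq, mul_ite, mul_one, mul_zero, ite_mul, zero_mul]
  rw [Finset.sum_eq_single (Y θ')]
  · rw [if_pos rfl]; ring
  · intro z _ hz
    rw [if_neg hz]
  · simp

theorem sandwich_mono_apply {ι Θ Θ' : Type} [Fintype ι] [DecidableEq ι] [Fintype Θ] [Fintype Θ']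
    {P Q : Matrix (ι → Bool) (ι → Bool) ℂ} {x y : ι → Bool} {A : Θ → ℂ} {B : Θ' → ℂ}
    {X : Θ → ι → Bool} {Y : Θ' → ι → Bool} {φ g}
    (hx : P *ᵥ ket x = ∑ θ, A θ • ket (X θ)) (hy : P *ᵥ ket y = ∑ θ, B θ • ket (Y θ))
    (hQ : Mono Q φ g) :
    (Pᴴ * (Q * P)) y x =
      ∑ θ, ∑ θ', if g (X θ) = Y θ' then A θ * φ (X θ) * star (B θ') else 0 := by
  rw [sandwich_apply hx hy]
  refine Finset.sum_congr rfl fun θ _ => Finset.sum_congr rfl fun θ' _ => ?_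
  rw [hQ.apply]
  by_cases h : g (X θ) = Y θ'
  · rw [if_pos h, if_pos h.symm]; ring
  · rw [if_neg h, if_neg (Ne.symm h), mul_zero]

/-- The middle part of a block. -/
def walkCircuit (i : Fin K) (F G : Phases n c w M) : Circuit n c w (Lab n c w m M K L) :=
  readCircuit i F ++ (swapCircuit i ++ readCircuit i G)

/-- A block, which multiplies by the Hamiltonian if it is switched on. -/
def blockCircuit [NeZero n] [NeZero M] (i : Fin K) (a : ℕ → ℝ) (F G : Phases n c w M) :
    Circuit n c w (Lab n c w m M K L) :=
  prepCircuit i a ++ (walkCircuit i F G ++ (prepCircuit i a).inv)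

/-- The answer of the black box for the row `u` and the index `s`. -/
def oracle (c w : ℕ) (u : Fin n → Bool) (s : Fin m → Bool) (t : Port n c w) : Bool :=
  answer p H (Fin.ofBits u)
    (Nat.ofBits fun k : Fin c => if h : k.1 < m then s ⟨k, h⟩ else false) t

/-- The position part of the answer. -/
def oraclePos (c w : ℕ) (u : Fin n → Bool) (s : Fin m → Bool) (k : Fin n) : Bool :=
  oracle p H c w u s (.pos k)

/-- The matrix elements of a block that is switched on. -/
def blockAmp (a : ℕ → ℝ) (F G : Phases n c w M) (m : ℕ) (v u : Fin n → Bool) : ℂ :=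
  ∑ s : ((Fin m → Bool) × (Fin m → Bool)) × Fin M,
    if oraclePos p H c w u s.1.1 = v ∧ oraclePos p H c w v s.1.2 = u then
      ((4 : ℂ) ^ m)⁻¹ * (a s.2 : ℂ) ^ 2 *
        (F.val (oracle p H c w u s.1.1) s.2 * G.val (oracle p H c w v s.1.2) s.2)
    else 0

/-- When the query has more index qubits than the counter, the excess ones are idle ports in the
state `0`, which agrees with the padding by `false` in `oracle`. -/
theorem queried_eq_oracle (i : Fin K) {x : Lab n c w m M K L → Bool}
    (hx : ∀ t, x (portLab t) = false) :
    queried p H i x = oracle p H c w (fun k => x (.inl k)) (fun k => x (blkLab i (.fst k))) := by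
  funext t
  simp only [queried, hx, Bool.false_xor, reply, oracle, portEmb, portFun,
    Function.Embedding.coeFn_mk]
  congr 2
  funext k
  split_ifs
  · rfl
  · exact hx _

/-- The basis state after the middle part of a block that is switched on. -/
def walkState (i : Fin K) (v t : Fin n → Bool) (x : Lab n c w m M K L → Bool) :
    Lab n c w m M K L → Bool
  | .inl k => v k
  | .inr (.blk i' (.tgt k)) => if i' = i then t k else x (blkLab i' (.tgt k))
  | q => x q

theorem prod_oneHot {R : Type*} [CommMonoid R] (f : Fin M → R) (l : Fin M) :
    (∏ k, if oneHot l k then f k else 1) = f l := by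
  simp [oneHot]

theorem walkCircuit_mono (i : Fin K) (F G : Phases n c w M) :
    Mono (Circuit.matrix p H (walkCircuit (m := m) (L := L) i F G))
      (fun x => (∏ l, if x (blkLab i (.hot l)) then F.val (queried p H i x) l else 1) *
        ∏ l, if x (blkLab i (.hot l)) then
          G.val (queried p H i (swapMap i (readMap p H i x))) l else 1)
      (fun x => readMap p H i (swapMap i (readMap p H i x))) := by
  simp only [walkCircuit, Circuit.matrix_append]
  refine (((readCircuit_mono p H i G).mul (swapCircuit_mono p H i)).mul
    (readCircuit_mono p H i F)).congr (fun x => ?_) fun x => rfl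
  simp only [one_mul]
  rfl

/-- The first reading puts the column `v` into the empty target register. After the swap the system
holds `v` and the target holds `u`, and the second reading, now of row `v` with index `s₂`, adds its
column to `u`. The target is empty again exactly if this column is `u`. -/
theorem walk_on (i : Fin K) {x : Lab n c w m M K L → Bool} (hx : ∀ b, x (blkLab i b) = false)
    (hp : ∀ t, x (portLab t) = false) (hq : x (ctlLab i) = true) (s₁ s₂ : Fin m → Bool)
    (h : Fin M → Bool) :
    queried p H i (put i s₁ s₂ h x) = oracle p H c w (fun k => x (.inl k)) s₁ ∧
    queried p H i (swapMap i (readMap p H i (put i s₁ s₂ h x))) =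
      oracle p H c w (oraclePos p H c w (fun k => x (.inl k)) s₁) s₂ ∧
    readMap p H i (swapMap i (readMap p H i (put i s₁ s₂ h x))) =
      put i s₂ s₁ h (walkState i (oraclePos p H c w (fun k => x (.inl k)) s₁)
        (fun k => xor (x (.inl k))
          (oraclePos p H c w (oraclePos p H c w (fun k => x (.inl k)) s₁) s₂ k)) x) := by
  have h₁ : queried p H i (put i s₁ s₂ h x) = oracle p H c w (fun k => x (.inl k)) s₁ := by
    rw [queried_eq_oracle p H i (by intro t; exact hp t)]
    simp [put]
  have e₁ : ∀ k, readMap p H i (put i s₁ s₂ h x) (blkLab i (.tgt k)) =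
      oraclePos p H c w (fun k => x (.inl k)) s₁ k := by
    intro k
    simp [readMap, h₁, put, hx, oraclePos]
  have hc : readMap p H i (put i s₁ s₂ h x) (ctlLab i) = true := hq
  have h₂ : queried p H i (swapMap i (readMap p H i (put i s₁ s₂ h x))) =
      oracle p H c w (oraclePos p H c w (fun k => x (.inl k)) s₁) s₂ := by
    rw [queried_eq_oracle p H i (by intro t; exact hp t)]
    congr 1
    · funext k
      simp only [swapMap, hc, if_true, e₁]
    · funext k
      simp only [swapMap, hc, and_self, if_true]
      simp [readMap, put]
  refine ⟨h₁, h₂, ?_⟩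
  funext q
  rcases q with k | (k | t | k | ⟨i', (k | k | k | k)⟩)
  case inl =>
    simp only [readMap, swapMap, put, walkState] at *
    rw [if_pos hc, e₁]
  case inr.blk.tgt =>
    by_cases hi : i' = i
    · subst hi
      rw [readMap, if_pos rfl, h₂]
      simp [put, walkState, swapMap, hq, readMap, oraclePos]
    · simp [readMap, swapMap, put, walkState, hi]
  case inr.blk.fst =>
    by_cases hi : i' = i
    · subst hi
      simp [readMap, swapMap, put, hq]
    · simp [readMap, swapMap, put, walkState, hi]
  case inr.blk.snd =>
    by_cases hi : i' = i
    · subst hi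
      simp [readMap, swapMap, put, hq]
    · simp [readMap, swapMap, put, walkState, hi]
  case inr.blk.hot =>
    by_cases hi : i' = i
    · subst hi
      simp [readMap, swapMap, put]
    · simp [readMap, swapMap, put, walkState, hi]
  all_goals rfl

/-- Without the swap both readings concern the same row and the same index, so they cancel in the
target register. -/
theorem walk_off (i : Fin K) {x : Lab n c w m M K L → Bool} (hx : ∀ b, x (blkLab i b) = false)
    (hp : ∀ t, x (portLab t) = false) (hq : x (ctlLab i) = false) (s₁ s₂ : Fin m → Bool)
    (h : Fin M → Bool) :
    readMap p H i (swapMap i (readMap p H i (put i s₁ s₂ h x))) = put i s₁ s₂ h x := by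
  have hc : readMap p H i (put i s₁ s₂ h x) (ctlLab i) = false := hq
  have hs : swapMap i (readMap p H i (put i s₁ s₂ h x)) = readMap p H i (put i s₁ s₂ h x) := by
    funext q
    rcases q with k | (k | t | k | ⟨i', (k | k | k | k)⟩) <;> simp [swapMap, hc]
  have hr : queried p H i (readMap p H i (put i s₁ s₂ h x)) = queried p H i (put i s₁ s₂ h x) := by
    rw [queried_eq_oracle p H i (by intro t; exact hp t),
      queried_eq_oracle p H i (by intro t; exact hp t)]
    rfl
  rw [hs]
  funext q
  rcases q with k | (k | t | k | ⟨i', (k | k | k | k)⟩)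
  case inr.blk.tgt =>
    by_cases hi : i' = i
    · subst hi
      rw [readMap, if_pos rfl, hr]
      simp [readMap]
    · simp [readMap, hi]
  all_goals rfl

end HamSim

end

/-! ### From blocks to powers of the block matrix. -/

noncomputable section

namespace HamSim

open Matrix

set_option linter.unusedSectionVars false

variable {n c w m M K L : ℕ} (p : ℕ) (H : Matrix (Fin (2 ^ n)) (Fin (2 ^ n)) ℂ)

theorem prepCircuit_pres [NeZero n] [NeZero M] (i : Fin K) (a : ℕ → ℝ) :
    Pres {q : Lab n c w m M K L | ∀ b, q ≠ blkLab i b}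
      (Circuit.matrix p H (prepCircuit i a)) := by
  rw [prepCircuit, Circuit.matrix_append, Circuit.matrix_cons]
  refine ((cascade_pres p H _ _ _ _ _ fun j => ?_).mul
    ((cnotOp_mono p H _ _ _).pres fun x q hq => ?_)).mul (hadCircuit_pres p H _ _ ?_ ?_)
  · simp [hotSeq]
  · exact Function.update_of_ne (hq _) _ _
  · simp
  · intro q hq
    obtain ⟨k, -, rfl⟩ := List.mem_map.1 hq
    rcases k with k | k <;> simp [countLab]

theorem walkCircuit_pres (i : Fin K) (F G : Phases n c w M) :
    Pres {q : Lab n c w m M K L | (∀ k, q ≠ .inl k) ∧ ∀ b, q ≠ blkLab i b}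
      (Circuit.matrix p H (walkCircuit i F G)) := by
  refine (walkCircuit_mono p H i F G).pres fun x q hq => ?_
  rcases q with k | (k | t | k | ⟨i', b⟩)
  · exact absurd rfl (hq.1 k)
  · rfl
  · rfl
  · rfl
  · have hi : i' ≠ i := fun e => hq.2 b (by rw [e])
    rcases b with (k | k | k | k) <;> simp [readMap, swapMap, hi]

theorem blockCircuit_pres [NeZero n] [NeZero M] (i : Fin K) (a : ℕ → ℝ) (F G : Phases n c w M) :
    Pres {q : Lab n c w m M K L | (∀ k, q ≠ .inl k) ∧ ∀ b, q ≠ blkLab i b}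
      (Circuit.matrix p H (blockCircuit i a F G)) := by
  have h : Pres {q : Lab n c w m M K L | (∀ k, q ≠ .inl k) ∧ ∀ b, q ≠ blkLab i b}
      (Circuit.matrix p H (prepCircuit i a)) := (prepCircuit_pres p H i a).mono fun q hq => hq.2
  rw [blockCircuit, Circuit.matrix_append, Circuit.matrix_append, Circuit.matrix_inv]
  exact (h.conjTranspose.mul (walkCircuit_pres p H i F G)).mul h

/-- Overlap of the state after the double reading with a prepared state: the counters appear in
exchanged order, the slot is unchanged, and emptiness of the target register becomes `u' = u`. -/
theorem put_walkState_eq_iff (i : Fin K) {x y : Lab n c w m M K L → Bool}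
    (hy : ∀ b, y (blkLab i b) = false) (hxy : ∀ q, y (.inr q) = x (.inr q))
    (s₁ s₂ s₁' s₂' : Fin m → Bool) (l l' : Fin M) (v u' : Fin n → Bool) :
    put i s₂ s₁ (oneHot l) (walkState i v (fun k => xor (x (.inl k)) (u' k)) x) =
      put i s₁' s₂' (oneHot l') y ↔
      ((s₁', s₂'), l') = ((s₂, s₁), l) ∧ v = (fun k => y (.inl k)) ∧
        u' = fun k => x (.inl k) := by
  constructor
  · intro h
    refine ⟨?_, ?_, ?_⟩
    · have h₁ : s₁' = s₂ := by
        funext k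
        simpa [put] using (congrFun h (blkLab i (.fst k))).symm
      have h₂ : s₂' = s₁ := by
        funext k
        simpa [put] using (congrFun h (blkLab i (.snd k))).symm
      have h₃ : l' = l := by
        have := (congrFun h (blkLab i (.hot l'))).symm
        simpa [put, oneHot] using this
      rw [h₁, h₂, h₃]
    · funext k
      exact congrFun h (.inl k)
    · funext k
      have := congrFun h (blkLab i (.tgt k))
      simp only [put, walkState, hy, if_true] at this
      exact (by simpa using this : x (.inl k) = u' k).symm
  · rintro ⟨h, rfl, rfl⟩
    simp only [Prod.mk.injEq] at h
    obtain ⟨⟨rfl, rfl⟩, rfl⟩ := h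
    funext q
    rcases q with k | (k | t | k | ⟨i', b⟩)
    · rfl
    · exact (hxy _).symm
    · exact (hxy _).symm
    · exact (hxy _).symm
    · by_cases hi : i' = i
      · subst hi
        rcases b with (k | k | k | k) <;> simp [put, walkState, hy]
      · have := hxy (.blk i' b)
        rcases b with (k | k | k | k) <;> simp [put, walkState, hi, this]

theorem put_eq_iff (i : Fin K) {x y : Lab n c w m M K L → Bool}
    (hx : ∀ b, x (blkLab i b) = false) (hy : ∀ b, y (blkLab i b) = false)
    (s₁ s₂ s₁' s₂' : Fin m → Bool) (h : Fin M → Bool) :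
    put i s₁ s₂ h x = put i s₁' s₂' h y ↔ (s₁', s₂') = (s₁, s₂) ∧ y = x := by
  constructor
  · intro e
    refine ⟨?_, ?_⟩
    · have h₁ : s₁' = s₁ := by
        funext k
        simpa [put] using (congrFun e (blkLab i (.fst k))).symm
      have h₂ : s₂' = s₂ := by
        funext k
        simpa [put] using (congrFun e (blkLab i (.snd k))).symm
      rw [h₁, h₂]
    · funext q
      rcases q with k | (k | t | k | ⟨i', b⟩)
      · exact (congrFun e (.inl k)).symm
      · exact (congrFun e (.inr (.therm k))).symm
      · exact (congrFun e (.inr (.port t))).symm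
      · exact (congrFun e (.inr (.work k))).symm
      · by_cases hi : i' = i
        · subst hi
          exact (hy b).trans (hx b).symm
        · have := congrFun e (blkLab i' b)
          rcases b with (k | k | k | k) <;> simpa [put, hi] using this.symm
  · rintro ⟨h, rfl⟩
    simp only [Prod.mk.injEq] at h
    obtain ⟨rfl, rfl⟩ := h
    rfl

theorem blockCircuit_apply [NeZero n] [NeZero M] (i : Fin K) {a : ℕ → ℝ} (ha : ∀ l, 0 < a l)
    (ha' : ∑ l : Fin M, a l ^ 2 = 1) (F G : Phases n c w M) {x y : Lab n c w m M K L → Bool}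
    (hx : ∀ b, x (blkLab i b) = false) (hy : ∀ b, y (blkLab i b) = false)
    (hp : ∀ t, x (portLab t) = false) :
    Circuit.matrix p H (blockCircuit i a F G) y x =
      if ∀ q, y (.inr q) = x (.inr q) then
        if x (ctlLab i) then blockAmp p H a F G m (fun k => y (.inl k)) (fun k => x (.inl k))
        else if (fun k => y (.inl k)) = fun k => x (.inl k) then 1 else 0
      else 0 := by
  by_cases hxy : ∀ q, y (.inr q) = x (.inr q)
  swap
  · rw [if_neg hxy]
    by_contra h
    apply hxy
    intro q
    by_cases hq : ∃ b, q = .blk i b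
    · obtain ⟨b, rfl⟩ := hq
      exact (hy b).trans (hx b).symm
    · push Not at hq
      exact blockCircuit_pres p H i a F G x y h (.inr q) ⟨by simp, fun b e =>
        hq b (by simpa using e)⟩
  rw [if_pos hxy, blockCircuit, Circuit.matrix_append, Circuit.matrix_append, Circuit.matrix_inv,
    Matrix.mul_assoc]
  cases hq : x (ctlLab i)
  · have hqy : y (ctlLab i) = false := (hxy _).trans hq
    rw [sandwich_mono_apply (prepCircuit_mulVec_off p H i a hx hq)
      (prepCircuit_mulVec_off p H i a hy hqy) (walkCircuit_mono p H i F G)]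
    simp only [walk_off p H i hx hp hq, put_eq_iff i hx hy]
    by_cases hyx : y = x
    · subst hyx
      simp only [Prod.mk.eta, and_true, Finset.sum_ite_eq', Finset.mem_univ, if_true]
      simp only [put, if_true, Bool.false_eq_true, if_false, Finset.prod_const_one, mul_one]
      simp only [Finset.sum_const, Finset.card_univ, Fintype.card_prod, Fintype.card_fun,
        Fintype.card_bool, Fintype.card_fin]
      simp
      field_simp
    · have : ¬ (fun k => y (.inl k)) = fun k => x (.inl k) := fun e => hyx (by
        funext q
        rcases q with k | q
        · exact congrFun e k
        · exact hxy q)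
      simp [hyx, this]
  · have hqy : y (ctlLab i) = true := (hxy _).trans hq
    rw [sandwich_mono_apply (prepCircuit_mulVec_on p H i ha ha' hx hq)
      (prepCircuit_mulVec_on p H i ha ha' hy hqy) (walkCircuit_mono p H i F G), if_pos rfl,
      blockAmp]
    refine Finset.sum_congr rfl fun s _ => ?_
    obtain ⟨⟨s₁, s₂⟩, l⟩ := s
    obtain ⟨h₁, h₂, h₃⟩ := walk_on p H i hx hp hq s₁ s₂ (oneHot l)
    simp only [h₁, h₂, h₃]
    simp only [put_walkState_eq_iff i hy hxy]
    -- Since the walk exchanges the counters, only the branch with exchanged counters and the same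
    -- slot survives. All pairs of counters have equal amplitude, so the exchange costs nothing.
    rw [Finset.sum_eq_single ((s₂, s₁), l)]
    · by_cases h : oraclePos p H c w (fun k => x (.inl k)) s₁ = (fun k => y (.inl k)) ∧
          oraclePos p H c w (fun k => y (.inl k)) s₂ = fun k => x (.inl k)
      · rw [if_pos h, if_pos ⟨rfl, h.1, by rw [h.1]; exact h.2⟩, h.1]
        simp only [put, if_true]
        rw [prod_oneHot, prod_oneHot]
        have h4 : (4 : ℂ) ^ m = 2 ^ m * 2 ^ m := by rw [← mul_pow]; norm_num
        rw [h4]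
        simp
        ring
      · rw [if_neg h, if_neg]
        rintro ⟨-, h', h''⟩
        exact h ⟨h', by rw [← h']; exact h''⟩
    · intro s' _ hs'
      rw [if_neg]
      rintro ⟨h, -⟩
      exact hs' h
    · simp

/-! ### The product of the blocks -/

/-- All blocks of a list. -/
def blocksCircuit [NeZero n] [NeZero M] (a : ℕ → ℝ) (F G : Phases n c w M) (l : List (Fin K)) :
    Circuit n c w (Lab n c w m M K L) :=
  l.flatMap fun i => blockCircuit i a F G

theorem blocksCircuit_pres [NeZero n] [NeZero M] (a : ℕ → ℝ) (F G : Phases n c w M)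
    (l : List (Fin K)) :
    Pres {q : Lab n c w m M K L | (∀ k, q ≠ .inl k) ∧ ∀ i ∈ l, ∀ b, q ≠ blkLab i b}
      (Circuit.matrix p H (blocksCircuit a F G l)) := by
  induction l with
  | nil => simpa [blocksCircuit] using Pres.one _
  | cons i l ih =>
    have : blocksCircuit (m := m) (L := L) a F G (i :: l) =
        blockCircuit i a F G ++ blocksCircuit a F G l := by
      simp [blocksCircuit]
    rw [this, Circuit.matrix_append]
    refine (ih.mono ?_).mul ((blockCircuit_pres p H i a F G).mono ?_)
    · exact fun q hq => ⟨hq.1, fun j hj => hq.2 j (by simp [hj])⟩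
    · exact fun q hq => ⟨hq.1, hq.2 i (by simp)⟩

/-- No ancilla is measured or reset between blocks. Every block has ancillas of its own that the
other blocks leave alone, so clean ancillas at the end already imply that they were clean just after
their block. The clean part of the product is therefore the product of the clean parts. -/
theorem blocksCircuit_apply [NeZero n] [NeZero M] {a : ℕ → ℝ} (ha : ∀ l, 0 < a l)
    (ha' : ∑ l : Fin M, a l ^ 2 = 1) (F G : Phases n c w M) (l : List (Fin K)) (hl : l.Nodup)
    {x y : Lab n c w m M K L → Bool}
    (hx : ∀ i ∈ l, ∀ b, x (blkLab i b) = false) (hy : ∀ i ∈ l, ∀ b, y (blkLab i b) = false)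
    (hp : ∀ t, x (portLab t) = false) :
    Circuit.matrix p H (blocksCircuit a F G l) y x =
      if ∀ q, y (.inr q) = x (.inr q) then
        (Matrix.of (blockAmp p H a F G m) ^ (l.countP fun i => x (ctlLab i)))
          (fun k => y (.inl k)) (fun k => x (.inl k))
      else 0 := by
  induction l generalizing x with
  | nil =>
    simp only [blocksCircuit, List.flatMap_nil, Circuit.matrix_nil, List.countP_nil, pow_zero,
      Matrix.one_apply]
    by_cases h : y = x
    · simp [h]
    · rw [if_neg h]
      by_cases h' : ∀ q, y (.inr q) = x (.inr q)
      · rw [if_pos h', if_neg]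
        exact fun e => h (by
          funext q
          rcases q with k | q
          · exact congrFun e k
          · exact h' q)
      · rw [if_neg h']
  | cons i l ih =>
    have hc : blocksCircuit (m := m) (L := L) a F G (i :: l) =
        blockCircuit i a F G ++ blocksCircuit a F G l := by
      simp [blocksCircuit]
    have hl' := List.nodup_cons.1 hl
    rw [hc, Circuit.matrix_append, Matrix.mul_apply]
    have key : ∀ z : Lab n c w m M K L → Bool,
        Circuit.matrix p H (blocksCircuit a F G l) y z *
          Circuit.matrix p H (blockCircuit i a F G) z x =
        if (∀ q, y (.inr q) = x (.inr q)) ∧ (∀ q, z (.inr q) = x (.inr q)) then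
          (Matrix.of (blockAmp p H a F G m) ^ (l.countP fun i => x (ctlLab i)))
            (fun k => y (.inl k)) (fun k => z (.inl k)) *
          (Matrix.of (blockAmp p H a F G m) ^ (if x (ctlLab i) then 1 else 0))
            (fun k => z (.inl k)) (fun k => x (.inl k))
        else 0 := by
      intro z
      -- Either the term vanishes and `z` violates the condition on the right, or all ancillas of
      -- `z` agree with those of `x`: if the term is nonzero, the later blocks preserve the ancillas
      -- of block `i`, and block `i` preserves the other ancillas.
      by_cases hz : Circuit.matrix p H (blocksCircuit a F G l) y z *
          Circuit.matrix p H (blockCircuit i a F G) z x = 0 ∧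
          ¬ (∀ q, z (.inr q) = x (.inr q))
      · rw [hz.1, if_neg fun h => hz.2 h.2]
      have hzi : ∀ b, z (blkLab i b) = false := by
        intro b
        rcases not_and_or.1 hz with h | h
        · rw [← blocksCircuit_pres p H a F G l z y (left_ne_zero_of_mul h) (blkLab i b)
            ⟨by simp, fun j hj b' e => hl'.1 ?_⟩]
          · exact hy i (by simp) b
          · simp only [Sum.inr.injEq, Anc.blk.injEq] at e
            rw [e.1]; exact hj
        · push Not at h
          exact (h _).trans (hx i (by simp) b)
      have hoff : ∀ q : Anc n c w m M K L, (∀ b, q ≠ .blk i b) → z (.inr q) = x (.inr q) := by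
        intro q hq
        rcases not_and_or.1 hz with h | h
        · exact blockCircuit_pres p H i a F G x z (right_ne_zero_of_mul h) (.inr q)
            ⟨by simp, fun b e => hq b (by simpa using e)⟩
        · push Not at h
          exact h q
      have hzx : ∀ q, z (.inr q) = x (.inr q) := by
        intro q
        by_cases hq : ∃ b, q = .blk i b
        · obtain ⟨b, rfl⟩ := hq
          exact (hzi b).trans (hx i (by simp) b).symm
        · push Not at hq
          exact hoff q hq
      rw [blockCircuit_apply p H i ha ha' F G (hx i (by simp)) hzi hp,
        ih hl'.2 (x := z) (fun j hj b => (hzx _).trans (hx j (by simp [hj]) b))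
          (fun j hj => hy j (by simp [hj])) (fun t => (hzx _).trans (hp t)), if_pos hzx]
      simp only [hzx, implies_true, and_true]
      split_ifs with h₁ h₂ h₃ <;> simp only [pow_zero, pow_one, Matrix.one_apply, Matrix.of_apply,
        if_pos, mul_zero, zero_mul, *]
      simp
    simp only [key]
    by_cases hyx : ∀ q, y (.inr q) = x (.inr q)
    swap
    · simp [hyx]
    rw [if_pos hyx, sum_extend (e := Sum.inl) Sum.inl_injective x _ (fun z hz q hq => by
      rcases q with k | q
      · exact absurd rfl (hq k)
      · by_contra h
        exact hz (if_neg fun h' => h (h'.2 q)))]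
    have he : ∀ s : Fin n → Bool, ∀ k,
        Function.extend (Sum.inl : Fin n → Lab n c w m M K L) s x (.inl k) = s k :=
      fun s k => Sum.inl_injective.extend_apply _ _ _
    have he' : ∀ s : Fin n → Bool, ∀ q,
        Function.extend (Sum.inl : Fin n → Lab n c w m M K L) s x (.inr q) = x (.inr q) :=
      fun s q => Function.extend_apply' _ _ _ (by simp)
    simp only [he, he', hyx, implies_true, and_self, if_true]
    rw [List.countP_cons, pow_add, Matrix.mul_apply]

end HamSim

end

/-! ### Linear combination of powers and oblivious amplitude amplification. -/

noncomputable section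

namespace HamSim

open Matrix

set_option linter.unusedSectionVars false

variable {n c w m M K L : ℕ} (p : ℕ) (H : Matrix (Fin (2 ^ n)) (Fin (2 ^ n)) ℂ)

/-! ### Linear combination of powers -/

/-- The thermometer. -/
def thermSeq (k : ℕ) : Lab n c w m M K L := .inr (.therm (Fin.ofNat (K + 2) k))

theorem thermSeq_val (k : Fin (K + 2)) :
    thermSeq (n := n) (c := c) (w := w) (m := m) (M := M) (L := L) k.1 = .inr (.therm k) := by
  simp [thermSeq]

theorem thermSeq_ne {l l' : ℕ} (h : l < l') (h' : l' < K + 2) :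
    thermSeq (n := n) (c := c) (w := w) (m := m) (M := M) (K := K) (L := L) l ≠ thermSeq l' := by
  intro e
  have e' : (.inr (.therm ⟨l, h.trans h'⟩) : Lab n c w m M K L) = .inr (.therm ⟨l', h'⟩) := by
    rw [← thermSeq_val, ← thermSeq_val]; exact e
  simp only [Sum.inr.injEq, Anc.therm.injEq, Fin.mk.injEq] at e'
  omega

/-- Prepares the thermometer. -/
def startCircuit (b : ℕ → ℝ) : Circuit n c w (Lab n c w m M K L) :=
  notOp (.inr (.therm 0)) (.inr (.therm 1)) (by simp) :: cascade thermSeq b true 0 (K + 1)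

/-- The thermometer shows `k`. -/
def thermPut (k : Fin (K + 2)) (x : Lab n c w m M K L → Bool) : Lab n c w m M K L → Bool
  | .inr (.therm j) => decide (j ≤ k)
  | q => x q

theorem unary_thermSeq (x : Lab n c w m M K L → Bool) (hx : ∀ k, x (.inr (.therm k)) = false)
    (k : Fin (K + 2)) :
    unary thermSeq true 0 k.1 (Function.update x (.inr (.therm 0)) true) = thermPut k x := by
  have h0 : (.inr (.therm 0) : Lab n c w m M K L) = thermSeq 0 := (thermSeq_val 0).symm
  funext q
  by_cases hq : ∃ j, q = .inr (.therm j)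
  · obtain ⟨j, rfl⟩ := hq
    rw [show thermPut k x (.inr (.therm j)) = decide (j ≤ k) from rfl, ← thermSeq_val j]
    rcases lt_trichotomy j k with h | h | h
    · rw [unary_lt thermSeq _ 0 k.1 _ (fun j j' _ h₁ h₂ => thermSeq_ne h₁ (by omega))
        (by omega) (by simpa using h)]
      simp [h.le]
    · subst h
      have := unary_last thermSeq true 0 j.1 (x := Function.update x (.inr (.therm 0)) true)
        (by rw [h0]; simp)
      rw [zero_add] at this
      rw [this]; simp
    · have hlt : k.1 < j.1 := h
      rw [unary_of_ne thermSeq _ 0 k.1 _ (fun l _ hl => (thermSeq_ne (by omega) j.2).symm), h0,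
        Function.update_of_ne (thermSeq_ne (by omega) j.2).symm, thermSeq_val, hx]
      simp [h]
  · push Not at hq
    rw [unary_of_ne thermSeq _ _ _ _ fun j _ _ => hq _, Function.update_of_ne (hq 0)]
    rcases q with k | (k | t | k | ⟨i', b⟩)
    case inr.therm => exact absurd rfl (hq k)
    all_goals rfl

theorem startCircuit_mulVec {b : ℕ → ℝ} (hb : ∀ l, 0 < b l)
    (hb' : ∑ k : Fin (K + 2), b k ^ 2 = 1) {x : Lab n c w m M K L → Bool}
    (hx : ∀ k, x (.inr (.therm k)) = false) :
    Circuit.matrix p H (startCircuit b) *ᵥ ket x =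
      ∑ k : Fin (K + 2), (b k : ℂ) • ket (thermPut k x) := by
  have h0 : (.inr (.therm 0) : Lab n c w m M K L) = thermSeq 0 := (thermSeq_val 0).symm
  have hN : tailNorm b 0 (K + 1) = 1 := by
    rw [tailNorm]
    simp only [zero_add]
    rw [Finset.sum_range (fun l => b l ^ 2), hb', Real.sqrt_one]
  rw [startCircuit, Circuit.matrix_cons, ← Matrix.mulVec_mulVec, notOp_mono, one_smul]
  beta_reduce
  rw [hx, Bool.not_false]
  have := cascade_mulVec (c := c) (w := w) p H thermSeq hb true 0 (K + 1)
    (fun l l' _ h h' => thermSeq_ne h (by omega))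
    (x := Function.update x (.inr (.therm 0)) true)
    (by rw [h0, Function.update_self]) (fun l h h' => by
      rw [h0, Function.update_of_ne (thermSeq_ne h (by omega)).symm]
      exact hx _)
  rw [hN, Complex.ofReal_one, one_smul, Finset.sum_range] at this
  rw [this]
  exact Finset.sum_congr rfl fun l _ => by rw [unary_thermSeq x hx, zero_add]

/-- The sign of the last term. -/
def lastPhase (r _s : Bool) : ℂ := sgn r

theorem norm_lastPhase (r s : Bool) : ‖lastPhase r s‖ = 1 := norm_sgn r

/-- A linear combination of the powers of the block matrix. -/
def lcuCircuit [NeZero n] [NeZero M] (a b : ℕ → ℝ) (F G : Phases n c w M) :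
    Circuit n c w (Lab n c w m M K L) :=
  startCircuit b ++ (blocksCircuit a F G (List.finRange K) ++
    (diagOp (.inr (.therm (Fin.last (K + 1)))) (.inl 0) (by simp) lastPhase norm_lastPhase ::
      (startCircuit b).inv))

/-- The ancillas that `lcuCircuit` returns unchanged. -/
def cleanSet (n c w m M K L : ℕ) : Set (Lab n c w m M K L) :=
  {q | (∀ k, q ≠ .inl k) ∧ (∀ k, q ≠ .inr (.therm k)) ∧ ∀ i b, q ≠ blkLab i b}

theorem startCircuit_pres (b : ℕ → ℝ) :
    Pres {q : Lab n c w m M K L | ∀ k, q ≠ .inr (.therm k)}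
      (Circuit.matrix p H (startCircuit b)) := by
  rw [startCircuit, Circuit.matrix_cons]
  refine (cascade_pres p H _ _ _ _ _ fun j => ?_).mul
    ((notOp_mono p H _ _ _).pres fun x q hq => ?_)
  · simp [thermSeq]
  · exact Function.update_of_ne (hq _) _ _

theorem lcuCircuit_pres [NeZero n] [NeZero M] (a b : ℕ → ℝ) (F G : Phases n c w M) :
    Pres (cleanSet n c w m M K L) (Circuit.matrix p H (lcuCircuit a b F G)) := by
  have h : Pres (cleanSet n c w m M K L) (Circuit.matrix p H (startCircuit b)) :=
    (startCircuit_pres p H b).mono fun q hq => hq.2.1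
  rw [lcuCircuit, Circuit.matrix_append, Circuit.matrix_append, Circuit.matrix_cons,
    Circuit.matrix_inv]
  refine ((h.conjTranspose.mul ((diagOp_mono p H _ _ _ _ _).pres fun x q hq => rfl)).mul
    ((blocksCircuit_pres p H a F G _).mono ?_)).mul h
  exact fun q hq => ⟨hq.1, fun i _ b => hq.2.2 i b⟩

theorem Mono.diag_mul_apply {ι : Type} [Fintype ι] [DecidableEq ι] {κ : Type}
    {Z : Matrix (ι → Bool) (ι → Bool) ℂ}
    {φ} (hZ : Mono Z φ id) (B : Matrix (ι → Bool) κ ℂ) (y : ι → Bool) (u : κ) :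
    (Z * B) y u = φ y * B y u := by
  rw [Matrix.mul_apply, Finset.sum_eq_single y]
  · rw [hZ.apply, id, if_pos rfl]
  · intro z _ hz
    rw [hZ.apply, id, if_neg (Ne.symm hz), zero_mul]
  · simp

/-- The thermometer has values up to `K + 1`, but there are only `K` blocks, so the two largest
values select the same power. -/
theorem countP_finRange_le (K k : ℕ) :
    (List.finRange K).countP (fun i => decide (i.1 + 1 ≤ k)) = min k K := by
  have h : (fun i : Fin K => decide (i.1 + 1 ≤ k)) = (fun i => decide (i + 1 ≤ k)) ∘ Fin.val := rfl
  rw [h, ← List.countP_map, List.map_coe_finRange_eq_range]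
  clear h
  induction K with
  | zero => simp
  | succ K ih =>
    rw [List.range_succ, List.countP_append, ih, List.countP_singleton]
    by_cases h : K + 1 ≤ k
    · rw [if_pos (by simpa using h), min_eq_right (by omega), min_eq_right h]
    · rw [if_neg (by simpa using h), min_eq_left (by omega), min_eq_left (by omega),
        Nat.add_zero]

/-- The basis state with zeros in all ancillas. -/
def zeroExt (u : Fin n → Bool) : Lab n c w m M K L → Bool := Sum.elim u fun _ => false

/-- The thermometer serves only as a control, so its different values do not interfere, and
preparation and unpreparation each contribute a factor `b k`. The top thermometer qubit is set only
for the last value, which receives the sign `-1`. -/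
theorem lcuCircuit_apply [NeZero n] [NeZero M] {a : ℕ → ℝ} (ha : ∀ l, 0 < a l)
    (ha' : ∑ l : Fin M, a l ^ 2 = 1) {b : ℕ → ℝ} (hb : ∀ l, 0 < b l)
    (hb' : ∑ k : Fin (K + 2), b k ^ 2 = 1) (F G : Phases n c w M) (v u : Fin n → Bool) :
    Circuit.matrix p H (lcuCircuit (m := m) (K := K) (L := L) a b F G) (zeroExt v) (zeroExt u) =
      ∑ k : Fin (K + 2), (b k : ℂ) ^ 2 * (sgn (decide (k = Fin.last (K + 1))) *
        (Matrix.of (blockAmp p H a F G m) ^ (min k.1 K)) v u) := by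
  rw [lcuCircuit, Circuit.matrix_append, Circuit.matrix_append, Circuit.matrix_cons,
    Circuit.matrix_inv, Matrix.mul_assoc, Matrix.mul_assoc, ← Matrix.mul_assoc _ _ (Circuit.matrix _ _ (startCircuit b)),
    sandwich_apply (startCircuit_mulVec p H hb hb' (x := zeroExt u) fun _ => rfl)
      (startCircuit_mulVec p H hb hb' (x := zeroExt v) fun _ => rfl)]
  refine Finset.sum_congr rfl fun k _ => ?_
  have hB : ∀ k' : Fin (K + 2), Circuit.matrix p H (blocksCircuit (m := m) (L := L) a F G
      (List.finRange K)) (thermPut k' (zeroExt v)) (thermPut k (zeroExt u)) =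
      if k' = k then (Matrix.of (blockAmp p H a F G m) ^ (min k.1 K)) v u else 0 := by
    intro k'
    rw [blocksCircuit_apply p H ha ha' F G _ (List.nodup_finRange K) (fun _ _ _ => rfl)
      (fun _ _ _ => rfl) (fun _ => rfl)]
    have hc : ((List.finRange K).countP fun i => thermPut (n := n) (c := c) (w := w) (m := m)
        (M := M) (L := L) k (zeroExt u) (ctlLab i)) = min k.1 K := by
      rw [← countP_finRange_le]
      rfl
    by_cases h : k' = k
    · subst h
      rw [hc, if_pos rfl, if_pos]
      · rfl
      · intro q
        rcases q with k | t | k | ⟨i, b⟩ <;> rfl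
    · rw [if_neg h, if_neg]
      intro h'
      apply h
      have h₁ := h' (.therm k)
      have h₂ := h' (.therm k')
      simp only [thermPut, le_refl, decide_true, decide_eq_true_eq] at h₁ h₂
      exact le_antisymm (by simpa using h₂.symm) h₁
  rw [Finset.sum_eq_single k]
  · rw [(diagOp_mono p H _ _ _ _ _).diag_mul_apply, hB, if_pos rfl]
    have : thermPut (n := n) (c := c) (w := w) (m := m) (M := M) (L := L) k (zeroExt v)
        (.inr (.therm (Fin.last (K + 1)))) = decide (k = Fin.last (K + 1)) := by
      simp [thermPut, Fin.last_le_iff]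
    rw [this, lastPhase, Complex.star_def, Complex.conj_ofReal]
    ring
  · intro k' _ hk'
    rw [(diagOp_mono p H _ _ _ _ _).diag_mul_apply, hB, if_neg hk']
    simp
  · simp

/-! ### Amplitude amplification -/

/-- The isometry that adds ancillas in the state `0`. -/
def embed (n c w m M K L : ℕ) : Matrix (Lab n c w m M K L → Bool) (Fin n → Bool) ℂ :=
  Matrix.of fun x u => if x = zeroExt u then 1 else 0

theorem mul_embed_apply {κ : Type} (A : Matrix κ (Lab n c w m M K L → Bool) ℂ) (y : κ)
    (u : Fin n → Bool) : (A * embed n c w m M K L) y u = A y (zeroExt u) := by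
  simp [Matrix.mul_apply, embed]

theorem embed_conjTranspose_mul_apply {κ : Type} (A : Matrix (Lab n c w m M K L → Bool) κ ℂ)
    (v : Fin n → Bool) (y : κ) : ((embed n c w m M K L)ᴴ * A) v y = A (zeroExt v) y := by
  simp only [Matrix.mul_apply, embed, Matrix.conjTranspose_apply, Matrix.of_apply]
  rw [Finset.sum_eq_single (zeroExt v)]
  · simp
  · intro z _ hz
    simp [hz]
  · simp

theorem zeroExt_injective :
    Function.Injective (zeroExt (n := n) (c := c) (w := w) (m := m) (M := M) (K := K) (L := L)) := by
  intro u v h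
  funext k
  exact congrFun h (.inl k)

theorem embed_conjTranspose_mul_embed :
    (embed n c w m M K L)ᴴ * embed n c w m M K L = 1 := by
  ext v u
  rw [embed_conjTranspose_mul_apply]
  simp only [embed, Matrix.of_apply, zeroExt_injective.eq_iff, Matrix.one_apply]

/-- With `R = 1 - 2EE*` the product expands directly; the factor `1/2` in `hU` is what makes one
round sufficient. The identity is exact for any `U`, and the defect of unitarity `1 - U*U` appears
explicitly. The reflection is assumed only on the ranges of `E`, `AE` and `A*E`, since the circuit
for it is correct only when its work bits are `0`. -/
theorem amplification_identity {S T : Type} [Fintype S] [DecidableEq S] [Fintype T]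
    [DecidableEq T] {A R : Matrix S S ℂ} {E : Matrix S T ℂ} {U : Matrix T T ℂ}
    (hA : Aᴴ * A = 1) (hE : Eᴴ * E = 1) (hU : Eᴴ * (A * E) = (2⁻¹ : ℂ) • U)
    (hR₀ : R * E = E - (2 : ℂ) • (E * (Eᴴ * E)))
    (hR₁ : R * (A * E) = A * E - (2 : ℂ) • (E * (Eᴴ * (A * E))))
    (hR₂ : R * (Aᴴ * E) = Aᴴ * E - (2 : ℂ) • (E * (Eᴴ * (Aᴴ * E)))) :
    A * (R * (Aᴴ * (R * (A * E)))) = -(E * U + A * E * (1 - Uᴴ * U)) := by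
  have hA' : A * Aᴴ = 1 := mul_eq_one_comm.1 hA
  have hU' : Eᴴ * (Aᴴ * E) = (2⁻¹ : ℂ) • Uᴴ := by
    have := congrArg Matrix.conjTranspose hU
    simpa [Matrix.conjTranspose_mul, Matrix.mul_assoc] using this
  have hR₀' : R * E = -E := by
    rw [hR₀, hE, Matrix.mul_one]; module
  have hR₁' : R * (A * E) = A * E - E * U := by
    rw [hR₁, hU, Matrix.mul_smul, smul_smul]; norm_num
  have hR₂' : R * (Aᴴ * E) = Aᴴ * E - E * Uᴴ := by
    rw [hR₂, hU', Matrix.mul_smul, smul_smul]; norm_num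
  have h₁ : Aᴴ * (R * (A * E)) = E - Aᴴ * E * U := by
    rw [hR₁', Matrix.mul_sub, ← Matrix.mul_assoc Aᴴ, hA, Matrix.one_mul, Matrix.mul_assoc]
  have h₂ : R * (Aᴴ * (R * (A * E))) = -E - (Aᴴ * E - E * Uᴴ) * U := by
    rw [h₁, Matrix.mul_sub, hR₀', ← Matrix.mul_assoc, hR₂']
  rw [h₂, Matrix.mul_sub, Matrix.mul_neg, ← Matrix.mul_assoc, Matrix.mul_sub,
    ← Matrix.mul_assoc A Aᴴ, hA', Matrix.one_mul, Matrix.sub_mul, Matrix.mul_sub, Matrix.mul_one]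
  simp only [Matrix.mul_assoc]
  abel

/-- The ancillas that are checked by a reflection. -/
def dirtyList (n c w m M K L : ℕ) : List (Lab n c w m M K L) :=
  (List.finRange (K + 2)).map (fun k => .inr (.therm k)) ++ (List.finRange K).flatMap fun i =>
    (List.finRange n).map (fun k => blkLab i (.tgt k)) ++
      ((List.finRange m).map (fun k => blkLab i (.fst k)) ++
        ((List.finRange m).map (fun k => blkLab i (.snd k)) ++
          (List.finRange M).map fun k => blkLab i (.hot k)))

theorem dirtyList_length :
    (dirtyList n c w m M K L).length = K + 2 + K * (n + (m + (m + M))) := by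
  simp [dirtyList, List.length_flatMap]

theorem therm_mem_dirtyList (k : Fin (K + 2)) : .inr (.therm k) ∈ dirtyList n c w m M K L := by
  simp [dirtyList]

theorem blkLab_mem_dirtyList (i : Fin K) (b : Blk n m M) :
    blkLab i b ∈ dirtyList n c w m M K L := by
  cases b <;> simp [dirtyList]

theorem work_notMem_dirtyList (k : Fin L) : .inr (.work k) ∉ dirtyList n c w m M K L := by
  simp [dirtyList]

theorem chainEnd_mem {ι : Type} (v : ι) (l : List (ι × ι)) :
    chainEnd v l ∈ v :: l.map Prod.snd := by
  induction l generalizing v with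
  | nil => simp [chainEnd]
  | cons r l ih => exact List.mem_cons_of_mem _ (ih r.2)

/-- The number of work bits. -/
abbrev workCount (n m M K : ℕ) : ℕ := K + 2 + K * (n + (m + (m + M)))

/-- The sources and targets of the disjunctions of a reflection. -/
def chainList (n c w m M K : ℕ) :
    List (Lab n c w m M K (workCount n m M K + 1) × Lab n c w m M K (workCount n m M K + 1)) :=
  (dirtyList n c w m M K (workCount n m M K + 1)).zip ((List.finRange (workCount n m M K)).map fun k =>
    .inr (.work k.succ))

theorem chainList_map_fst :
    (chainList n c w m M K).map Prod.fst = dirtyList n c w m M K (workCount n m M K + 1) := by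
  rw [chainList, List.map_fst_zip]
  simp [dirtyList_length]

theorem chainList_map_snd : (chainList n c w m M K).map Prod.snd =
    (List.finRange (workCount n m M K)).map fun k => .inr (.work k.succ) := by
  rw [chainList, List.map_snd_zip]
  simp [dirtyList_length]

/-- The reflection about the subspace in which all ancillas are `0`. -/
def reflectCircuit (n c w m M K : ℕ) [NeZero n] :
    Circuit n c w (Lab n c w m M K (workCount n m M K + 1)) :=
  reflCircuit (.inr (.work 0)) (chainList n c w m M K) (.inl 0)

theorem reflectCircuit_mono [NeZero n] :
    ∃ φ, Mono (Circuit.matrix p H (reflectCircuit n c w m M K)) φ id ∧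
      ∀ x, (∀ k, x (.inr (.work k)) = false) →
        φ x = if ∀ q ∈ dirtyList n c w m M K (workCount n m M K + 1), x q = false then -1 else 1 := by
  have hnd : (.inr (.work 0) :: (chainList n c w m M K).map Prod.snd).Nodup := by
    rw [chainList_map_snd, List.nodup_cons]
    refine ⟨by simp [Fin.succ_ne_zero], (List.nodup_finRange _).map fun a b h => ?_⟩
    simpa using h
  have hwork : ∀ q ∈ (.inr (.work 0) :: (chainList n c w m M K).map Prod.snd),
      ∃ k, q = .inr (.work k) := by
    intro q hq
    rw [chainList_map_snd, List.mem_cons, List.mem_map] at hq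
    rcases hq with rfl | ⟨k, -, rfl⟩
    · exact ⟨_, rfl⟩
    · exact ⟨_, rfl⟩
  obtain ⟨φ, hφ, hφx⟩ := reflCircuit_mono (c := c) (w := w) p H (.inr (.work 0))
    (chainList n c w m M K) (.inl 0) hnd
    (fun r hr hr' => by
      obtain ⟨k, hk⟩ := hwork _ hr'
      refine work_notMem_dirtyList (n := n) (c := c) (w := w) (m := m) (M := M) (K := K) k ?_
      rw [← hk, ← chainList_map_fst]
      exact List.mem_map.2 ⟨r, hr, rfl⟩)
    (by
      obtain ⟨k, hk⟩ := hwork _ (chainEnd_mem _ (chainList n c w m M K))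
      rw [hk]; simp)
  refine ⟨φ, hφ, fun x hx => ?_⟩
  rw [hφx x (hx 0) fun r hr => ?_]
  · have : (∀ r ∈ chainList n c w m M K, x r.1 = false) ↔
        ∀ q ∈ dirtyList n c w m M K (workCount n m M K + 1), x q = false := by
      rw [← chainList_map_fst, List.forall_mem_map]
    by_cases h : ∀ q ∈ dirtyList n c w m M K (workCount n m M K + 1), x q = false
    · rw [if_pos h, if_pos (this.2 h)]
    · rw [if_neg h, if_neg fun h' => h (this.1 h')]
  · obtain ⟨k, hk⟩ := hwork r.2 (List.mem_cons_of_mem _ (List.mem_map.2 ⟨r, hr, rfl⟩))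
    rw [hk, hx]

/-- The circuit tests only the thermometer and the blocks. Because `G` preserves the ports and the
work bits, these are `0` on the range of `G * embed`, where the test therefore recognizes exactly
the states with all ancillas `0`. -/
theorem reflectCircuit_mul [NeZero n] {G : Matrix (Lab n c w m M K (workCount n m M K + 1) → Bool)
      (Lab n c w m M K (workCount n m M K + 1) → Bool) ℂ}
    (hG : Pres (cleanSet n c w m M K (workCount n m M K + 1)) G) :
    Circuit.matrix p H (reflectCircuit n c w m M K) * (G * embed n c w m M K (workCount n m M K + 1)) =
      G * embed n c w m M K (workCount n m M K + 1) - (2 : ℂ) • (embed n c w m M K (workCount n m M K + 1) *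
        ((embed n c w m M K (workCount n m M K + 1))ᴴ * (G * embed n c w m M K (workCount n m M K + 1)))) := by
  obtain ⟨φ, hφ, hφx⟩ := reflectCircuit_mono (c := c) (w := w) (m := m) (M := M) (K := K) p H
  ext y u
  rw [hφ.diag_mul_apply, Matrix.sub_apply, Matrix.smul_apply, mul_embed_apply]
  have he : (embed n c w m M K (workCount n m M K + 1) * ((embed n c w m M K (workCount n m M K + 1))ᴴ * (G * embed n c w m M K (workCount n m M K + 1)))) y u =
      if ∃ v, y = zeroExt v then G y (zeroExt u) else 0 := by
    rw [Matrix.mul_apply]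
    simp only [embed_conjTranspose_mul_apply, mul_embed_apply]
    by_cases h : ∃ v, y = zeroExt v
    · obtain ⟨v, rfl⟩ := h
      rw [if_pos ⟨v, rfl⟩, Finset.sum_eq_single v]
      · simp [embed]
      · intro v' _ hv'
        simp [embed, zeroExt_injective.eq_iff, hv'.symm]
      · simp
    · rw [if_neg h, Finset.sum_eq_zero]
      intro v _
      push Not at h
      simp [embed, h v]
  rw [he]
  by_cases hy : G y (zeroExt u) = 0
  · simp [hy]
  have hclean := hG _ _ hy
  have hwork : ∀ k, y (.inr (.work k)) = false := fun k => hclean (.inr (.work k)) ⟨by simp, by simp, by simp⟩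
  have hport : ∀ t, y (portLab t) = false := fun k => hclean (portLab k) ⟨by simp, by simp, by simp⟩
  have hiff : (∀ q ∈ dirtyList n c w m M K (workCount n m M K + 1), y q = false) ↔ ∃ v, y = zeroExt v := by
    constructor
    · intro h
      refine ⟨fun k => y (.inl k), ?_⟩
      funext q
      rcases q with k | (k | t | k | ⟨i, b⟩)
      · rfl
      · exact h _ (therm_mem_dirtyList k)
      · exact hport t
      · exact hwork k
      · exact h _ (blkLab_mem_dirtyList i b)
    · rintro ⟨v, rfl⟩ q hq
      rcases q with k | q
      · exfalso
        revert hq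
        simp [dirtyList]
      · rfl
  rw [hφx y hwork]
  by_cases h : ∃ v, y = zeroExt v
  · rw [if_pos h, if_pos (hiff.2 h)]
    simp; ring
  · rw [if_neg h, if_neg fun h' => h (hiff.1 h')]
    simp

theorem norm_neg_one_phase (_r _s : Bool) : ‖(fun _ _ : Bool => (-1 : ℂ)) _r _s‖ = 1 := by simp

/-- One segment of the simulation. -/
def segmentCircuit [NeZero n] [NeZero M] (a b : ℕ → ℝ) (F G : Phases n c w M) (m K : ℕ) :
    Circuit n c w (Lab n c w m M K (workCount n m M K + 1)) :=
  lcuCircuit a b F G ++ (reflectCircuit n c w m M K ++ ((lcuCircuit a b F G).inv ++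
    (reflectCircuit n c w m M K ++ (lcuCircuit a b F G ++
      [diagOp (.inr (.therm 0)) (.inl 0) (by simp) (fun _ _ => -1) norm_neg_one_phase]))))

/-- The reflection is needed for `1`, for the linear combination circuit and for its adjoint, all of
which preserve `cleanSet`. The last gate is the scalar `-1`, which removes the sign in
`amplification_identity`. -/
theorem segmentCircuit_mul_embed [NeZero n] [NeZero M] (a b : ℕ → ℝ) (F G : Phases n c w M)
    {U : Matrix (Fin n → Bool) (Fin n → Bool) ℂ}
    (hU : ∀ v u, Circuit.matrix p H (lcuCircuit (m := m) (K := K)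
      (L := workCount n m M K + 1) a b F G) (zeroExt v) (zeroExt u) = 2⁻¹ * U v u) :
    Circuit.matrix p H (segmentCircuit a b F G m K) * embed n c w m M K (workCount n m M K + 1) =
      embed n c w m M K (workCount n m M K + 1) * U +
        Circuit.matrix p H (lcuCircuit (m := m) (K := K) (L := workCount n m M K + 1) a b F G) *
          embed n c w m M K (workCount n m M K + 1) * (1 - Uᴴ * U) := by
  have hpres := lcuCircuit_pres (c := c) (w := w) (m := m) (K := K) (L := workCount n m M K + 1)
    p H a b F G
  have hone := reflectCircuit_mul (c := c) (w := w) (m := m) (M := M) (K := K) p H (Pres.one _)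
  have key := amplification_identity
    (Circuit.conjTranspose_mul_matrix p H (lcuCircuit a b F G))
    embed_conjTranspose_mul_embed (U := U) (by
      ext v u
      rw [embed_conjTranspose_mul_apply, mul_embed_apply, hU]
      rfl)
    (by simpa using hone) (reflectCircuit_mul p H hpres) (reflectCircuit_mul p H hpres.conjTranspose)
  have hneg : (diagOp (n := n) (c := c) (w := w) (.inr (.therm 0)) (.inl 0) (by simp)
      (fun _ _ => -1) norm_neg_one_phase :
        Op n c w (Lab n c w m M K (workCount n m M K + 1))).matrix p H = -1 := by
    apply matrix_ext_ket
    intro x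
    rw [diagOp_mono, Matrix.neg_mulVec, Matrix.one_mulVec]
    simp
  simp only [segmentCircuit, Circuit.matrix_append, Circuit.matrix_cons, Circuit.matrix_nil,
    Circuit.matrix_inv, Matrix.one_mul, Matrix.mul_assoc, hneg] at key ⊢
  rw [key]
  simp

end HamSim

end

/-! ### Counting queries and gates. -/

noncomputable section

namespace HamSim

open Matrix

set_option linter.unusedSectionVars false

variable {n c w m M K L : ℕ}

/-! ### The size of the circuits -/

theorem phaseCircuit_queries (i : Fin K) (F : Phases n c w M) :
    Circuit.queries (phaseCircuit (m := m) (L := L) i F) = 0 := by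
  rw [phaseCircuit, Circuit.queries_flatMap (m := 0) _ _ fun l _ => rfl, mul_zero]

theorem phaseCircuit_gates (i : Fin K) (F : Phases n c w M) :
    Circuit.gates (phaseCircuit (m := m) (L := L) i F) = M * 2 := by
  rw [phaseCircuit, Circuit.gates_flatMap (m := 2) _ _ fun l _ => rfl, List.length_finRange]

theorem readCircuit_queries (i : Fin K) (F : Phases n c w M) :
    Circuit.queries (readCircuit (m := m) (L := L) i F) = 2 := by
  simp only [readCircuit, Circuit.queries_query, Circuit.queries_append, phaseCircuit_queries,
    Circuit.queries_nil]
  rw [Circuit.queries_flatMap (m := 0) _ _ fun l _ => rfl]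
  simp

theorem readCircuit_gates (i : Fin K) (F : Phases n c w M) :
    Circuit.gates (readCircuit (m := m) (L := L) i F) = M * 2 + n := by
  simp only [readCircuit, Circuit.gates_query, Circuit.gates_append, phaseCircuit_gates,
    Circuit.gates_nil]
  rw [Circuit.gates_flatMap (m := 1) _ _ fun l _ => rfl]
  simp

theorem swapCircuit_queries (i : Fin K) :
    Circuit.queries (swapCircuit (n := n) (c := c) (w := w) (m := m) (M := M) (L := L) i) = 0 := by
  simp only [swapCircuit, Circuit.queries_append]
  rw [Circuit.queries_flatMap (m := 0) _ _ fun l _ => rfl,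
    Circuit.queries_flatMap (m := 0) _ _ fun l _ => logicCircuit_queries _ _ _ _ _ _ _]
  simp

theorem swapCircuit_gates (i : Fin K) :
    Circuit.gates (swapCircuit (n := n) (c := c) (w := w) (m := m) (M := M) (L := L) i) =
      9 * (n + m) := by
  simp only [swapCircuit, Circuit.gates_append]
  rw [Circuit.gates_flatMap (m := 1) _ _ fun l _ => rfl,
    Circuit.gates_flatMap (m := 7) _ _ fun l _ => logicCircuit_gates _ _ _ _ _ _ _,
    swapList_length]
  ring

theorem prepCircuit_queries [NeZero n] [NeZero M] (i : Fin K) (a : ℕ → ℝ) :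
    Circuit.queries (prepCircuit (n := n) (c := c) (w := w) (m := m) (M := M) (L := L) i a) = 0 := by
  simp only [prepCircuit, Circuit.queries_append, hadCircuit_queries]
  exact (Nat.zero_add _).trans (cascade_queries _ _ _ _ _)

theorem prepCircuit_gates [NeZero n] [NeZero M] (i : Fin K) (a : ℕ → ℝ) :
    Circuit.gates (prepCircuit (n := n) (c := c) (w := w) (m := m) (M := M) (L := L) i a) ≤
      2 * m + M := by
  have h₁ := hadCircuit_gates (n := n) (c := c) (w := w)
    (blkLab i (.tgt 0) : Lab n c w m M K L) (countList i)
  have h₂ := cascade_gates (n := n) (c := c) (w := w)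
    (hotSeq i : ℕ → Lab n c w m M K L) a false 0 (M - 1)
  have h₃ : (countList i : List (Lab n c w m M K L)).length = m + m := by
    rw [countList, List.length_map, swapList_length]
  have hM : 1 ≤ M := NeZero.one_le
  simp only [prepCircuit, Circuit.gates_append, cnotOp, Circuit.gates_gate]
  omega

theorem blockCircuit_queries [NeZero n] [NeZero M] (i : Fin K) (a : ℕ → ℝ)
    (F G : Phases n c w M) :
    Circuit.queries (blockCircuit (m := m) (L := L) i a F G) = 4 := by
  simp [blockCircuit, walkCircuit, prepCircuit_queries, readCircuit_queries, swapCircuit_queries]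

theorem blockCircuit_gates [NeZero n] [NeZero M] (i : Fin K) (a : ℕ → ℝ) (F G : Phases n c w M) :
    Circuit.gates (blockCircuit (m := m) (L := L) i a F G) ≤ 11 * n + 13 * m + 6 * M := by
  have := prepCircuit_gates (n := n) (c := c) (w := w) (m := m) (M := M) (L := L) i a
  simp only [blockCircuit, walkCircuit, Circuit.gates_append, Circuit.gates_inv,
    readCircuit_gates, swapCircuit_gates]
  omega

theorem Circuit.gates_flatMap_le {ι : Type} [Fintype ι] [DecidableEq ι] {α : Type*} (l : List α) (f : α → Circuit n c w ι) {k : ℕ}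
    (h : ∀ a ∈ l, (f a).gates ≤ k) : Circuit.gates (l.flatMap f) ≤ l.length * k := by
  induction l with
  | nil => simp
  | cons a l ih =>
    have h₁ := ih fun b hb => h b (List.mem_cons_of_mem _ hb)
    have h₂ := h a List.mem_cons_self
    rw [List.flatMap_cons, Circuit.gates_append, List.length_cons, Nat.add_mul]
    omega

theorem startCircuit_queries (b : ℕ → ℝ) :
    Circuit.queries (startCircuit b : Circuit n c w (Lab n c w m M K L)) = 0 :=
  cascade_queries _ _ _ _ _

theorem startCircuit_gates (b : ℕ → ℝ) :
    Circuit.gates (startCircuit b : Circuit n c w (Lab n c w m M K L)) ≤ K + 2 :=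
  Nat.succ_le_succ (cascade_gates _ _ _ _ _)

theorem lcuCircuit_queries [NeZero n] [NeZero M] (a b : ℕ → ℝ) (F G : Phases n c w M) :
    Circuit.queries (lcuCircuit (m := m) (K := K) (L := L) a b F G) = 4 * K := by
  simp only [lcuCircuit, blocksCircuit, Circuit.queries_append, startCircuit_queries]
  rw [Circuit.queries_flatMap (m := 4) _ _ fun i _ => blockCircuit_queries i a F G, diagOp,
    Circuit.queries_gate, Circuit.queries_inv, startCircuit_queries, List.length_finRange]
  ring

theorem lcuCircuit_gates [NeZero n] [NeZero M] (a b : ℕ → ℝ) (F G : Phases n c w M) :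
    Circuit.gates (lcuCircuit (m := m) (K := K) (L := L) a b F G) ≤
      K * (11 * n + 13 * m + 6 * M) + 2 * K + 5 := by
  have h₁ := startCircuit_gates (n := n) (c := c) (w := w) (m := m) (M := M) (K := K) (L := L) b
  have h₂ := Circuit.gates_flatMap_le (List.finRange K)
    (fun i => blockCircuit (m := m) (L := L) i a F G) fun i _ => blockCircuit_gates i a F G
  rw [List.length_finRange] at h₂
  simp only [lcuCircuit, blocksCircuit, Circuit.gates_append, diagOp, Circuit.gates_gate,
    Circuit.gates_inv]
  omega

theorem reflectCircuit_queries [NeZero n] : Circuit.queries (reflectCircuit n c w m M K) = 0 :=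
  reflCircuit_queries _ _ _

theorem reflectCircuit_gates [NeZero n] :
    Circuit.gates (reflectCircuit n c w m M K) ≤ 14 * workCount n m M K + 1 := by
  refine (reflCircuit_gates _ _ _).trans (le_of_eq ?_)
  have : (chainList n c w m M K).length = workCount n m M K := by
    rw [← List.length_map (f := Prod.snd), chainList_map_snd, List.length_map,
      List.length_finRange]
  rw [this]

/-- Three uses of the linear combination, each with `K` blocks of two readings, each reading with
two queries. -/
theorem segmentCircuit_queries [NeZero n] [NeZero M] (a b : ℕ → ℝ) (F G : Phases n c w M) :
    Circuit.queries (segmentCircuit a b F G m K) = 12 * K := by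
  simp only [segmentCircuit, Circuit.queries_append, Circuit.queries_inv, lcuCircuit_queries,
    reflectCircuit_queries, diagOp, Circuit.queries_gate, Circuit.queries_nil]
  ring

/-- The bounds `m ≤ n`, `1 ≤ K` and `1 ≤ n` absorb the counters and the additive constants into `K *
n`. -/
theorem segmentCircuit_gates [NeZero n] [NeZero M] (hK : 1 ≤ K) (hm : m ≤ n) (a b : ℕ → ℝ)
    (F G : Phases n c w M) :
    Circuit.gates (segmentCircuit a b F G m K) ≤ K * (292 * n + 46 * M) := by
  have h₁ := lcuCircuit_gates (m := m) (K := K) (L := workCount n m M K + 1) a b F G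
  have h₂ := reflectCircuit_gates (n := n) (c := c) (w := w) (m := m) (M := M) (K := K)
  have hn : 1 ≤ n := NeZero.one_le
  have h₃ : K * m ≤ K * n := Nat.mul_le_mul_left _ hm
  have h₄ : K ≤ K * n := Nat.le_mul_of_pos_right _ hn
  simp only [segmentCircuit, Circuit.gates_append, Circuit.gates_inv, diagOp, Circuit.gates_gate,
    Circuit.gates_nil]
  simp only [workCount, Nat.mul_add, Nat.mul_left_comm K] at h₁ h₂ ⊢
  omega

/-- Repetition of a circuit. -/
def Circuit.iterate {ι : Type} (r : ℕ) (S : Circuit n c w ι) : Circuit n c w ι :=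
  (List.replicate r S).flatten

theorem Circuit.iterate_succ {ι : Type} [Fintype ι] [DecidableEq ι] (r : ℕ) (S : Circuit n c w ι) :
    Circuit.iterate (r + 1) S = S ++ Circuit.iterate r S := rfl

theorem Circuit.iterate_queries {ι : Type} [Fintype ι] [DecidableEq ι] (r : ℕ) (S : Circuit n c w ι) :
    (Circuit.iterate r S).queries = r * S.queries := by
  induction r with
  | zero => simp [Circuit.iterate]
  | succ r ih => rw [Circuit.iterate_succ, Circuit.queries_append, ih]; ring

theorem Circuit.iterate_gates {ι : Type} [Fintype ι] [DecidableEq ι] (r : ℕ) (S : Circuit n c w ι) :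
    (Circuit.iterate r S).gates = r * S.gates := by
  induction r with
  | zero => simp [Circuit.iterate]
  | succ r ih => rw [Circuit.iterate_succ, Circuit.gates_append, ih]; ring

theorem Circuit.iterate_matrix {ι : Type} [Fintype ι] [DecidableEq ι] (p : ℕ)
    (H : Matrix (Fin (2 ^ n)) (Fin (2 ^ n)) ℂ) (r : ℕ) (S : Circuit n c w ι) :
    (Circuit.iterate r S).matrix p H = S.matrix p H ^ r := by
  induction r with
  | zero => rw [pow_zero]; rfl
  | succ r ih => rw [Circuit.iterate_succ, Circuit.matrix_append, ih, pow_succ]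

end HamSim

end

/-! ### Rounded entries as averages of phases. -/

noncomputable section

namespace HamSim

open Matrix

set_option linter.unusedSectionVars false

/-! ### Rounding the entries of the Hamiltonian -/

/-- The number represented by the sign of `x` and the bits `k₀, …, k₀ + b - 1` of its magnitude. -/
def keepReal (p k₀ b : ℕ) (x : ℝ) : ℝ :=
  (if x < 0 then -1 else 1) * ((2 : ℝ) ^ k₀ / 2 ^ p * ((magnitude p x / 2 ^ k₀ % 2 ^ b : ℕ) : ℝ))

/-- The real and the imaginary part are rounded. -/
def keep (p k₀ b : ℕ) (z : ℂ) : ℂ := ⟨keepReal p k₀ b z.re, keepReal p k₀ b z.im⟩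

variable (p k₀ b : ℕ)

theorem magnitude_neg (x : ℝ) : magnitude p (-x) = magnitude p x := by
  rw [magnitude, abs_neg, magnitude]

theorem keepReal_zero : keepReal p k₀ b 0 = 0 := by simp [keepReal, magnitude]

theorem keep_zero : keep p k₀ b 0 = 0 := by
  apply Complex.ext <;> simp [keep, keepReal_zero]

theorem keepReal_neg (x : ℝ) : keepReal p k₀ b (-x) = -keepReal p k₀ b x := by
  rcases lt_trichotomy x 0 with h | rfl | h
  · rw [keepReal, keepReal, magnitude_neg, if_neg (by linarith), if_pos h]; ring
  · rw [neg_zero, keepReal_zero, neg_zero]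
  · rw [keepReal, keepReal, magnitude_neg, if_pos (by linarith), if_neg (by linarith)]; ring

theorem keep_star (z : ℂ) : keep p k₀ b (star z) = star (keep p k₀ b z) := by
  apply Complex.ext <;> simp [keep, keepReal_neg]

theorem sum_testBit (x b : ℕ) :
    ∑ k : Fin b, (2 : ℂ) ^ k.1 * (if x.testBit k then 1 else 0) = ((x % 2 ^ b : ℕ) : ℂ) := by
  induction b with
  | zero => simp [Nat.mod_one]
  | succ b ih =>
    rw [Fin.sum_univ_castSucc, Nat.pow_succ, Nat.mod_mul, Nat.cast_add]
    simp only [Fin.val_castSucc, Fin.val_last, ih]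
    congr 1
    simp only [Nat.testBit_eq_decide_div_mod_eq]
    rcases Nat.mod_two_eq_zero_or_one (x / 2 ^ b) with h | h <;> simp [h]

theorem abs_sign_mul (x y : ℝ) : |(if x < 0 then (-1 : ℝ) else 1) * y| = |y| := by
  split_ifs <;> simp

theorem abs_keepReal_le (x : ℝ) : |keepReal p k₀ b x| ≤ 2 ^ k₀ / 2 ^ p * (2 ^ b - 1) := by
  rw [keepReal, abs_sign_mul, abs_of_nonneg (by positivity)]
  have h : magnitude p x / 2 ^ k₀ % 2 ^ b + 1 ≤ 2 ^ b := Nat.mod_lt _ (by positivity)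
  have h' : ((magnitude p x / 2 ^ k₀ % 2 ^ b : ℕ) : ℝ) + 1 ≤ 2 ^ b := by exact_mod_cast h
  gcongr
  linarith

theorem norm_keep_le (z : ℂ) : ‖keep p k₀ b z‖ ≤ 2 * (2 ^ k₀ / 2 ^ p * (2 ^ b - 1)) := by
  refine (Complex.norm_le_abs_re_add_abs_im _).trans ?_
  have h₁ := abs_keepReal_le p k₀ b z.re
  have h₂ := abs_keepReal_le p k₀ b z.im
  simp only [keep]
  linarith

/-- The hypothesis says that no bit above the kept window is set, so only the lowest `k₀` bits are
lost. The bound has `2 ^ k₀ - 1` rather than `2 ^ k₀` so that it vanishes for `k₀ = 0`, when all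
bits are kept. -/
theorem abs_truncReal_sub_keepReal_le {x : ℝ} (hx : magnitude p x < 2 ^ (k₀ + b)) :
    |truncReal p x - keepReal p k₀ b x| ≤ (2 ^ k₀ - 1) / 2 ^ p := by
  have h₀ : magnitude p x / 2 ^ k₀ % 2 ^ b = magnitude p x / 2 ^ k₀ := by
    apply Nat.mod_eq_of_lt
    rw [Nat.div_lt_iff_lt_mul (by positivity), ← pow_add, add_comm]
    exact hx
  have h₁ : magnitude p x % 2 ^ k₀ + 1 ≤ 2 ^ k₀ := Nat.mod_lt _ (by positivity)
  have h₂ : ((magnitude p x % 2 ^ k₀ : ℕ) : ℝ) + 1 ≤ 2 ^ k₀ := by exact_mod_cast h₁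
  have h₃ : (magnitude p x : ℝ) =
      2 ^ k₀ * ((magnitude p x / 2 ^ k₀ : ℕ) : ℝ) + ((magnitude p x % 2 ^ k₀ : ℕ) : ℝ) := by
    exact_mod_cast (Nat.div_add_mod _ _).symm
  rw [truncReal, keepReal, ← mul_sub, abs_sign_mul, h₀, h₃]
  rw [show ∀ a b c d : ℝ, (a * b + c) / d - a / d * b = c / d by intros; ring,
    abs_of_nonneg (by positivity)]
  gcongr
  linarith

theorem norm_trunc_sub_keep_le {z : ℂ} (hre : magnitude p z.re < 2 ^ (k₀ + b))
    (him : magnitude p z.im < 2 ^ (k₀ + b)) :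
    ‖trunc p z - keep p k₀ b z‖ ≤ 2 * ((2 ^ k₀ - 1) / 2 ^ p) := by
  refine (Complex.norm_le_abs_re_add_abs_im _).trans ?_
  have h₁ := abs_truncReal_sub_keepReal_le p k₀ b hre
  have h₂ := abs_truncReal_sub_keepReal_le p k₀ b him
  simp only [trunc, keep, Complex.sub_re, Complex.sub_im]
  linarith

/-! ### The enumeration of the nonzero entries -/

theorem nthNonzero_eq_some {N : ℕ} {H : Matrix (Fin N) (Fin N) ℂ} {u v : Fin N} {j : ℕ}
    (h : nthNonzero H u j = some v) : H u v ≠ 0 := by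
  classical
  have := List.mem_iff_getElem?.2 ⟨j, h⟩
  rw [Finset.mem_sort] at this
  simpa using this

theorem existsUnique_nthNonzero {N D : ℕ} {H : Matrix (Fin N) (Fin N) ℂ} {u v : Fin N}
    (hD : {v | H u v ≠ 0}.ncard ≤ D) (h : H u v ≠ 0) :
    ∃ j < D, ∀ j', nthNonzero H u j' = some v ↔ j' = j := by
  classical
  have hmem : v ∈ (Finset.univ.filter fun v => H u v ≠ 0).sort (· ≤ ·) := by
    rw [Finset.mem_sort]; simpa using h
  obtain ⟨j, hj⟩ := List.mem_iff_getElem?.1 hmem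
  obtain ⟨hlt, hj'⟩ := List.getElem?_eq_some_iff.1 hj
  have hcard : (Finset.univ.filter fun v => H u v ≠ 0).card ≤ D := by
    refine le_trans (le_of_eq ?_) hD
    rw [← Set.ncard_coe_finset]
    simp
  refine ⟨j, lt_of_lt_of_le hlt (by rw [Finset.length_sort]; exact hcard), fun j' => ?_⟩
  constructor
  · intro h'
    obtain ⟨hlt', hj''⟩ := List.getElem?_eq_some_iff.1 h'
    exact (Finset.sort_nodup _ _).getElem_inj_iff.1 (hj''.trans hj'.symm)
  · rintro rfl
    unfold nthNonzero
    convert hj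

/-- The number held by an index register of which only `m` bits are used. -/
def indexOf (c : ℕ) {m : ℕ} (s : Fin m → Bool) : ℕ :=
  Nat.ofBits fun k : Fin c => if h : k.1 < m then s ⟨k, h⟩ else false

theorem indexOf_injective {c m : ℕ} (hm : m ≤ c) :
    Function.Injective (indexOf c : (Fin m → Bool) → ℕ) := by
  intro s t h
  funext k
  have := congrArg (fun x => x.testBit k.1) h
  simpa [indexOf, Nat.testBit_ofBits_lt _ _ (k.2.trans_le hm)] using this

theorem exists_indexOf_eq {c m j : ℕ} (hm : m ≤ c) (hj : j < 2 ^ m) :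
    ∃ s : Fin m → Bool, indexOf c s = j := by
  refine ⟨fun k => j.testBit k, Nat.eq_of_testBit_eq fun i => ?_⟩
  by_cases hi : i < c
  · rw [indexOf, Nat.testBit_ofBits_lt _ _ hi]
    split_ifs with h
    · rfl
    · exact (Nat.testBit_lt_two_pow (hj.trans_le (Nat.pow_le_pow_right two_pos (by simpa using h)))).symm
  · rw [indexOf, Nat.testBit_ofBits_ge _ _ (by omega)]
    exact (Nat.testBit_lt_two_pow (hj.trans_le (Nat.pow_le_pow_right two_pos (by omega)))).symm

/-- A nonzero entry occurs exactly once in the enumeration of its row, at an index that fits into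
`m` bits; hence exactly one value of the counter finds it. -/
theorem sum_nthNonzero {N c m : ℕ} (hm : m ≤ c) {H : Matrix (Fin N) (Fin N) ℂ} {u v : Fin N}
    (hD : {v | H u v ≠ 0}.ncard ≤ 2 ^ m) (X : ℂ) :
    ∑ s : Fin m → Bool, (if nthNonzero H u (indexOf c s) = some v then X else 0) =
      if H u v = 0 then 0 else X := by
  by_cases h : H u v = 0
  · rw [if_pos h, Finset.sum_eq_zero]
    intro s _
    rw [if_neg fun h' => nthNonzero_eq_some h' h]
  · obtain ⟨j, hj, hj'⟩ := existsUnique_nthNonzero hD h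
    obtain ⟨s, hs⟩ := exists_indexOf_eq hm hj
    rw [if_neg h, Finset.sum_eq_single s]
    · rw [if_pos ((hj' _).2 hs)]
    · intro s' _ hs'
      rw [if_neg fun h' => hs' (indexOf_injective hm (((hj' _).1 h').trans hs.symm))]
    · simp

/-! ### The weights and phases -/

variable {p k₀ b} {n c w : ℕ}

/-- The slots of the one-hot register: whether the imaginary part is read, two signs, and the
number of a bit. -/
def slotEquiv (b : ℕ) : Fin (8 * b) ≃ (Bool × Bool × Bool) × Fin b :=
  (Fintype.equivFinOfCardEq (by simp)).symm

/-- The number of the bit of a slot. -/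
def slotBit (l : Fin (8 * b)) : Fin b := (slotEquiv b l).2

/-- The port that holds a bit of the real or imaginary part. -/
def magPort (hw : k₀ + b ≤ w) (im : Bool) (k : Fin b) : Port n c w :=
  if im then .imMag ⟨k₀ + k, by omega⟩ else .reMag ⟨k₀ + k, by omega⟩

/-- The port that holds the sign of the real or imaginary part. -/
def signPort (im : Bool) : Port n c w := if im then .imSign else .reSign

theorem magPort_isOut (hw : k₀ + b ≤ w) (im : Bool) (k : Fin b) :
    (magPort hw im k : Port n c w).IsOut := by
  cases im <;> trivial

theorem signPort_isOut (im : Bool) : (signPort im : Port n c w).IsOut := by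
  cases im <;> trivial

/-- The phases of the first reading: the two signs cancel unless the bit is set. -/
def firstPhases (hw : k₀ + b ≤ w) : Phases n c w (8 * b) where
  bitPort l := magPort hw (slotEquiv b l).1.1 (slotBit l)
  signPort l := signPort (slotEquiv b l).1.1
  bitPort_isOut _ := magPort_isOut _ _ _
  signPort_isOut _ := signPort_isOut _
  bit l r := sgn ((slotEquiv b l).1.2.1 && !r)
  sign _ _ := 1
  norm_bit _ _ := norm_sgn _
  norm_sign _ _ := norm_one

/-- The phases of the second reading, which contain the sign of the entry. -/
def secondPhases (hw : k₀ + b ≤ w) : Phases n c w (8 * b) where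
  bitPort l := magPort hw (slotEquiv b l).1.1 (slotBit l)
  signPort l := signPort (slotEquiv b l).1.1
  bitPort_isOut _ := magPort_isOut _ _ _
  signPort_isOut _ := signPort_isOut _
  bit l r := sgn ((slotEquiv b l).1.2.2 && !r)
  sign l r := sgn r * if (slotEquiv b l).1.1 then 1 else -Complex.I
  norm_bit _ _ := norm_sgn _
  norm_sign l r := by
    rw [norm_mul, norm_sgn]
    split_ifs <;> simp

/-- The amplitudes of the slots. -/
def slotWeight (b l : ℕ) : ℝ :=
  if h : l < 8 * b then Real.sqrt (2 ^ (slotBit ⟨l, h⟩ : Fin b).1 / (8 * (2 ^ b - 1))) else 1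

theorem two_pow_sub_one_pos (hb : 0 < b) : (0 : ℝ) < 2 ^ b - 1 := by
  have := one_lt_pow₀ (one_lt_two (α := ℝ)) hb.ne'
  linarith

/-- The value `1` outside the range of slots is there for this lemma: `cascade_mulVec` asks for
positive weights at all natural numbers. -/
theorem slotWeight_pos (hb : 0 < b) (l : ℕ) : 0 < slotWeight b l := by
  have := two_pow_sub_one_pos hb
  unfold slotWeight
  split_ifs
  · positivity
  · exact one_pos

theorem slotWeight_sq (hb : 0 < b) (l : Fin (8 * b)) :
    slotWeight b l ^ 2 = 2 ^ (slotBit l).1 / (8 * (2 ^ b - 1)) := by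
  have := two_pow_sub_one_pos hb
  rw [slotWeight, dif_pos l.2, Real.sq_sqrt (by positivity)]

theorem sum_slots {R : Type*} [AddCommMonoid R] (f : (Bool × Bool × Bool) × Fin b → R) :
    ∑ l : Fin (8 * b), f (slotEquiv b l) = ∑ im, ∑ k, ∑ r, ∑ r', f ((im, r, r'), k) := by
  rw [Equiv.sum_comp (slotEquiv b) f]
  simp only [Fintype.sum_prod_type]
  refine Finset.sum_congr rfl fun im _ => Eq.trans ?_ Finset.sum_comm
  exact Finset.sum_congr rfl fun r _ => Finset.sum_comm

theorem sum_slotWeight_sq (hb : 0 < b) : ∑ l : Fin (8 * b), slotWeight b l ^ 2 = 1 := by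
  have h := two_pow_sub_one_pos hb
  simp only [slotWeight_sq hb]
  rw [show ∑ l : Fin (8 * b), (2 : ℝ) ^ (slotBit l).1 / (8 * (2 ^ b - 1)) =
    ∑ l : Fin (8 * b), (fun q : (Bool × Bool × Bool) × Fin b =>
      (2 : ℝ) ^ q.2.1 / (8 * (2 ^ b - 1))) (slotEquiv b l) from rfl]
  rw [sum_slots (fun q : (Bool × Bool × Bool) × Fin b => (2 : ℝ) ^ q.2.1 / (8 * (2 ^ b - 1)))]
  simp only [Fintype.sum_bool, ← Finset.sum_div, Finset.sum_add_distrib]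
  have : ∑ k : Fin b, (2 : ℝ) ^ k.1 = 2 ^ b - 1 := by
    rw [← Finset.sum_range fun k => (2 : ℝ) ^ k, geom_sum_eq (by norm_num)]
    norm_num
  rw [this]
  field_simp
  norm_num

/-- For each bit, the average over `r` of the sign `(-1) ^ (r ∧ ¬bit)` is `1` if the bit is set and
`0` otherwise; the same holds for `r'` and the second reading. The weights then assemble the number
whose bits are set in both readings. The factors `-i` and `1` for the real and imaginary parts are
those of `-i(x + iy) = -ix + y`. -/
theorem sum_phases (hb : 0 < b) (hw : k₀ + b ≤ w) (z z' : Port n c w → Bool) :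
    ∑ l : Fin (8 * b), (slotWeight b l : ℂ) ^ 2 *
        ((firstPhases hw).val z l * (secondPhases hw).val z' l) =
      ((2 * (2 ^ b - 1) : ℝ) : ℂ)⁻¹ * ∑ im : Bool, (sgn (z' (signPort im)) *
        if im then 1 else -Complex.I) * ∑ k, (2 : ℂ) ^ k.1 *
          if z (magPort hw im k) && z' (magPort hw im k) then 1 else 0 := by
  have h := two_pow_sub_one_pos hb
  let f : (Bool × Bool × Bool) × Fin b → ℂ := fun q =>
    ((2 ^ q.2.1 / (8 * (2 ^ b - 1)) : ℝ) : ℂ) *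
      ((sgn (q.1.2.1 && !z (magPort hw q.1.1 q.2))) *
        ((sgn (q.1.2.2 && !z' (magPort hw q.1.1 q.2))) * (sgn (z' (signPort q.1.1)) *
          if q.1.1 then 1 else -Complex.I)))
  have e : ∀ l : Fin (8 * b), (slotWeight b l : ℂ) ^ 2 *
      ((firstPhases hw).val z l * (secondPhases hw).val z' l) = f (slotEquiv b l) := by
    intro l
    rw [← Complex.ofReal_pow, slotWeight_sq hb]
    simp [f, Phases.val, firstPhases, secondPhases, slotBit]
  rw [Finset.sum_congr rfl fun l _ => e l, sum_slots f, Finset.mul_sum]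
  refine Finset.sum_congr rfl fun im _ => ?_
  rw [Finset.mul_sum, Finset.mul_sum]
  refine Finset.sum_congr rfl fun k _ => ?_
  have h' : ((2 : ℂ) ^ b - 1) ≠ 0 := by exact_mod_cast h.ne'
  change ∑ r : Bool, ∑ r' : Bool, ((2 ^ k.1 / (8 * (2 ^ b - 1)) : ℝ) : ℂ) *
    ((sgn (r && !z (magPort hw im k))) * ((sgn (r' && !z' (magPort hw im k))) *
      (sgn (z' (signPort im)) * if im then 1 else -Complex.I))) = _
  generalize z (magPort hw im k) = r
  generalize z' (magPort hw im k) = r'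
  generalize sgn (z' (signPort im)) * (if im then 1 else -Complex.I) = B
  push_cast
  cases r <;> cases r' <;> simp [sgn]
  field_simp
  ring

/-- The rounded Hamiltonian. -/
def rounded (p k₀ b : ℕ) {N : ℕ} (H : Matrix (Fin N) (Fin N) ℂ) : Matrix (Fin N) (Fin N) ℂ :=
  Matrix.of fun u v => keep p k₀ b (H u v)

theorem rounded_isHermitian {N : ℕ} {H : Matrix (Fin N) (Fin N) ℂ} (hH : H.IsHermitian) :
    (rounded p k₀ b H).IsHermitian := by
  ext u v
  rw [Matrix.conjTranspose_apply]
  simp only [rounded, Matrix.of_apply]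
  rw [← keep_star, hH.apply]

/-- The normalization of a block. -/
def blockScale (p k₀ b m : ℕ) : ℝ := 4 ^ m * (2 * (2 ^ b - 1)) * (2 ^ k₀ / 2 ^ p)

/-- By Hermitian symmetry the magnitudes read at `(u, v)` and at `(v, u)` coincide, so the
conjunction of their bits is the bit itself, while the signs come from the second reading alone. A
missing entry is answered by zeros, which could be mistaken for column `0`; this does no harm
because its magnitude bits vanish and the phases average to `0`. -/
theorem sum_phases_answer (hb : 0 < b) (hw : k₀ + b ≤ w)
    {H : Matrix (Fin (2 ^ n)) (Fin (2 ^ n)) ℂ} (hH : H.IsHermitian) (u v : Fin (2 ^ n)) (j j' : ℕ) :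
    (if (fun k : Fin n => answer p H u j (.pos k : Port n c w)) = (fun k : Fin n => v.1.testBit k) ∧
        (fun k : Fin n => answer p H v j' (.pos k : Port n c w)) = (fun k : Fin n => u.1.testBit k) then
      ∑ l : Fin (8 * b), (slotWeight b l : ℂ) ^ 2 *
        ((firstPhases hw).val (answer p H u j : Port n c w → Bool) l *
          (secondPhases hw).val (answer p H v j' : Port n c w → Bool) l) else 0) =
      if nthNonzero H u j = some v then if nthNonzero H v j' = some u then
        ((2 * (2 ^ b - 1) * (2 ^ k₀ / 2 ^ p) : ℝ) : ℂ)⁻¹ * (-Complex.I * rounded p k₀ b H v u)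
        else 0 else 0 := by
  have hinj : ∀ x y : Fin (2 ^ n), (fun k : Fin n => x.1.testBit k) = (fun k : Fin n => y.1.testBit k) →
      x = y := by
    intro x y h
    refine Fin.ext (Nat.eq_of_testBit_eq fun i => ?_)
    by_cases hi : i < n
    · exact congrFun h ⟨i, hi⟩
    · have hp : (2 : ℕ) ^ n ≤ 2 ^ i := Nat.pow_le_pow_right two_pos (by omega)
      rw [Nat.testBit_lt_two_pow (x.2.trans_le hp), Nat.testBit_lt_two_pow (y.2.trans_le hp)]
  rw [sum_phases hb]
  have hzero : ∀ z z' : Port n c w → Bool, (∀ im k, (z (magPort hw im k) && z' (magPort hw im k)) =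
      false) → ((2 * (2 ^ b - 1) : ℝ) : ℂ)⁻¹ * ∑ im : Bool, (sgn (z' (signPort im)) *
        if im then 1 else -Complex.I) * ∑ k, (2 : ℂ) ^ k.1 *
          (if z (magPort hw im k) && z' (magPort hw im k) then 1 else 0) = 0 := by
    intro z z' h
    simp [h]
  rcases h₁ : nthNonzero H u j with _ | v₁
  · rw [hzero, ite_self, if_neg (by simp)]
    intro im k
    simp [answer, h₁]
  rcases h₂ : nthNonzero H v j' with _ | u₁
  · rw [hzero]
    · simp
    · intro im k
      simp [answer, h₂]
  have e₁ : (fun k : Fin n => answer p H u j (.pos k : Port n c w)) =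
      fun k : Fin n => v₁.1.testBit k := by
    funext k; simp [answer, h₁]
  have e₂ : (fun k : Fin n => answer p H v j' (.pos k : Port n c w)) =
      fun k : Fin n => u₁.1.testBit k := by
    funext k; simp [answer, h₂]
  rw [e₁, e₂]
  by_cases hv : v₁ = v
  swap
  · rw [if_neg fun h => hv (hinj _ _ h.1), if_neg fun h => hv (Option.some.inj h)]
  by_cases hu : u₁ = u
  swap
  · rw [if_neg fun h => hu (hinj _ _ h.2), if_pos (by rw [hv]),
      if_neg fun h => hu (Option.some.inj h)]
  subst hv hu
  rw [if_pos ⟨rfl, rfl⟩, if_pos rfl, if_pos rfl]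
  have hm : ∀ k : Fin b, (answer p H u₁ j (magPort hw false k : Port n c w) &&
      answer p H v₁ j' (magPort hw false k : Port n c w)) =
        (magnitude p (H v₁ u₁).re / 2 ^ k₀).testBit k := by
    intro k
    have : magnitude p (H u₁ v₁).re = magnitude p (H v₁ u₁).re := by
      rw [← hH.apply]; simp
    simp [answer, h₁, h₂, magPort, this, Nat.testBit_div_two_pow, add_comm k₀]
  have hm' : ∀ k : Fin b, (answer p H u₁ j (magPort hw true k : Port n c w) &&
      answer p H v₁ j' (magPort hw true k : Port n c w)) =
        (magnitude p (H v₁ u₁).im / 2 ^ k₀).testBit k := by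
    intro k
    have : magnitude p (H u₁ v₁).im = magnitude p (H v₁ u₁).im := by
      rw [← hH.apply]; simp [magnitude_neg]
    simp [answer, h₁, h₂, magPort, this, Nat.testBit_div_two_pow, add_comm k₀]
  have hs : sgn (answer p H v₁ j' (signPort false : Port n c w)) =
      ((if (H v₁ u₁).re < 0 then -1 else 1 : ℝ) : ℂ) := by
    by_cases h : (H v₁ u₁).re < 0 <;> simp [answer, h₂, signPort, sgn, h]
  have hs' : sgn (answer p H v₁ j' (signPort true : Port n c w)) =
      ((if (H v₁ u₁).im < 0 then -1 else 1 : ℝ) : ℂ) := by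
    by_cases h : (H v₁ u₁).im < 0 <;> simp [answer, h₂, signPort, sgn, h]
  simp only [Fintype.sum_bool, hm, hm', hs, hs', sum_testBit, if_true, mul_one]
  have hr : rounded p k₀ b H v₁ u₁ = (keepReal p k₀ b (H v₁ u₁).re : ℂ) +
      keepReal p k₀ b (H v₁ u₁).im * Complex.I := by
    apply Complex.ext <;> simp [rounded, keep]
  rw [hr, keepReal, keepReal]
  have h := two_pow_sub_one_pos hb
  have h' : ((2 : ℂ) ^ b - 1) ≠ 0 := by exact_mod_cast h.ne'
  have hI : Complex.I * Complex.I = -1 := Complex.I_mul_I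
  push_cast
  generalize ((if (H v₁ u₁).re < 0 then -1 else 1 : ℝ) : ℂ) = s₁
  generalize ((if (H v₁ u₁).im < 0 then -1 else 1 : ℝ) : ℂ) = s₂
  have hq : ((2 : ℂ) ^ k₀ / 2 ^ p)⁻¹ * (2 ^ k₀ / 2 ^ p) = 1 := inv_mul_cancel₀ (by simp)
  generalize (2 : ℂ) ^ k₀ / 2 ^ p = q at hq ⊢
  generalize ((magnitude p (H v₁ u₁).re / 2 ^ k₀ % 2 ^ b : ℕ) : ℂ) = N₁
  generalize ((magnitude p (H v₁ u₁).im / 2 ^ k₀ % 2 ^ b : ℕ) : ℂ) = N₂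
  rw [mul_inv _ q]
  generalize (2 * ((2 : ℂ) ^ b - 1))⁻¹ = A
  linear_combination (-A * (-Complex.I * s₁ * N₁ - s₂ * N₂ * Complex.I * Complex.I)) * hq +
    A * s₂ * N₂ * hI

/-- For a nonzero entry exactly one `s` leads from `u` to `v` and exactly one `s'` leads back, so
one of the `4 ^ m` pairs survives. For a zero entry both sides vanish, since rounding fixes `0`. -/
theorem blockAmp_eq {m : ℕ} (hm : m ≤ c) (hb : 0 < b) (hw : k₀ + b ≤ w)
    {H : Matrix (Fin (2 ^ n)) (Fin (2 ^ n)) ℂ} (hH : H.IsHermitian)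
    (hD : ∀ u, {v | H u v ≠ 0}.ncard ≤ 2 ^ m) (v u : Fin n → Bool) :
    blockAmp (c := c) p H (slotWeight b) (firstPhases hw) (secondPhases hw) m v u =
      ((blockScale p k₀ b m : ℝ) : ℂ)⁻¹ *
        (-Complex.I * rounded p k₀ b H (Fin.ofBits v) (Fin.ofBits u)) := by
  have hbits : ∀ v : Fin n → Bool, (fun k : Fin n => (Fin.ofBits v).1.testBit k) = v := by
    intro v
    funext k
    exact Nat.testBit_ofBits_lt _ _ k.2
  have key : ∀ s s' : Fin m → Bool, (∑ l : Fin (8 * b),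
      if oraclePos p H c w u s = v ∧ oraclePos p H c w v s' = u then
        ((4 : ℂ) ^ m)⁻¹ * (slotWeight b l : ℂ) ^ 2 *
          ((firstPhases hw).val (oracle p H c w u s) l *
            (secondPhases hw).val (oracle p H c w v s') l) else 0) =
      ((4 : ℂ) ^ m)⁻¹ * if nthNonzero H (Fin.ofBits u) (indexOf c s) = some (Fin.ofBits v) then
        if nthNonzero H (Fin.ofBits v) (indexOf c s') = some (Fin.ofBits u) then
        ((2 * (2 ^ b - 1) * (2 ^ k₀ / 2 ^ p) : ℝ) : ℂ)⁻¹ *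
          (-Complex.I * rounded p k₀ b H (Fin.ofBits v) (Fin.ofBits u))
        else 0 else 0 := by
    intro s s'
    rw [← sum_phases_answer (c := c) hb hw hH, hbits, hbits]
    rw [mul_ite, mul_zero, Finset.mul_sum]
    simp only [mul_assoc]
    by_cases h : oraclePos p H c w u s = v ∧ oraclePos p H c w v s' = u
    · simp only [if_pos h]
      exact (if_pos h).symm
    · simp only [if_neg h]
      exact Finset.sum_const_zero.trans (if_neg h).symm
  rw [blockAmp, Fintype.sum_prod_type]
  simp only [key]
  rw [Fintype.sum_prod_type]
  simp only [← Finset.mul_sum]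
  rw [Finset.sum_congr rfl fun s _ => show _ = if nthNonzero H (Fin.ofBits u) (indexOf c s) =
    some (Fin.ofBits v) then if H (Fin.ofBits v) (Fin.ofBits u) = 0 then 0 else
      ((2 * (2 ^ b - 1) * (2 ^ k₀ / 2 ^ p) : ℝ) : ℂ)⁻¹ *
          (-Complex.I * rounded p k₀ b H (Fin.ofBits v) (Fin.ofBits u)) else 0 by
      by_cases h : nthNonzero H (Fin.ofBits u) (indexOf c s) = some (Fin.ofBits v)
      · simp only [if_pos h]
        exact sum_nthNonzero hm (hD _) _
      · simp only [if_neg h, Finset.sum_const_zero],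
    sum_nthNonzero hm (hD _)]
  by_cases h : H (Fin.ofBits v) (Fin.ofBits u) = 0
  · have : rounded p k₀ b H (Fin.ofBits v) (Fin.ofBits u) = 0 := by
      rw [rounded, Matrix.of_apply, h, keep_zero]
    rw [this]
    simp
  · have h' : H (Fin.ofBits u) (Fin.ofBits v) ≠ 0 := by
      rw [← hH.apply]
      simpa using h
    rw [if_neg h, if_neg h', blockScale]
    push_cast
    simp only [mul_inv]
    ring

end HamSim

end

/-! ### Norm estimates for exponentials, sparse matrices and segments. -/

noncomputable section

namespace HamSim

open Matrix

set_option linter.unusedSectionVars false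

/-! ### The exponential of skew-adjoint elements -/

section CStar

variable {𝔸 : Type*} [NormedRing 𝔸] [NormedAlgebra ℂ 𝔸] [CompleteSpace 𝔸] [StarRing 𝔸]
  [CStarRing 𝔸]

theorem norm_le_one_of_star_mul_self {V : 𝔸} (hV : star V * V = 1) : ‖V‖ ≤ 1 := by
  nontriviality 𝔸
  have h := CStarRing.norm_star_mul_self (x := V)
  rw [hV, CStarRing.norm_one] at h
  nlinarith [norm_nonneg V]

theorem star_exp_mul_exp {A : 𝔸} (hA : star A = -A) :
    star (NormedSpace.exp A) * NormedSpace.exp A = 1 := by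
  let _ : NormedAlgebra ℚ 𝔸 := NormedAlgebra.restrictScalars ℚ ℂ 𝔸
  exact Unitary.star_mul_self_of_mem
    (NormedSpace.exp_mem_unitary_of_mem_skewAdjoint (skewAdjoint.mem_iff.2 hA))

theorem norm_exp_le_one {A : 𝔸} (hA : star A = -A) : ‖NormedSpace.exp A‖ ≤ 1 :=
  norm_le_one_of_star_mul_self (star_exp_mul_exp hA)

/-- Duhamel's argument: `exp (sA) * exp ((1 - s)B)` joins the two exponentials, and its derivative
is `A - B` between two factors of norm at most `1`. Skew-adjointness removes the exponential growth
from the usual bound. -/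
theorem norm_exp_sub_exp_le [StarModule ℂ 𝔸] {A B : 𝔸} (hA : star A = -A) (hB : star B = -B) :
    ‖NormedSpace.exp A - NormedSpace.exp B‖ ≤ ‖A - B‖ := by
  let _ : NormedAlgebra ℝ 𝔸 := NormedAlgebra.restrictScalars ℝ ℂ 𝔸
  have hstar : ∀ (s : ℝ) (X : 𝔸), star X = -X → star (s • X) = -(s • X) := by
    intro s X hX
    have : s • X = (s : ℂ) • X := (algebraMap_smul ℂ s X).symm
    rw [this, star_smul, hX, smul_neg]
    simp
  have hd : ∀ s ∈ Set.Icc (0 : ℝ) 1, HasDerivWithinAt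
      (fun s : ℝ => NormedSpace.exp (s • A) * NormedSpace.exp ((1 - s) • B))
      (NormedSpace.exp (s • A) * (A - B) * NormedSpace.exp ((1 - s) • B))
      (Set.Icc (0 : ℝ) 1) s := by
    intro s _
    have h₁ := hasDerivAt_exp_smul_const (𝕂 := ℝ) A s
    have h₂ := (hasDerivAt_exp_smul_const' (𝕂 := ℝ) B (1 - s)).scomp s
      ((hasDerivAt_id s).const_sub 1)
    have h₃ := h₁.mul h₂
    refine (h₃.congr_deriv ?_).hasDerivWithinAt
    simp only [Function.comp, neg_smul, one_smul, mul_neg, mul_sub, sub_mul, mul_assoc]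
    abel
  have := norm_image_sub_le_of_norm_deriv_le_segment_01' hd (C := ‖A - B‖) fun s _ => by
    have h₁ := norm_exp_le_one (hstar s A hA)
    have h₂ := norm_exp_le_one (hstar (1 - s) B hB)
    calc _ ≤ ‖NormedSpace.exp (s • A)‖ * ‖A - B‖ * ‖NormedSpace.exp ((1 - s) • B)‖ :=
          (norm_mul_le _ _).trans (by gcongr; exact norm_mul_le _ _)
      _ ≤ 1 * ‖A - B‖ * 1 := by gcongr
      _ = _ := by ring
  simpa [NormedSpace.exp_zero] using this

/-- The Taylor polynomial of the exponential function. -/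
def taylor {𝔸 : Type*} [Ring 𝔸] [Module ℂ 𝔸] (K : ℕ) (X : 𝔸) : 𝔸 :=
  ∑ k ∈ Finset.range (K + 1), ((k.factorial : ℂ))⁻¹ • X ^ k

/-- The remainder is dominated by that of the scalar series at `‖X‖`, for which `Real.exp_bound` is
available. -/
theorem norm_exp_sub_taylor_le {X : 𝔸} (hX : ‖X‖ ≤ 1) (K : ℕ) :
    ‖NormedSpace.exp X - taylor K X‖ ≤ 2 / K.factorial := by
  have h := NormedSpace.exp_series_hasSum_exp' (𝕂 := ℂ) X
  have hr := NormedSpace.exp_series_hasSum_exp' (𝕂 := ℝ) (‖X‖ : ℝ)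
  rw [← Real.exp_eq_exp_ℝ] at hr
  have h₁ := (hasSum_nat_add_iff' (K + 1)).2 h
  have h₂ := (hasSum_nat_add_iff' (K + 1)).2 hr
  have hle : ‖NormedSpace.exp X - taylor K X‖ ≤
      Real.exp ‖X‖ - ∑ k ∈ Finset.range (K + 1), ((k.factorial : ℝ))⁻¹ • ‖X‖ ^ k := by
    rw [taylor, ← h₁.tsum_eq]
    refine tsum_of_norm_bounded h₂ fun k => ?_
    rw [norm_smul, norm_inv, Complex.norm_natCast, smul_eq_mul]
    gcongr
    exact norm_pow_le' _ (by omega)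
  refine hle.trans ?_
  have hb := Real.exp_bound (x := ‖X‖) (by rwa [abs_norm]) (n := K + 1) (by omega)
  refine (le_trans (le_of_eq ?_) ((le_abs_self _).trans hb)).trans ?_
  · congr 1
    refine Finset.sum_congr rfl fun k _ => ?_
    rw [smul_eq_mul, div_eq_inv_mul]
  · have hp : |‖X‖| ^ (K + 1) ≤ 1 := pow_le_one₀ (abs_nonneg _) (by rwa [abs_norm])
    have hf : (0 : ℝ) < K.factorial := by exact_mod_cast K.factorial_pos
    refine (mul_le_of_le_one_left (by positivity) hp).trans ?_
    rw [Nat.factorial_succ]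
    push_cast
    rw [div_le_div_iff₀ (by positivity) hf]
    have hK : (0 : ℝ) ≤ K := Nat.cast_nonneg K
    have : ((K : ℝ) + 1 + 1) ≤ 2 * ((K + 1) * (K + 1)) := by nlinarith
    nlinarith

/-- With `D = V - U` and `V*V = 1` one has `1 - U*U = V*D + D*V - D*D`, where the star in each
product belongs to the first factor. -/
theorem norm_one_sub_star_mul_self_le {U V : 𝔸} {η : ℝ} (hV : star V * V = 1)
    (h : ‖V - U‖ ≤ η) : ‖1 - star U * U‖ ≤ 2 * η + η ^ 2 := by
  have h₀ := norm_le_one_of_star_mul_self hV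
  have h₁ : ‖star V‖ ≤ 1 := by rwa [norm_star]
  have h₂ : ‖star (V - U)‖ ≤ η := by rwa [norm_star]
  have hη : 0 ≤ η := (norm_nonneg _).trans h
  have e : 1 - star U * U = star V * (V - U) + star (V - U) * V - star (V - U) * (V - U) := by
    rw [← hV, star_sub]; noncomm_ring
  rw [e]
  refine (norm_sub_le _ _).trans (le_trans (add_le_add ((norm_add_le _ _).trans
    (add_le_add (norm_mul_le _ _) (norm_mul_le _ _))) (norm_mul_le _ _)) ?_)
  have a₁ : ‖star V‖ * ‖V - U‖ ≤ 1 * η := by gcongr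
  have a₂ : ‖star (V - U)‖ * ‖V‖ ≤ η * 1 := by gcongr
  have a₃ : ‖star (V - U)‖ * ‖V - U‖ ≤ η * η := by gcongr
  nlinarith

end CStar

/-! ### Norms of matrices -/

open scoped Matrix.Norms.L2Operator

variable {S T : Type} [Fintype S] [DecidableEq S] [Fintype T] [DecidableEq T]

theorem norm_toLp_mulVec_le (A : Matrix S T ℂ) (x : T → ℂ) :
    ‖WithLp.toLp 2 (A *ᵥ x)‖ ≤ ‖A‖ * ‖WithLp.toLp 2 x‖ :=
  Matrix.l2_opNorm_mulVec A (WithLp.toLp 2 x)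

theorem l2_opNorm_le_of_mulVec {A : Matrix S T ℂ} {C : ℝ} (hC : 0 ≤ C)
    (h : ∀ x : T → ℂ, ‖WithLp.toLp 2 (A *ᵥ x)‖ ≤ C * ‖WithLp.toLp 2 x‖) : ‖A‖ ≤ C := by
  rw [Matrix.l2_opNorm_def]
  exact ContinuousLinearMap.opNorm_le_bound _ hC fun x => h x.ofLp

/-- The Schur test for sparse matrices. -/
theorem l2_opNorm_le_of_sparse {A : Matrix T T ℂ} {d : ℕ} {B : ℝ} (hB : 0 ≤ B)
    (hrow : ∀ u, {v | A u v ≠ 0}.ncard ≤ d) (hcol : ∀ v, {u | A u v ≠ 0}.ncard ≤ d)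
    (h : ∀ u v, ‖A u v‖ ≤ B) : ‖A‖ ≤ d * B := by
  classical
  refine l2_opNorm_le_of_mulVec (by positivity) fun x => ?_
  refine (sq_le_sq₀ (norm_nonneg _) (by positivity)).1 ?_
  rw [mul_pow, EuclideanSpace.norm_sq_eq, EuclideanSpace.norm_sq_eq]
  have hcard : ∀ (P : T → Prop) [DecidablePred P], {v | P v}.ncard ≤ d →
      (Finset.univ.filter P).card ≤ d := by
    intro P _ hP
    rw [← Set.ncard_coe_finset]
    simpa using hP
  -- Cauchy–Schwarz over the at most `d` nonzero entries of the row. The second factor `d` comes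
  -- from the columns after the sums are exchanged.
  have h₁ : ∀ u, ‖(A *ᵥ x) u‖ ^ 2 ≤ d * B ^ 2 * ∑ v, if A u v ≠ 0 then ‖x v‖ ^ 2 else 0 := by
    intro u
    have hs : (A *ᵥ x) u = ∑ v ∈ Finset.univ.filter (fun v => A u v ≠ 0), A u v * x v := by
      rw [Matrix.mulVec, dotProduct, Finset.sum_filter]
      refine Finset.sum_congr rfl fun v _ => ?_
      split_ifs with h
      · rfl
      · rw [not_not.1 h, zero_mul]
    calc ‖(A *ᵥ x) u‖ ^ 2
        ≤ (∑ v ∈ Finset.univ.filter (fun v => A u v ≠ 0), ‖A u v * x v‖) ^ 2 := by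
          rw [hs]; gcongr; exact norm_sum_le _ _
      _ ≤ (Finset.univ.filter (fun v => A u v ≠ 0)).card *
          ∑ v ∈ Finset.univ.filter (fun v => A u v ≠ 0), ‖A u v * x v‖ ^ 2 :=
          sq_sum_le_card_mul_sum_sq
      _ ≤ d * ∑ v ∈ Finset.univ.filter (fun v => A u v ≠ 0), B ^ 2 * ‖x v‖ ^ 2 := by
          gcongr with v _
          · exact hcard _ (hrow u)
          · rw [norm_mul, mul_pow]
            gcongr
            exact h u v
      _ = _ := by
          rw [← Finset.mul_sum, Finset.sum_filter]; ring
  calc ∑ u, ‖(A *ᵥ x) u‖ ^ 2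
      ≤ ∑ u, d * B ^ 2 * ∑ v, if A u v ≠ 0 then ‖x v‖ ^ 2 else 0 :=
        Finset.sum_le_sum fun u _ => h₁ u
    _ = d * B ^ 2 * ∑ v, ∑ u, if A u v ≠ 0 then ‖x v‖ ^ 2 else 0 := by
        rw [← Finset.mul_sum, Finset.sum_comm]
    _ ≤ d * B ^ 2 * ∑ v, d * ‖x v‖ ^ 2 := by
        gcongr with v _
        rw [← Finset.sum_filter, Finset.sum_const, nsmul_eq_mul]
        gcongr
        exact hcard _ (hcol v)
    _ = _ := by
        rw [← Finset.mul_sum]; ring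

theorem l2_opNorm_le_one_of_isometry {A : Matrix S T ℂ} (h : Aᴴ * A = 1) : ‖A‖ ≤ 1 := by
  have h₁ := Matrix.l2_opNorm_conjTranspose_mul_self A
  have h₂ : ‖(1 : Matrix T T ℂ)‖ ≤ 1 := norm_le_one_of_star_mul_self (by simp)
  rw [h] at h₁
  nlinarith [norm_nonneg A]

/-- The error of one segment. -/
theorem segment_error {A Q : Matrix S S ℂ} {E : Matrix S T ℂ} {U V : Matrix T T ℂ} {η : ℝ}
    (hA : Aᴴ * A = 1) (hE : Eᴴ * E = 1) (hQ : Q * E = E * U + A * E * (1 - Uᴴ * U))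
    (hV : Vᴴ * V = 1) (h : ‖V - U‖ ≤ η) : ‖Q * E - E * V‖ ≤ 3 * η + η ^ 2 := by
  have e : Q * E - E * V = A * E * (1 - Uᴴ * U) - E * (V - U) := by
    rw [hQ, Matrix.mul_sub E]; abel
  have h₁ : ‖A * E‖ ≤ 1 := l2_opNorm_le_one_of_isometry (by
    rw [Matrix.conjTranspose_mul, Matrix.mul_assoc, ← Matrix.mul_assoc Aᴴ, hA, Matrix.one_mul, hE])
  have h₂ : ‖E‖ ≤ 1 := l2_opNorm_le_one_of_isometry hE
  have h₃ : ‖1 - Uᴴ * U‖ ≤ 2 * η + η ^ 2 := norm_one_sub_star_mul_self_le hV h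
  rw [e]
  calc _ ≤ ‖A * E‖ * ‖1 - Uᴴ * U‖ + ‖E‖ * ‖V - U‖ :=
        (norm_sub_le _ _).trans (add_le_add (Matrix.l2_opNorm_mul _ _) (Matrix.l2_opNorm_mul _ _))
    _ ≤ 1 * (2 * η + η ^ 2) + 1 * η := by gcongr
    _ = _ := by ring

/-- The error of repeated segments. -/
theorem iterate_error {Q : Matrix S S ℂ} {E : Matrix S T ℂ} {V : Matrix T T ℂ} {δ : ℝ}
    (hQ : Qᴴ * Q = 1) (hV : Vᴴ * V = 1) (h : ‖Q * E - E * V‖ ≤ δ) (r : ℕ) :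
    ‖Q ^ r * E - E * V ^ r‖ ≤ r * δ := by
  have h₁ : ∀ r : ℕ, (Q ^ r)ᴴ * Q ^ r = 1 := by
    intro r
    induction r with
    | zero => simp
    | succ r ih =>
      rw [pow_succ, Matrix.conjTranspose_mul, Matrix.mul_assoc, ← Matrix.mul_assoc (Q ^ r)ᴴ, ih,
        Matrix.one_mul, hQ]
  induction r with
  | zero => simp
  | succ r ih =>
    -- Telescoping: the new error is carried by the isometry `Q ^ r` and the old one by `V`, so
    -- neither is amplified.
    have e : Q ^ (r + 1) * E - E * V ^ (r + 1) =
        Q ^ r * (Q * E - E * V) + (Q ^ r * E - E * V ^ r) * V := by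
      rw [pow_succ, pow_succ, Matrix.mul_sub, Matrix.sub_mul]
      simp only [Matrix.mul_assoc]
      abel
    rw [e]
    have hδ : 0 ≤ δ := (norm_nonneg _).trans h
    calc _ ≤ ‖Q ^ r‖ * ‖Q * E - E * V‖ + ‖Q ^ r * E - E * V ^ r‖ * ‖V‖ :=
          (norm_add_le _ _).trans
            (add_le_add (Matrix.l2_opNorm_mul _ _) (Matrix.l2_opNorm_mul _ _))
      _ ≤ 1 * δ + (r * δ) * 1 := by
          gcongr
          · exact l2_opNorm_le_one_of_isometry (h₁ r)
          · exact l2_opNorm_le_one_of_isometry hV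
      _ = _ := by push_cast; ring

/-! ### Evolution operators -/

variable {N : ℕ}

theorem star_evolution_generator {H : Matrix (Fin N) (Fin N) ℂ} (hH : H.IsHermitian) (t : ℝ) :
    star ((-(Complex.I * (t : ℂ))) • H) = -((-(Complex.I * (t : ℂ))) • H) := by
  rw [star_smul, Matrix.star_eq_conjTranspose, hH.eq, ← neg_smul]
  simp

theorem evolution_isometry {H : Matrix (Fin N) (Fin N) ℂ} (hH : H.IsHermitian) (t : ℝ) :
    (evolution H t)ᴴ * evolution H t = 1 :=
  star_exp_mul_exp (star_evolution_generator hH t)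

theorem norm_evolution_sub_le {H G : Matrix (Fin N) (Fin N) ℂ} (hH : H.IsHermitian)
    (hG : G.IsHermitian) {t : ℝ} (ht : 0 ≤ t) :
    ‖evolution H t - evolution G t‖ ≤ t * ‖H - G‖ := by
  refine (norm_exp_sub_exp_le (star_evolution_generator hH t)
    (star_evolution_generator hG t)).trans (le_of_eq ?_)
  rw [← smul_sub, norm_smul]
  simp [abs_of_nonneg ht]

theorem evolution_pow (H : Matrix (Fin N) (Fin N) ℂ) (t : ℝ) (r : ℕ) :
    evolution H t ^ r = evolution H (r * t) := by
  rw [evolution, evolution, ← Matrix.exp_nsmul, ← Nat.cast_smul_eq_nsmul ℂ, smul_smul]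
  congr 2
  push_cast
  ring

theorem norm_evolution_sub_taylor_le {H : Matrix (Fin N) (Fin N) ℂ} {t : ℝ} (ht : 0 ≤ t)
    (h : t * ‖H‖ ≤ 1) (K : ℕ) :
    ‖evolution H t - taylor K ((-(Complex.I * (t : ℂ))) • H)‖ ≤ 2 / K.factorial := by
  refine norm_exp_sub_taylor_le ?_ K
  rw [norm_smul]
  simpa [abs_of_nonneg ht] using h

end HamSim

end

/-! ### Padded Taylor coefficients and the error of the simulation. -/

noncomputable section

namespace HamSim

open Matrix

set_option linter.unusedSectionVars false

/-! ### The weights of the Taylor series -/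

/-- The sum of the coefficients of the Taylor polynomial. -/
def taylorSum (x : ℝ) (K : ℕ) : ℝ := ∑ k ∈ Finset.range (K + 1), x ^ k / k.factorial

/-- The coefficients in the linear combination of powers; the last two are padded such that the
sum is `2`. -/
def lcuCoeff (x : ℝ) (K k : ℕ) : ℝ :=
  if k < K then x ^ k / k.factorial
  else if k = K then x ^ K / K.factorial + (2 - taylorSum x K) / 2
  else (2 - taylorSum x K) / 2

/-- The amplitudes of the thermometer states. -/
def lcuWeight (x : ℝ) (K k : ℕ) : ℝ := Real.sqrt (lcuCoeff x K k / 2)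

/-- The sum is at most `exp (1/2)`, whose square `e` is less than `4`. The gap below `2` makes the
padding terms positive. -/
theorem taylorSum_lt_two {x : ℝ} (hx : 0 < x) (hx' : x ≤ 1 / 2) (K : ℕ) : taylorSum x K < 2 := by
  refine (Real.sum_le_exp_of_nonneg hx.le (K + 1)).trans_lt ?_
  refine (Real.exp_le_exp.2 hx').trans_lt ?_
  have h : Real.exp (1 / 2) ^ 2 = Real.exp 1 := by
    rw [← Real.exp_nat_mul]; norm_num
  have h' := Real.exp_one_lt_d9
  nlinarith [Real.exp_pos (1 / 2)]

theorem lcuCoeff_pos {x : ℝ} (hx : 0 < x) (hx' : x ≤ 1 / 2) (K k : ℕ) : 0 < lcuCoeff x K k := by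
  have h := taylorSum_lt_two hx hx' K
  have h' : 0 < (2 - taylorSum x K) / 2 := by linarith
  unfold lcuCoeff
  split_ifs <;> positivity

theorem lcuWeight_pos {x : ℝ} (hx : 0 < x) (hx' : x ≤ 1 / 2) (K k : ℕ) : 0 < lcuWeight x K k :=
  Real.sqrt_pos.2 (half_pos (lcuCoeff_pos hx hx' K k))

theorem lcuWeight_sq {x : ℝ} (hx : 0 < x) (hx' : x ≤ 1 / 2) (K k : ℕ) :
    lcuWeight x K k ^ 2 = lcuCoeff x K k / 2 :=
  Real.sq_sqrt (half_pos (lcuCoeff_pos hx hx' K k)).le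

theorem sum_lcuWeight_sq {x : ℝ} (hx : 0 < x) (hx' : x ≤ 1 / 2) (K : ℕ) :
    ∑ k : Fin (K + 2), lcuWeight x K k ^ 2 = 1 := by
  rw [← Finset.sum_range fun k => lcuWeight x K k ^ 2]
  simp only [lcuWeight_sq hx hx']
  rw [Finset.sum_range_succ, Finset.sum_range_succ]
  have h : ∑ k ∈ Finset.range K, lcuCoeff x K k / 2 =
      (∑ k ∈ Finset.range K, x ^ k / k.factorial) / 2 := by
    rw [Finset.sum_div]
    refine Finset.sum_congr rfl fun k hk => ?_
    rw [lcuCoeff, if_pos (Finset.mem_range.1 hk)]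
  have h' : taylorSum x K = ∑ k ∈ Finset.range K, x ^ k / k.factorial + x ^ K / K.factorial :=
    Finset.sum_range_succ _ _
  rw [h, lcuCoeff, if_neg (lt_irrefl K), if_pos rfl, lcuCoeff, if_neg (by omega),
    if_neg (by omega), h']
  ring

/-- The padding `(2 - taylorSum x K) / 2` occurs twice with the same power `X ^ K` and with opposite
signs, so it contributes to the normalization but not to the operator. -/
theorem sum_lcuWeight_taylor {T : Type} [Fintype T] [DecidableEq T] {x : ℝ} (hx : 0 < x)
    (hx' : x ≤ 1 / 2) (K : ℕ) (X : Matrix T T ℂ) (v u : T) :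
    ∑ k : Fin (K + 2), (lcuWeight x K k : ℂ) ^ 2 * (sgn (decide (k = Fin.last (K + 1))) *
        (X ^ (min k.1 K)) v u) = 2⁻¹ * taylor K ((x : ℂ) • X) v u := by
  have hsq : ∀ k : ℕ, (lcuWeight x K k : ℂ) ^ 2 = ((lcuCoeff x K k / 2 : ℝ) : ℂ) := by
    intro k
    rw [← Complex.ofReal_pow, lcuWeight_sq hx hx']
  rw [Fin.sum_univ_castSucc, Fin.sum_univ_castSucc]
  have h₁ : ∀ k : Fin K, (lcuWeight x K k.castSucc.castSucc : ℂ) ^ 2 *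
      (sgn (decide (k.castSucc.castSucc = Fin.last (K + 1))) *
        (X ^ (min k.castSucc.castSucc.1 K)) v u) =
      2⁻¹ * (((x : ℂ) ^ k.1 / k.1.factorial) * (X ^ k.1) v u) := by
    intro k
    have hne : k.castSucc.castSucc ≠ Fin.last (K + 1) := Fin.castSucc_ne_last _
    rw [hsq, Fin.val_castSucc, Fin.val_castSucc, lcuCoeff, if_pos k.2, min_eq_left k.2.le,
      decide_eq_false hne]
    rw [show sgn false = 1 from rfl]
    push_cast
    ring
  rw [Finset.sum_congr rfl fun k _ => h₁ k]
  have hne : (Fin.last K).castSucc ≠ Fin.last (K + 1) := Fin.castSucc_ne_last _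
  rw [hsq, hsq, Fin.val_castSucc, Fin.val_last, Fin.val_last, decide_eq_false hne, min_self,
    min_eq_right (Nat.le_succ K), lcuCoeff, if_neg (lt_irrefl K), if_pos rfl, lcuCoeff,
    if_neg (by omega), if_neg (by omega), decide_eq_true rfl, taylor, Matrix.sum_apply,
    Finset.sum_range_succ, Finset.sum_range fun k => ((((k.factorial : ℂ))⁻¹ • ((x : ℂ) • X) ^ k) v u)]
  have h₂ : ∀ k : ℕ, ((((k.factorial : ℂ))⁻¹ • ((x : ℂ) • X) ^ k) v u) =
      (x : ℂ) ^ k / k.factorial * (X ^ k) v u := by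
    intro k
    rw [smul_pow, Matrix.smul_apply, Matrix.smul_apply, smul_eq_mul, smul_eq_mul]
    ring
  simp only [h₂, ← Finset.mul_sum]
  rw [show sgn false = 1 from rfl, show sgn true = -1 from rfl]
  push_cast
  ring

/-! ### The error of the circuit -/

/-- Numbers and their bits. -/
def bitsEquiv (n : ℕ) : (Fin n → Bool) ≃ Fin (2 ^ n) :=
  Equiv.ofBijective Fin.ofBits <| by
    rw [Fintype.bijective_iff_injective_and_card]
    refine ⟨fun u v h => ?_, by simp⟩
    funext k
    have := congrArg (fun x : Fin (2 ^ n) => x.1.testBit k) h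
    simpa [Nat.testBit_ofBits_lt _ _ k.2] using this

theorem submatrix_pow_equiv {S T : Type} [Fintype S] [DecidableEq S] [Fintype T] [DecidableEq T]
    (e : S ≃ T) (X : Matrix T T ℂ) (k : ℕ) : (X.submatrix e e) ^ k = (X ^ k).submatrix e e := by
  induction k with
  | zero => simp
  | succ k ih => rw [pow_succ, pow_succ, ih, Matrix.submatrix_mul_equiv]

theorem submatrix_taylor {S T : Type} [Fintype S] [DecidableEq S] [Fintype T] [DecidableEq T]
    (e : S ≃ T) (X : Matrix T T ℂ) (K : ℕ) :
    taylor K (X.submatrix e e) = (taylor K X).submatrix e e := by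
  ext u v
  simp only [taylor, Matrix.sum_apply, submatrix_pow_equiv, Matrix.submatrix_apply,
    Matrix.smul_apply]

theorem submatrix_segment {S T R : Type} [Fintype S] [DecidableEq S] [Fintype T] [DecidableEq T]
    [Fintype R] [DecidableEq R] (e : T ≃ R) (A : Matrix S S ℂ) (E : Matrix S T ℂ)
    (Y : Matrix R R ℂ) :
    (E * Y.submatrix e e + A * E * (1 - (Y.submatrix e e)ᴴ * Y.submatrix e e)).submatrix id e.symm =
      E.submatrix id e.symm * Y + A * E.submatrix id e.symm * (1 - Yᴴ * Y) := by
  have h : ∀ (B : Matrix S T ℂ) (Z : Matrix R R ℂ),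
      (B * Z.submatrix e e).submatrix id e.symm = B.submatrix id e.symm * Z := by
    intro B Z
    rw [← Matrix.submatrix_mul_equiv _ _ id e.symm e.symm]
    simp
  have h' : 1 - (Y.submatrix e e)ᴴ * Y.submatrix e e = (1 - Yᴴ * Y).submatrix e e := by
    rw [Matrix.conjTranspose_submatrix, Matrix.submatrix_mul_equiv, Matrix.submatrix_sub,
      Pi.sub_apply, Pi.sub_apply, Matrix.submatrix_one_equiv]
  rw [h', ← h, show A * E.submatrix id e.symm = (A * E).submatrix id e.symm from rfl, ← h]
  rfl

open scoped Matrix.Norms.L2Operator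

variable {n c w m K : ℕ} {p k₀ b : ℕ}

/-- The isometry that adds ancillas in the state `0`, for numbered basis states. -/
def embedNum (n c w m M K L : ℕ) : Matrix (Lab n c w m M K L → Bool) (Fin (2 ^ n)) ℂ :=
  (embed n c w m M K L).submatrix id (bitsEquiv n).symm

theorem embedNum_isometry {M L : ℕ} :
    (embedNum n c w m M K L)ᴴ * embedNum n c w m M K L = 1 := by
  have := congrArg (fun A => A.submatrix (bitsEquiv n).symm (bitsEquiv n).symm)
    (embed_conjTranspose_mul_embed (n := n) (c := c) (w := w) (m := m) (M := M) (K := K) (L := L))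
  rwa [Matrix.submatrix_one_equiv] at this

theorem blockScale_pos (hb : 0 < b) : 0 < blockScale p k₀ b m := by
  have := two_pow_sub_one_pos hb
  unfold blockScale
  positivity

theorem ncard_col_le {N D : ℕ} {H : Matrix (Fin N) (Fin N) ℂ} (hH : H.IsHermitian)
    (hD : ∀ u, {v | H u v ≠ 0}.ncard ≤ D) (v : Fin N) : {u | H u v ≠ 0}.ncard ≤ D := by
  have h : ∀ u, H u v ≠ 0 ↔ H v u ≠ 0 := fun u => by
    rw [← hH.apply u v]
    simp
  simp only [h]
  exact hD v

theorem ncard_le_of_imp {N D : ℕ} {P Q : Fin N → Prop} (h : ∀ v, P v → Q v)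
    (hQ : {v | Q v}.ncard ≤ D) : {v | P v}.ncard ≤ D :=
  (Set.ncard_le_ncard (fun v hv => h v hv) (Set.toFinite _)).trans hQ

/-- The Schur test gives a bound with `2 ^ m`; the weaker one with `4 ^ m` is enough, since it is
needed only for the argument of the Taylor polynomial to have norm at most `1`. -/
theorem norm_rounded_le (hb : 0 < b) {H : Matrix (Fin (2 ^ n)) (Fin (2 ^ n)) ℂ}
    (hH : H.IsHermitian) (hD : ∀ u, {v | H u v ≠ 0}.ncard ≤ 2 ^ m) :
    ‖rounded p k₀ b H‖ ≤ blockScale p k₀ b m := by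
  have hpos := two_pow_sub_one_pos hb
  have himp : ∀ u v, rounded p k₀ b H u v ≠ 0 → H u v ≠ 0 := by
    intro u v h h'
    apply h
    rw [rounded, Matrix.of_apply, h', keep_zero]
  have h := l2_opNorm_le_of_sparse (A := rounded p k₀ b H) (d := 2 ^ m)
    (B := 2 * (2 ^ k₀ / 2 ^ p * (2 ^ b - 1))) (by positivity)
    (fun u => ncard_le_of_imp (himp u) (hD u))
    (fun v => ncard_le_of_imp (fun u => himp u v) (ncard_col_le hH hD v))
    (fun u v => norm_keep_le p k₀ b (H u v))
  refine h.trans ?_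
  have h₂ : (2 : ℝ) ^ m ≤ 4 ^ m := by gcongr; norm_num
  rw [blockScale]
  push_cast
  calc (2 : ℝ) ^ m * (2 * (2 ^ k₀ / 2 ^ p * (2 ^ b - 1)))
      ≤ 4 ^ m * (2 * (2 ^ k₀ / 2 ^ p * (2 ^ b - 1))) := by gcongr
    _ = _ := by ring

theorem segmentCircuit_error [NeZero n] [NeZero (8 * b)] (hm : m ≤ c) (hb : 0 < b)
    (hw : k₀ + b ≤ w) {H : Matrix (Fin (2 ^ n)) (Fin (2 ^ n)) ℂ} (hH : H.IsHermitian)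
    (hD : ∀ u, {v | H u v ≠ 0}.ncard ≤ 2 ^ m) {h : ℝ} (hh : 0 < h)
    (hx : blockScale p k₀ b m * h ≤ 1 / 2) (K : ℕ) :
    ‖Circuit.matrix p H (segmentCircuit (slotWeight b) (lcuWeight (blockScale p k₀ b m * h) K)
        (firstPhases hw) (secondPhases hw) m K) *
        embedNum n c w m (8 * b) K (workCount n m (8 * b) K + 1) -
      embedNum n c w m (8 * b) K (workCount n m (8 * b) K + 1) *
        evolution (rounded p k₀ b H) h‖ ≤ 3 * (2 / K.factorial) + (2 / K.factorial) ^ 2 := by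
  have hα := blockScale_pos (p := p) (k₀ := k₀) (m := m) hb
  have hx₀ : 0 < blockScale p k₀ b m * h := mul_pos hα hh
  have hα' : ((blockScale p k₀ b m : ℝ) : ℂ) ≠ 0 := by exact_mod_cast hα.ne'
  set X : Matrix (Fin (2 ^ n)) (Fin (2 ^ n)) ℂ :=
    (-(Complex.I * (h : ℂ))) • rounded p k₀ b H with hX
  have hamp : ((blockScale p k₀ b m * h : ℝ) : ℂ) • Matrix.of (blockAmp (c := c) p H (slotWeight b)
      (firstPhases hw) (secondPhases hw) m) = X.submatrix (bitsEquiv n) (bitsEquiv n) := by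
    ext v u
    rw [Matrix.smul_apply, Matrix.of_apply, blockAmp_eq hm hb hw hH hD, Matrix.submatrix_apply, hX,
      Matrix.smul_apply, smul_eq_mul, smul_eq_mul, bitsEquiv, Equiv.ofBijective_apply,
      Equiv.ofBijective_apply]
    push_cast
    field_simp
  have hU := segmentCircuit_mul_embed (m := m) (K := K) (c := c) p H (slotWeight b)
    (lcuWeight (blockScale p k₀ b m * h) K) (firstPhases hw) (secondPhases hw)
    (U := (taylor K X).submatrix (bitsEquiv n) (bitsEquiv n)) fun v u => by
      rw [lcuCircuit_apply p H (slotWeight_pos hb) (sum_slotWeight_sq hb) (lcuWeight_pos hx₀ hx K)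
        (sum_lcuWeight_sq hx₀ hx K), sum_lcuWeight_taylor hx₀ hx, hamp, submatrix_taylor]
  have hQ := congrArg (fun A => A.submatrix id (bitsEquiv n).symm) hU
  refine segment_error
    (A := Circuit.matrix p H (lcuCircuit (slotWeight b) (lcuWeight (blockScale p k₀ b m * h) K)
        (firstPhases hw) (secondPhases hw))) (U := taylor K X)
    (Circuit.conjTranspose_mul_matrix p H _) embedNum_isometry ?_
    (evolution_isometry (rounded_isHermitian hH) h) ?_
  · exact hQ.trans (submatrix_segment _ _ _ _)
  · refine norm_evolution_sub_taylor_le hh.le ?_ K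
    have := norm_rounded_le (p := p) (k₀ := k₀) hb hH hD
    nlinarith

theorem error_trans {S T : Type} [Fintype S] [DecidableEq S] [Fintype T] [DecidableEq T]
    {Q : Matrix S S ℂ} {E : Matrix S T ℂ} {V V' : Matrix T T ℂ} {x y : ℝ}
    (h : ‖Q * E - E * V'‖ ≤ x) (hE : ‖E‖ ≤ 1) (h' : ‖V - V'‖ ≤ y) : ‖Q * E - E * V‖ ≤ x + y := by
  have e : Q * E - E * V = (Q * E - E * V') - E * (V - V') := by
    rw [Matrix.mul_sub]; abel
  rw [e]
  refine (norm_sub_le _ _).trans (add_le_add h ((Matrix.l2_opNorm_mul _ _).trans ?_))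
  calc _ ≤ 1 * y := by gcongr
    _ = _ := one_mul _

/-- The segments approximate the evolution under the rounded Hamiltonian, for which they are built;
passing back to `H` costs `t` times the rounding error. -/
theorem iterate_segmentCircuit_error [NeZero n] [NeZero (8 * b)] (hm : m ≤ c) (hb : 0 < b)
    (hw : k₀ + b ≤ w) {H : Matrix (Fin (2 ^ n)) (Fin (2 ^ n)) ℂ} (hH : H.IsHermitian)
    (hD : ∀ u, {v | H u v ≠ 0}.ncard ≤ 2 ^ m) {t : ℝ} (ht : 0 < t) {r : ℕ} (hr : 0 < r)
    (hx : blockScale p k₀ b m * (t / r) ≤ 1 / 2) (K : ℕ) :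
    ‖Circuit.matrix p H (Circuit.iterate r (segmentCircuit (slotWeight b)
        (lcuWeight (blockScale p k₀ b m * (t / r)) K) (firstPhases hw) (secondPhases hw) m K)) *
        embedNum n c w m (8 * b) K (workCount n m (8 * b) K + 1) -
      embedNum n c w m (8 * b) K (workCount n m (8 * b) K + 1) * evolution H t‖ ≤
        r * (3 * (2 / K.factorial) + (2 / K.factorial) ^ 2) + t * ‖H - rounded p k₀ b H‖ := by
  have hr' : (0 : ℝ) < r := by exact_mod_cast hr
  have h₁ := iterate_error
    (Circuit.conjTranspose_mul_matrix (ι := Lab n c w m (8 * b) K (workCount n m (8 * b) K + 1))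
      p H _)
    (evolution_isometry (rounded_isHermitian (p := p) (k₀ := k₀) (b := b) hH) (t / r))
    (segmentCircuit_error hm hb hw hH hD (div_pos ht hr') hx K) r
  rw [evolution_pow, mul_div_cancel₀ _ hr'.ne', ← Circuit.iterate_matrix] at h₁
  have h₂ := norm_evolution_sub_le hH (rounded_isHermitian (p := p) (k₀ := k₀) (b := b) hH) ht.le
  have h₃ : ‖embedNum n c w m (8 * b) K (workCount n m (8 * b) K + 1)‖ ≤ 1 :=
    l2_opNorm_le_one_of_isometry embedNum_isometry
  exact error_trans h₁ h₃ h₂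

end HamSim

end

/-! ### Numbering the qubits, and from operator norms to simulation. -/

noncomputable section

namespace HamSim

open Matrix

set_option linter.unusedSectionVars false

/-! ### Relabelling of qubits -/

section Relabel

variable {n c w : ℕ} {ι κ : Type}

/-- Relabelling of the qubits of an operation. -/
def Op.relabel (e : ι ≃ κ) : Op n c w ι → Op n c w κ
  | .gate a b hab U => .gate (e a) (e b) (e.injective.ne hab) U
  | .query f => .query (f.trans e.toEmbedding)

/-- Relabelling of the qubits of a circuit. -/
def Circuit.relabel (e : ι ≃ κ) (C : Circuit n c w ι) : Circuit n c w κ := C.map (Op.relabel e)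

theorem Circuit.relabel_queries (e : ι ≃ κ) (C : Circuit n c w ι) :
    (C.relabel e).queries = C.queries := by
  induction C with
  | nil => rfl
  | cons g C ih =>
    cases g
    · exact ih
    · exact congrArg (· + 1) ih

theorem Circuit.relabel_gates (e : ι ≃ κ) (C : Circuit n c w ι) :
    (C.relabel e).gates = C.gates := by
  induction C with
  | nil => rfl
  | cons g C ih =>
    cases g
    · exact congrArg (· + 1) ih
    · exact ih

/-- Basis states under relabelling. -/
def stateEquiv (e : ι ≃ κ) : (κ → Bool) ≃ (ι → Bool) where
  toFun x := x ∘ e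
  invFun x := x ∘ e.symm
  left_inv x := by funext q; simp
  right_inv x := by funext q; simp

variable (p : ℕ) (H : Matrix (Fin (2 ^ n)) (Fin (2 ^ n)) ℂ)

theorem Op.relabel_matrix (e : ι ≃ κ) (g : Op n c w ι) :
    (g.relabel e).matrix p H = (g.matrix p H).submatrix (stateEquiv e) (stateEquiv e) := by
  cases g with
  | gate a b hab U =>
    ext x y
    simp only [Op.relabel, Op.matrix, Matrix.submatrix_apply, gateMatrix, stateEquiv,
      Equiv.coe_fn_mk, Function.comp]
    have : (∀ q, q ≠ e a → q ≠ e b → x q = y q) ↔ ∀ q, q ≠ a → q ≠ b → x (e q) = y (e q) := by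
      rw [← e.forall_congr_right]
      simp
    by_cases h : ∀ q, q ≠ a → q ≠ b → x (e q) = y (e q)
    · rw [if_pos h, if_pos (this.2 h)]
    · rw [if_neg h, if_neg fun h' => h (this.1 h')]
  | query f =>
    ext y x
    simp only [Op.relabel, Op.matrix, Matrix.submatrix_apply, queryMatrix]
    have : stateEquiv e (queryMap p H (f.trans e.toEmbedding) x) =
        queryMap p H f (stateEquiv e x) := by
      funext q
      refine congrArg (xor (x (e q))) (decide_eq_decide.2 (exists_congr fun s => ?_))
      refine and_congr ?_ Iff.rfl
      exact e.apply_eq_iff_eq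
    rw [← this]
    by_cases h : y = queryMap p H (f.trans e.toEmbedding) x
    · rw [if_pos h, if_pos (congrArg _ h)]
    · rw [if_neg h, if_neg fun h' => h ((stateEquiv e).injective h')]

theorem Circuit.relabel_matrix [Fintype ι] [DecidableEq ι] [Fintype κ] [DecidableEq κ] (e : ι ≃ κ)
    (C : Circuit n c w ι) :
    (C.relabel e).matrix p H = (C.matrix p H).submatrix (stateEquiv e) (stateEquiv e) := by
  induction C with
  | nil => exact (Matrix.submatrix_one_equiv _).symm
  | cons g C ih =>
    rw [Circuit.relabel, List.map_cons, Circuit.matrix_cons, Circuit.matrix_cons,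
      ← Matrix.submatrix_mul_equiv _ _ _ (stateEquiv e), ← Op.relabel_matrix, ← ih]
    rfl

end Relabel

/-! ### Simulation -/

theorem norm_toLp_comp_equiv {S T : Type} [Fintype S] [Fintype T] (e : S ≃ T) (f : T → ℂ) :
    ‖WithLp.toLp 2 (f ∘ e)‖ = ‖WithLp.toLp 2 f‖ := by
  rw [EuclideanSpace.norm_eq, EuclideanSpace.norm_eq]
  congr 1
  exact Equiv.sum_comp e fun x => ‖f x‖ ^ 2

open scoped Matrix.Norms.L2Operator

variable {n c w m M K L : ℕ}

/-- The numbering of the ancillas. -/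
def labEquiv (n c w m M K L : ℕ) :
    Lab n c w m M K L ≃ Fin n ⊕ Fin (Fintype.card (Anc n c w m M K L)) :=
  Equiv.sumCongr (Equiv.refl _) (Fintype.equivFin _)

theorem embedNum_mulVec (ψ : Fin (2 ^ n) → ℂ) (x : Lab n c w m M K L → Bool) :
    (embedNum n c w m M K L *ᵥ ψ) x =
      if ∀ q, x (.inr q) = false then ψ (Fin.ofBits fun k => x (.inl k)) else 0 := by
  have hsum : (embedNum n c w m M K L *ᵥ ψ) x =
      ∑ u : Fin n → Bool, embed n c w m M K L x u * ψ (bitsEquiv n u) := by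
    rw [Matrix.mulVec, dotProduct, ← Equiv.sum_comp (bitsEquiv n)]
    simp [embedNum]
  rw [hsum]
  by_cases h : ∀ q, x (.inr q) = false
  · have hx : x = zeroExt fun k => x (.inl k) := by
      funext q
      rcases q with k | q
      · rfl
      · exact h q
    rw [if_pos h, Finset.sum_eq_single fun k => x (.inl k)]
    · rw [embed, Matrix.of_apply, if_pos hx, one_mul]
      rfl
    · intro u _ hu
      rw [embed, Matrix.of_apply, if_neg, zero_mul]
      rintro rfl
      exact hu rfl
    · simp
  · rw [if_neg h, Finset.sum_eq_zero]
    intro u _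
    rw [embed, Matrix.of_apply, if_neg, zero_mul]
    rintro rfl
    exact h fun q => rfl

theorem withAncillas_eq (ψ : Fin (2 ^ n) → ℂ) :
    withAncillas (Fintype.card (Anc n c w m M K L)) ψ =
      (embedNum n c w m M K L *ᵥ ψ) ∘ stateEquiv (labEquiv n c w m M K L) := by
  funext x
  rw [Function.comp_apply, embedNum_mulVec, withAncillas]
  have : (∀ k, x (.inr k) = false) ↔
      ∀ q, stateEquiv (labEquiv n c w m M K L) x (.inr q) = false :=
    (Fintype.equivFin _).forall_congr_right.symm
  by_cases h : ∀ k, x (.inr k) = false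
  · rw [if_pos h, if_pos (this.1 h)]
    rfl
  · rw [if_neg h, if_neg fun h' => h (this.2 h')]

/-- Relabelling permutes basis states and so preserves the `ℓ²` norm; the operator norm on the range
of the embedding then bounds the error for every input state. -/
theorem simulates_of_norm_le (p : ℕ) (H : Matrix (Fin (2 ^ n)) (Fin (2 ^ n)) ℂ)
    (C : Circuit n c w (Lab n c w m M K L)) {t ε : ℝ}
    (h : ‖C.matrix p H * embedNum n c w m M K L - embedNum n c w m M K L * evolution H t‖ ≤ ε) :
    Simulates p (C.relabel (labEquiv n c w m M K L)) H t ε := by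
  intro ψ
  have e : (C.relabel (labEquiv n c w m M K L)).matrix p H *ᵥ
        withAncillas (Fintype.card (Anc n c w m M K L)) ψ -
      withAncillas (Fintype.card (Anc n c w m M K L)) (evolution H t *ᵥ ψ) =
      ((C.matrix p H * embedNum n c w m M K L - embedNum n c w m M K L * evolution H t) *ᵥ ψ) ∘
        stateEquiv (labEquiv n c w m M K L) := by
    rw [withAncillas_eq, withAncillas_eq, Circuit.relabel_matrix, Matrix.submatrix_mulVec_equiv,
      Matrix.sub_mulVec, ← Matrix.mulVec_mulVec, ← Matrix.mulVec_mulVec]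
    funext x
    simp [Function.comp_def]
  rw [e, norm_toLp_comp_equiv]
  exact (norm_toLp_mulVec_le _ _).trans (by gcongr)

end HamSim

end

/-! ### Degree, precision and error budget. -/

noncomputable section

namespace HamSim

open Matrix

set_option linter.unusedSectionVars false

/-! ### The choice of parameters -/

/-- Take `K = ⌈16 L / log L⌉`. From `log (log L) ≤ (log L) / 2` follows `log K - 1 ≥ (log L) / 2`,
so `K! ≥ (K / e) ^ K` is at least `exp (8L) ≥ exp (L + 7)`, and `exp 7 ≥ 1056`. Rounding up costs at
most `1 ≤ L / log L`, whence `17`. -/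
theorem exists_order {L : ℝ} (hL : 1 < L) :
    ∃ K : ℕ, 1 ≤ K ∧ (K : ℝ) ≤ 17 * (L / Real.log L) ∧ 1056 * Real.exp L ≤ K.factorial := by
  have hl : 0 < Real.log L := Real.log_pos hL
  have hlL : Real.log L ≤ L := (Real.log_le_sub_one_of_pos (by linarith)).trans (by linarith)
  have hq : 1 ≤ L / Real.log L := (one_le_div hl).2 hlL
  set x := 16 * (L / Real.log L) with hx
  have hx0 : 0 < x := by positivity
  have hKx : x ≤ (⌈x⌉₊ : ℝ) := Nat.le_ceil x
  have hK0 : (0 : ℝ) < (⌈x⌉₊ : ℝ) := hx0.trans_le hKx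
  refine ⟨⌈x⌉₊, Nat.ceil_pos.2 hx0, ?_, ?_⟩
  · have := Nat.ceil_lt_add_one hx0.le
    linarith
  set K := ⌈x⌉₊
  have hfac : (0 : ℝ) < K.factorial := by exact_mod_cast K.factorial_pos
  have hlog2 := Real.log_two_gt_d9
  have hlog2' := Real.log_two_lt_d9
  have h16 : Real.log 16 = 4 * Real.log 2 := by
    rw [show (16 : ℝ) = 2 ^ 4 by norm_num, Real.log_pow]; norm_num
  have hll : Real.log (Real.log L) ≤ Real.log L / 2 := by
    have h := Real.log_le_sub_one_of_pos (half_pos hl)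
    rw [Real.log_div hl.ne' two_ne_zero] at h
    linarith
  have hlogK : Real.log L / 2 ≤ Real.log K - 1 := by
    have h₁ : Real.log x ≤ Real.log K := Real.log_le_log hx0 hKx
    rw [hx, Real.log_mul (by norm_num) (by positivity), Real.log_div (by linarith) hl.ne', h16]
      at h₁
    linarith
  have hexp : L + 7 ≤ K * (Real.log K - 1) := by
    have h₁ : x * (Real.log L / 2) ≤ K * (Real.log K - 1) := by gcongr
    have h₂ : x * (Real.log L / 2) = 8 * L := by
      rw [hx]; field_simp; norm_num
    linarith
  have hpow : Real.exp (K * (Real.log K - 1)) ≤ K.factorial := by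
    have h₁ := Real.pow_div_factorial_le_exp (K : ℝ) hK0.le K
    rw [div_le_iff₀ hfac] at h₁
    have h₂ : Real.exp (K * (Real.log K - 1)) = (K : ℝ) ^ K / Real.exp K := by
      rw [mul_sub, mul_one, Real.exp_sub, ← Real.log_pow, Real.exp_log (by positivity)]
    rw [h₂, div_le_iff₀ (Real.exp_pos _), mul_comm]
    exact h₁
  have h7 : (1056 : ℝ) ≤ Real.exp 7 := by
    have h₁ := Real.exp_one_gt_d9
    have h₂ : Real.exp 7 = Real.exp 1 ^ 7 := by
      rw [← Real.exp_nat_mul]; norm_num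
    rw [h₂]
    calc (1056 : ℝ) ≤ 2.7182 ^ 7 := by norm_num
      _ ≤ _ := by gcongr; linarith
  calc 1056 * Real.exp L ≤ Real.exp 7 * Real.exp L := by gcongr
    _ = Real.exp (L + 7) := by rw [← Real.exp_add, add_comm]
    _ ≤ _ := (Real.exp_le_exp.2 hexp).trans hpow

theorem exists_precision {L : ℝ} (hL : 1 < L) :
    ∃ b : ℕ, 0 < b ∧ (b : ℝ) ≤ 11 * L ∧ 16 * Real.exp L ≤ 2 ^ b := by
  have h0 : 0 < 10 * L := by linarith
  have hb : 10 * L ≤ (⌈10 * L⌉₊ : ℝ) := Nat.le_ceil _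
  refine ⟨⌈10 * L⌉₊, Nat.ceil_pos.2 h0, ?_, ?_⟩
  · have := Nat.ceil_lt_add_one h0.le
    linarith
  have hlog2 := Real.log_two_gt_d9
  have h16 : (16 : ℝ) = Real.exp (4 * Real.log 2) := by
    rw [mul_comm, Real.exp_mul, Real.exp_log two_pos]; norm_num
  have hlog2' := Real.log_two_lt_d9
  rw [h16, ← Real.exp_add, ← Real.rpow_natCast, Real.rpow_def_of_pos two_pos]
  refine Real.exp_le_exp.2 ?_
  nlinarith

theorem two_pow_clog_le {d : ℕ} (hd : 0 < d) : 2 ^ Nat.clog 2 d ≤ 2 * d := by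
  rcases Nat.lt_or_ge 1 d with h | h
  · have h₁ := Nat.pow_pred_clog_lt_self one_lt_two h
    have h₂ : 0 < Nat.clog 2 d := Nat.clog_pos one_lt_two h
    have h₃ : 2 ^ Nat.clog 2 d = 2 * 2 ^ (Nat.clog 2 d).pred := by
      rw [← pow_succ', Nat.pred_eq_sub_one, Nat.sub_add_cancel h₂]
    omega
  · have : d = 1 := by omega
    subst this
    simp

theorem two_pow_size_le {x : ℝ} (hx : 1 ≤ x) : (2 : ℝ) ^ Nat.size ⌊x⌋₊ ≤ 2 * x := by
  have h₀ : 0 < ⌊x⌋₊ := Nat.floor_pos.2 hx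
  have h₁ : 0 < Nat.size ⌊x⌋₊ := Nat.size_pos.2 h₀
  have h₂ : 2 ^ (Nat.size ⌊x⌋₊ - 1) ≤ ⌊x⌋₊ := Nat.lt_size.1 (by omega)
  have h₃ : ((2 : ℝ) ^ (Nat.size ⌊x⌋₊ - 1)) ≤ x :=
    le_trans (by exact_mod_cast h₂) (Nat.floor_le (by linarith))
  calc (2 : ℝ) ^ Nat.size ⌊x⌋₊ = 2 * 2 ^ (Nat.size ⌊x⌋₊ - 1) := by
        rw [← pow_succ', Nat.sub_add_cancel h₁]
    _ ≤ _ := by linarith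

theorem norm_le_maxNorm {N : ℕ} (H : Matrix (Fin N) (Fin N) ℂ) (u v : Fin N) :
    ‖H u v‖ ≤ maxNorm H :=
  le_ciSup (f := fun q : Fin N × Fin N => ‖H q.1 q.2‖) (Set.finite_range _).bddAbove (u, v)

theorem magnitude_le {p : ℕ} {x Λ : ℝ} (hx : |x| ≤ Λ) : magnitude p x ≤ ⌊2 ^ p * Λ⌋₊ :=
  Nat.floor_le_floor (by gcongr)

/-- A row has only `2 ^ n` entries, so `n` bits suffice as a counter even if `d` is larger. This
keeps the counters within the gate bound, which does not involve `log d`. -/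
theorem ncard_le_two_pow_min {n d : ℕ} {s : Set (Fin (2 ^ n))} (hs : s.ncard ≤ d) :
    s.ncard ≤ 2 ^ min (Nat.clog 2 d) n := by
  rcases le_total (Nat.clog 2 d) n with h | h
  · rw [min_eq_left h]
    exact hs.trans (Nat.le_pow_clog one_lt_two d)
  · rw [min_eq_right h]
    calc s.ncard ≤ (Set.univ : Set (Fin (2 ^ n))).ncard :=
          Set.ncard_le_ncard (Set.subset_univ s) (Set.toFinite _)
      _ = 2 ^ n := by simp

open scoped Matrix.Norms.L2Operator

theorem time_mul_norm_le_of_sparse {N d : ℕ} (hd : 0 < d) {t ε : ℝ} (ht : 0 < t)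
    {H A : Matrix (Fin N) (Fin N) ℂ} (hH : IsSparse d H) (h₀ : ∀ u v, H u v = 0 → A u v = 0)
    (h : ∀ u v, d * t * ‖A u v‖ ≤ ε) (hε : 0 ≤ ε) : t * ‖A‖ ≤ ε := by
  have hd' : (0 : ℝ) < d := by exact_mod_cast hd
  have h₁ := l2_opNorm_le_of_sparse (A := A) (d := d) (B := ε / (d * t)) (by positivity)
    (fun u => ncard_le_of_imp (fun v => mt (h₀ u v)) (hH.1 u))
    (fun v => ncard_le_of_imp (fun u => mt (h₀ u v)) (hH.2 v))
    (fun u v => by rw [le_div_iff₀ (by positivity), mul_comm]; exact h u v)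
  calc t * ‖A‖ ≤ t * (d * (ε / (d * t))) := by gcongr
    _ = ε := by field_simp

/-- Truncation by the black box accounts for `ε / 2` and the discarded low bits for `ε / 4`.
Rounding keeps zero entries zero, so the difference is as sparse as `H`. -/
theorem time_mul_norm_sub_rounded_le {n d p k₀ b : ℕ} (hd : 0 < d) {t ε : ℝ} (ht : 0 < t)
    (hε : 0 < ε) {H : Matrix (Fin (2 ^ n)) (Fin (2 ^ n)) ℂ} (hH : IsSparse d H)
    (htrunc : ∀ u v, d * t * ‖H u v - trunc p (H u v)‖ ≤ ε / 2)
    (hmag : ∀ u v, magnitude p (H u v).re < 2 ^ (k₀ + b) ∧ magnitude p (H u v).im < 2 ^ (k₀ + b))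
    (hk : d * t * (2 * ((2 ^ k₀ - 1) / 2 ^ p)) ≤ ε / 4) :
    t * ‖H - rounded p k₀ b H‖ ≤ 3 * ε / 4 := by
  refine time_mul_norm_le_of_sparse hd ht hH (fun u v h => ?_) (fun u v => ?_) (by positivity)
  · rw [Matrix.sub_apply, rounded, Matrix.of_apply, h, keep_zero, sub_zero]
  · have h₁ : ‖(H - rounded p k₀ b H) u v‖ ≤
        ‖H u v - trunc p (H u v)‖ + 2 * ((2 ^ k₀ - 1) / 2 ^ p) := by
      have e : (H - rounded p k₀ b H) u v =
          (H u v - trunc p (H u v)) + (trunc p (H u v) - keep p k₀ b (H u v)) := by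
        rw [Matrix.sub_apply, rounded, Matrix.of_apply]; ring
      rw [e]
      exact (norm_add_le _ _).trans
        (add_le_add_right (norm_trunc_sub_keep_le p k₀ b (hmag u v).1 (hmag u v).2) _)
    calc (d : ℝ) * t * ‖(H - rounded p k₀ b H) u v‖
        ≤ d * t * (‖H u v - trunc p (H u v)‖ + 2 * ((2 ^ k₀ - 1) / 2 ^ p)) := by gcongr
      _ ≤ ε / 2 + ε / 4 := by rw [mul_add]; exact add_le_add (htrunc u v) hk
      _ = _ := by ring

/-- Both roundings up to powers of two lose at most a factor `2`: `2 ^ m ≤ 2d`, which enters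
squared, and `2 ^ (k₀ + b) ≤ 2 (2 ^ p Λ)`. With the factor `2` for real and imaginary parts this
gives `16`. -/
theorem blockScale_le {d p k₀ b m : ℕ} (hd : 0 < d) (hm : m ≤ Nat.clog 2 d) {Λ : ℝ}
    (hΛ : (2 : ℝ) ^ (k₀ + b) ≤ 2 * (2 ^ p * Λ)) :
    blockScale p k₀ b m ≤ 16 * ((d : ℝ) ^ 2 * Λ) := by
  have h₁ : (4 : ℝ) ^ m ≤ (2 * d) ^ 2 := by
    have h : 2 ^ m ≤ 2 * d := (Nat.pow_le_pow_right two_pos hm).trans (two_pow_clog_le hd)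
    have h' : (2 : ℝ) ^ m ≤ 2 * d := by exact_mod_cast h
    calc (4 : ℝ) ^ m = (2 ^ m) ^ 2 := by rw [← pow_mul, mul_comm, pow_mul]; norm_num
      _ ≤ _ := by gcongr
  have h₂ : ((2 : ℝ) ^ b - 1) * (2 ^ k₀ / 2 ^ p) ≤ 2 * Λ := by
    rw [mul_div_assoc', div_le_iff₀ (by positivity)]
    calc ((2 : ℝ) ^ b - 1) * 2 ^ k₀ ≤ 2 ^ b * 2 ^ k₀ := by gcongr; linarith
      _ = 2 ^ (k₀ + b) := by ring
      _ ≤ _ := by linarith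
  have h₃ : (0 : ℝ) ≤ (2 ^ b - 1) * (2 ^ k₀ / 2 ^ p) := by
    have : (1 : ℝ) ≤ 2 ^ b := one_le_pow₀ one_le_two
    exact mul_nonneg (by linarith) (by positivity)
  calc blockScale p k₀ b m = 4 ^ m * (2 * ((2 ^ b - 1) * (2 ^ k₀ / 2 ^ p))) := by
        rw [blockScale]; ring
    _ ≤ (2 * d) ^ 2 * (2 * (2 * Λ)) := by gcongr
    _ = _ := by ring

/-- If the truncated entries vanish, nothing needs to be done. -/
theorem simulates_nil {n d c w p : ℕ} (hd : 0 < d) {t ε : ℝ} (ht : 0 < t) (hε : 0 < ε)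
    {H : Matrix (Fin (2 ^ n)) (Fin (2 ^ n)) ℂ} (hH : H.IsHermitian) (hs : IsSparse d H)
    (h : ∀ u v, d * t * ‖H u v‖ ≤ ε) :
    Simulates p (Circuit.relabel (labEquiv n c w 0 0 0 0) ([] : Circuit n c w _)) H t ε := by
  apply simulates_of_norm_le
  have h₁ := time_mul_norm_le_of_sparse hd ht hs (fun _ _ => id) h hε.le
  have h₂ := norm_evolution_sub_le hH (Matrix.isHermitian_zero (n := Fin (2 ^ n)) (α := ℂ)) ht.le
  have h₃ : evolution (0 : Matrix (Fin (2 ^ n)) (Fin (2 ^ n)) ℂ) t = 1 := by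
    rw [evolution, smul_zero, NormedSpace.exp_zero]
  rw [h₃, sub_zero] at h₂
  refine (error_trans (x := 0) (V' := 1) ?_ (l2_opNorm_le_one_of_isometry embedNum_isometry)
    h₂).trans (by linarith)
  rw [Circuit.matrix_nil, Matrix.one_mul, Matrix.mul_one, sub_self, norm_zero]

/-- The error of the whole circuit, for suitable parameters. -/
theorem simulates_iterate {n d p w k₀ b K r m : ℕ} [NeZero n] [NeZero (8 * b)] (hd : 0 < d)
    (hb : 0 < b) (hw : k₀ + b ≤ w) (hm : m = min (Nat.clog 2 d) n) {t ε y : ℝ} (ht : 0 < t)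
    (hε : 0 < ε) (hy : 1 ≤ y) (hr : 0 < r)
    (hx : blockScale p k₀ b m * (t / r) ≤ 1 / 2) (hrK : r ≤ 33 * (y * ε))
    (hK : 1056 * y ≤ K.factorial) (hk : d * t * (2 * ((2 ^ k₀ - 1) / 2 ^ p)) ≤ ε / 4)
    {H : Matrix (Fin (2 ^ n)) (Fin (2 ^ n)) ℂ} (hH : H.IsHermitian) (hs : IsSparse d H)
    (htrunc : ∀ u v, d * t * ‖H u v - trunc p (H u v)‖ ≤ ε / 2)
    (hmag : ∀ u v, magnitude p (H u v).re < 2 ^ (k₀ + b) ∧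
      magnitude p (H u v).im < 2 ^ (k₀ + b)) :
    Simulates p (Circuit.relabel (labEquiv n (Nat.clog 2 d) w m (8 * b) K _)
      (Circuit.iterate r (segmentCircuit (slotWeight b)
        (lcuWeight (blockScale p k₀ b m * (t / r)) K) (firstPhases hw) (secondPhases hw) m K)))
      H t ε := by
  apply simulates_of_norm_le
  refine (iterate_segmentCircuit_error (hm ▸ min_le_left _ _) hb hw hH
    (fun u => hm ▸ ncard_le_two_pow_min (hs.1 u)) ht hr hx K).trans ?_
  have h₁ := time_mul_norm_sub_rounded_le hd ht hε hs htrunc hmag hk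
  have hfac : (0 : ℝ) < K.factorial := by linarith
  have hη : (2 : ℝ) / K.factorial ≤ 1 / (528 * y) := by
    rw [div_le_div_iff₀ hfac (by positivity)]; linarith
  have hη1 : 1 / (528 * y) ≤ 1 := by
    rw [div_le_one (by positivity)]; linarith
  have hη0 : (0 : ℝ) ≤ 2 / K.factorial := by positivity
  -- The remaining `ε / 4` of the budget: since `η ≤ 1` the segment error is at most `4η`, and `33 ·
  -- 4 / 528 = 1 / 4`.
  have h₂ : 3 * (2 / (K.factorial : ℝ)) + (2 / K.factorial) ^ 2 ≤ 4 * (1 / (528 * y)) := by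
    nlinarith
  have h₃ : (r : ℝ) * (3 * (2 / (K.factorial : ℝ)) + (2 / K.factorial) ^ 2) ≤
      33 * (y * ε) * (4 * (1 / (528 * y))) := by gcongr
  have h₄ : 33 * (y * ε) * (4 * (1 / (528 * y))) = ε / 4 := by field_simp; norm_num
  linarith

end HamSim

end

/-! ### Assembly of the parameters. -/

theorem theorem1 :
    ∃ C : ℝ, ∀ (n d p w : ℕ) (Λ t ε τ : ℝ),
      1 ≤ n → 0 < t → 0 < ε →
      τ = (d : ℝ) ^ 2 * Λ * t → 1 ≤ τ → Real.exp 1 < τ / ε →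
      Λ * 2 ^ p < 2 ^ w →
      ∃ (a : ℕ) (K : HamSim.Circuit n (Nat.clog 2 d) w (Fin n ⊕ Fin a)),
        (K.queries : ℝ) ≤ C * (τ * (Real.log (τ / ε) / Real.log (Real.log (τ / ε)))) ∧
        (K.gates : ℝ) ≤ C * (τ * (Real.log (τ / ε) ^ 2 / Real.log (Real.log (τ / ε))) * n) ∧
        ∀ H : Matrix (Fin (2 ^ n)) (Fin (2 ^ n)) ℂ,
          H.IsHermitian → HamSim.IsSparse d H → HamSim.maxNorm H ≤ Λ →
          (∀ u v, d * t * ‖H u v - HamSim.trunc p (H u v)‖ ≤ ε / 2) →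
          HamSim.Simulates p K H t ε := by
  -- The constant comes from the gate count: `33 * 17 * 4340`, for the number of segments, the
  -- degree, and the gates per block and segment. The query count needs only `33 * 12 * 17`.
  refine ⟨2434740, fun n d p w Λ t ε τ hn ht hε hτ hτ1 hy hw => ?_⟩
  set y := τ / ε with hydef
  have hy0 : 0 < y := (Real.exp_pos 1).trans hy
  set L := Real.log y with hLdef
  have hL : 1 < L := (Real.lt_log_iff_exp_lt hy0).2 hy
  have hexpL : Real.exp L = y := Real.exp_log hy0
  have hl : 0 < Real.log L := Real.log_pos hL
  have hyε : y * ε = τ := div_mul_cancel₀ τ hε.ne'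
  have hd : 0 < d := by
    rcases Nat.eq_zero_or_pos d with h | h
    · subst h
      norm_num at hτ
      linarith
    · exact h
  have hd1 : (1 : ℝ) ≤ d := by exact_mod_cast hd
  have hΛ : 0 < Λ := by
    by_contra h
    have : (d : ℝ) ^ 2 * Λ * t ≤ 0 :=
      mul_nonpos_of_nonpos_of_nonneg (mul_nonpos_of_nonneg_of_nonpos (by positivity)
        (not_lt.1 h)) ht.le
    linarith
  have habs : ∀ H : Matrix (Fin (2 ^ n)) (Fin (2 ^ n)) ℂ, HamSim.maxNorm H ≤ Λ → ∀ u v,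
      HamSim.magnitude p (H u v).re ≤ ⌊2 ^ p * Λ⌋₊ ∧
        HamSim.magnitude p (H u v).im ≤ ⌊2 ^ p * Λ⌋₊ := by
    intro H hH u v
    have h := (HamSim.norm_le_maxNorm H u v).trans hH
    exact ⟨HamSim.magnitude_le ((Complex.abs_re_le_norm _).trans h),
      HamSim.magnitude_le ((Complex.abs_im_le_norm _).trans h)⟩
  -- In this case every truncated entry is zero, so the accuracy hypothesis bounds the entries of
  -- `H` themselves and the empty circuit is good enough.
  by_cases hsmall : 2 ^ p * Λ < 1
  · refine ⟨_, HamSim.Circuit.relabel (HamSim.labEquiv n (Nat.clog 2 d) w 0 0 0 0) [], ?_, ?_, ?_⟩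
    · rw [HamSim.Circuit.relabel_queries, HamSim.Circuit.queries_nil, Nat.cast_zero]
      positivity
    · rw [HamSim.Circuit.relabel_gates, HamSim.Circuit.gates_nil, Nat.cast_zero]
      positivity
    · intro H hH hs hmax htrunc
      refine HamSim.simulates_nil hd ht hε hH hs fun u v => ?_
      have h0 : ⌊2 ^ p * Λ⌋₊ = 0 := Nat.floor_eq_zero.2 hsmall
      obtain ⟨h₁, h₂⟩ := habs H hmax u v
      rw [h0, Nat.le_zero] at h₁ h₂
      have h₃ : HamSim.trunc p (H u v) = 0 := by
        apply Complex.ext <;> simp [HamSim.trunc, HamSim.truncReal, h₁, h₂]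
      have h₄ := htrunc u v
      rw [h₃, sub_zero] at h₄
      linarith
  have hbig : 1 ≤ 2 ^ p * Λ := not_lt.1 hsmall
  obtain ⟨K, hK1, hK, hfac⟩ := HamSim.exists_order hL
  obtain ⟨b₀, hb₀, hb₀L, hb₀y⟩ := HamSim.exists_precision hL
  rw [hexpL] at hfac hb₀y
  -- The number of magnitude bits that can be nonzero. Only these matter for the normalization,
  -- which must depend on `Λ` and not on the width `w` of the register.
  set s := Nat.size ⌊2 ^ p * Λ⌋₊ with hsdef
  have hs2 : (2 : ℝ) ^ s ≤ 2 * (2 ^ p * Λ) := HamSim.two_pow_size_le hbig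
  have hs0 : 0 < s := Nat.size_pos.2 (Nat.floor_pos.2 hbig)
  have hsw : s ≤ w := by
    rw [hsdef, Nat.size_le, Nat.floor_lt (by positivity)]
    push_cast
    linarith
  -- Keep the leading `b₀` of the `s` bits, or all of them if there are fewer; in the latter case
  -- nothing is lost.
  obtain ⟨b, k₀, hb, hkb, hbb, hk₀⟩ :
      ∃ b k₀ : ℕ, 0 < b ∧ k₀ + b = s ∧ b ≤ b₀ ∧ (k₀ = 0 ∨ b = b₀) := by
    rcases le_total s b₀ with h | h
    · exact ⟨s, 0, hs0, by omega, h, Or.inl rfl⟩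
    · exact ⟨b₀, s - b₀, hb₀, by omega, le_rfl, Or.inr rfl⟩
  have hkw : k₀ + b ≤ w := hkb ▸ hsw
  have hnz : NeZero n := ⟨by omega⟩
  have hbz : NeZero (8 * b) := ⟨by omega⟩
  set m := min (Nat.clog 2 d) n with hm
  set α := HamSim.blockScale p k₀ b m with hα
  have hα0 : 0 < α := HamSim.blockScale_pos hb
  have hαle : α * t ≤ 16 * τ := by
    have h := HamSim.blockScale_le (m := m) hd (min_le_left _ _) (hkb.symm ▸ hs2)
    calc α * t ≤ 16 * ((d : ℝ) ^ 2 * Λ) * t := by gcongr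
      _ = 16 * τ := by rw [hτ]; ring
  -- Twice the rescaled time, so that each segment has `x = α * (t / r) ≤ 1 / 2`. The ceiling is
  -- absorbed by `τ ≥ 1`: `2 * 16 + 1 = 33`.
  set r := ⌈2 * (α * t)⌉₊ with hr
  have hr0 : 0 < r := Nat.ceil_pos.2 (by positivity)
  have hr0' : (0 : ℝ) < r := by exact_mod_cast hr0
  have hrle : (r : ℝ) ≤ 33 * τ := by
    have := Nat.ceil_lt_add_one (show 0 ≤ 2 * (α * t) by positivity)
    linarith
  have hx : α * (t / r) ≤ 1 / 2 := by
    have h : 2 * (α * t) ≤ r := Nat.le_ceil _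
    rw [mul_div_assoc', div_le_iff₀ hr0']
    linarith
  have hk : (d : ℝ) * t * (2 * ((2 ^ k₀ - 1) / 2 ^ p)) ≤ ε / 4 := by
    rcases hk₀ with h | h
    · rw [h]
      norm_num
      linarith
    · have h₁ : (2 : ℝ) ^ k₀ * 2 ^ b₀ ≤ 2 * (2 ^ p * Λ) := by
        rw [← pow_add, ← h, hkb]; exact hs2
      -- The `b₀` kept bits make the discarded part smaller than `2Λ` by the factor `2 ^ b₀ ≥ 16y`;
      -- the `16` yields exactly `ε / 4` below.
      have h₂ : ((2 : ℝ) ^ k₀ - 1) / 2 ^ p ≤ 2 * Λ / (16 * y) := by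
        rw [div_le_div_iff₀ (by positivity) (by positivity)]
        calc ((2 : ℝ) ^ k₀ - 1) * (16 * y) ≤ 2 ^ k₀ * 2 ^ b₀ := by gcongr; linarith
          _ ≤ _ := by linarith
      have h₃ : (d : ℝ) * Λ * t ≤ τ := by
        rw [hτ]
        gcongr
        nlinarith
      calc (d : ℝ) * t * (2 * ((2 ^ k₀ - 1) / 2 ^ p))
          ≤ d * t * (2 * (2 * Λ / (16 * y))) := by gcongr
        _ = d * Λ * t / (4 * y) := by field_simp; norm_num
        _ ≤ τ / (4 * y) := by gcongr
        _ = ε / 4 := by rw [← hyε]; field_simp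
  refine ⟨_, HamSim.Circuit.relabel (HamSim.labEquiv n (Nat.clog 2 d) w m (8 * b) K _)
    (HamSim.Circuit.iterate r (HamSim.segmentCircuit (HamSim.slotWeight b)
      (HamSim.lcuWeight (α * (t / r)) K) (HamSim.firstPhases hkw) (HamSim.secondPhases hkw) m K)),
    ?_, ?_, ?_⟩
  · rw [HamSim.Circuit.relabel_queries, HamSim.Circuit.iterate_queries,
      HamSim.segmentCircuit_queries]
    push_cast
    calc (r : ℝ) * (12 * K) ≤ 33 * τ * (12 * (17 * (L / Real.log L))) := by gcongr
      _ = 6732 * (τ * (L / Real.log L)) := by ring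
      _ ≤ _ := by gcongr; norm_num
  · rw [HamSim.Circuit.relabel_gates, HamSim.Circuit.iterate_gates]
    have h := HamSim.segmentCircuit_gates (c := Nat.clog 2 d) (w := w) hK1
      (show m ≤ n from min_le_right _ _) (HamSim.slotWeight b) (HamSim.lcuWeight (α * (t / r)) K)
      (HamSim.firstPhases hkw) (HamSim.secondPhases hkw)
    have h' : (HamSim.Circuit.gates (HamSim.segmentCircuit (HamSim.slotWeight b)
      (HamSim.lcuWeight (α * (t / r)) K) (HamSim.firstPhases (c := Nat.clog 2 d) (n := n) hkw)
        (HamSim.secondPhases hkw) m K) : ℝ) ≤ K * (292 * n + 46 * (8 * b)) := by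
      exact_mod_cast h
    have hn1 : (1 : ℝ) ≤ n := by exact_mod_cast hn
    have hbL : (b : ℝ) ≤ 11 * L := le_trans (by exact_mod_cast hbb) hb₀L
    -- Here `b ≤ 11L`, so the second term is at most `4048 L`. Both `n` and `L` are bounded by `L *
    -- n`, which gives `292 + 4048 = 4340`.
    have hsum : (292 * n + 46 * (8 * b) : ℝ) ≤ 4340 * (L * n) := by
      have h₁ : (n : ℝ) ≤ L * n := by nlinarith
      have h₂ : L ≤ L * n := by nlinarith
      linarith
    push_cast
    calc (r : ℝ) * _ ≤ 33 * τ * (17 * (L / Real.log L) * (4340 * (L * n))) := by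
          refine mul_le_mul hrle (h'.trans ?_) (Nat.cast_nonneg _) (by positivity)
          gcongr
      _ = _ := by ring
  · intro H hH hsp hmax htrunc
    refine HamSim.simulates_iterate hd hb hkw hm ht hε ?_ hr0 hx (by rw [hyε]; exact hrle) hfac hk
      hH hsp htrunc fun u v => ?_
    · linarith [Real.add_one_le_exp 1]
    · obtain ⟨h₁, h₂⟩ := habs H hmax u v
      rw [hkb]
      exact ⟨h₁.trans_lt (Nat.lt_size_self _), h₂.trans_lt (Nat.lt_size_self _)⟩
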